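/- Let $(\mathbb I_1,\mu_1)$ and $(\mathbb I_2,\mu_2)$ be standard probability spaces (standard Borel spaces with Borel probability measures), let $d\ge 0$ be an integer, and let $\boldsymbol w\in L^\infty(\mathbb I_1\times\mathbb I_1;\mathbb R^d)$ and $\boldsymbol u\in L^\infty(\mathbb I_2\times\mathbb I_2;\mathbb R^d)$ be kernels with $|\boldsymbol w|\le 1$ and $|\boldsymbol u|\le 1$ almost everywhere; $\boldsymbol e_1,\dots,\boldsymbol e_d$ is the standard basis of $\mathbb R^d$. Then the following are equivalent. (1) $\boldsymbol t(T,\boldsymbol w)=\boldsymbol t(T,\boldsymbol u)$ for every finite oriented tree $T$. (2) $\nu_{\boldsymbol w}=\nu_{\boldsymbol u}$. (3) The quotient kernels $\boldsymbol w/\mathscr C(\boldsymbol w)$ and $\boldsymbol u/\mathscr C(\boldsymbol u)$ are isomorphic. (4) There is a coupling $\gamma$ of $\mu_1$ and $\mu_2$ such that $T_{\langle \boldsymbol e,\boldsymbol w\rangle}\circ T_\gamma=T_\gamma\circ T_{\langle \boldsymbol e,\boldsymbol u\rangle}$ on $L^2(\mathbb I_2)$ and $T_{\gamma^{T}}\circ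 T_{\langle \boldsymbol e,\boldsymbol w\rangle}=T_{\langle \boldsymbol e,\boldsymbol u\rangle}\circ T_{\gamma^{T}}$ on $L^2(\mathbb I_1)$ for all $\boldsymbol e\in\mathbb R^d$. (5) There are a relatively complete $\boldsymbol w$-invariant sub-$\sigma$-algebra $\mathscr C$ and a relatively complete $\boldsymbol u$-invariant sub-$\sigma$-algebra $\mathscr D$ such that $\delta_\square(\boldsymbol w_{\mathscr C},\boldsymbol u_{\mathscr D})=0$. Here the notation is as follows, for a standard probability space $(\mathbb I,\mathscr B,\mu)$ and a kernel $\boldsymbol w$ on it as above. An oriented tree $T$ has a finite vertex set $\mathsf v(T)$ and a set $\mathsf e(T)\subset \mathsf v(T)\times\mathsf v(T)$ of directed edges that never contains both $(i,j)$ and $(j,i)$, and its underlying undirected graph is a tree; $\boldsymbol t(T,\boldsymbol w)=\int_{\mathbb I^{\mathsf v(T)}}\bigotimes_{(i,j)\in\mathsf e(T)}\boldsymbol w(\xi_i,\xi_j)\prod_{i}d\mu(\xi_i)\in(\mathbb R^d)^{\otimes\mathsf e(T)}$. Put $\boldsymbol w^T(\xi,\zeta)=\boldsymbol w(\zeta,\xi)$,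 and $(T_kf)(\xi)=\int k(\xi,\zeta)f(\zeta)\,d\mu(\zeta)$ for a scalar kernel $k$. A coupling $\gamma$ of $\mu_1,\mu_2$ is a measure on $\mathbb I_1\times\mathbb I_2$ with marginals $\mu_1,\mu_2$; $(T_\gamma f)(\xi)=\int f(\zeta)\,\gamma(\xi,d\zeta)$, where $\gamma(d\xi,d\zeta)=\mu_1(d\xi)\,\gamma(\xi,d\zeta)$; and $\gamma^T$ is the image of $\gamma$ under exchange of the coordinates. For a measurable space $X$ let $\mathcal M_{\le1}(X)$ be the set of signed measures on $X$ of total variation at most $1$. Let $P^0$ be a point, $\mathbb M_n=\prod_{i\le n}P^i$, $P^{n+1}=(\mathcal M_{\le1}(\mathbb M_n))^{2d}$, and $\mathbb M=\prod_{n\ge 0}P^n$, with the Borel $\sigma$-algebras of the weak-* and product topologies (those generated by the evaluations $m\mapsto m(A)$ and the coordinates). Let $i_{\boldsymbol w}:\mathbb I\to\mathbb M$ be the map whose components are defined inductively by $i_{\boldsymbol w}(\xi)(n+1)(l)(A)=\int_{i_{\boldsymbol w,n}^{-1}(A)}\langle \boldsymbol e_l,\boldsymbol w(\xi,\zeta)\rangle\,d\mu(\zeta)$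 for $1\le l\le d$, and by the same formula with $\boldsymbol e_{l-d}$ and $\boldsymbol w^T$ for $d<l\le 2d$, where $i_{\boldsymbol w,n}:\mathbb I\to\mathbb M_n$ consists of the components of index at most $n$. Then $\nu_{\boldsymbol w}$ is the law of $i_{\boldsymbol w}$ under $\mu$. A sub-$\sigma$-algebra $\mathscr C\subset\mathscr B$ is relatively complete if every $Z\in\mathscr B$ that differs by a $\mu$-null set from a member of $\mathscr C$ belongs to $\mathscr C$. A pair $(\mathscr D,\mathscr E)$ is $\boldsymbol w$-invariant if $T_{\langle\boldsymbol e,\boldsymbol w\rangle}$ and $T_{\langle\boldsymbol e,\boldsymbol w^T\rangle}$ map $L^2(\mathbb I,\mathscr D)$ into $L^2(\mathbb I,\mathscr E)$ for all $\boldsymbol e$, and $\mathscr C$ is $\boldsymbol w$-invariant if $(\mathscr C,\mathscr C)$ is. Let $\mathscr C_0^{\boldsymbol w}$ consist of the sets of measure $0$ or $1$, let $\mathscr C_{n+1}^{\boldsymbol w}$ be the intersection of all relatively complete $\mathscr E$ such that $(\mathscr C_n^{\boldsymbol w},\mathscr E)$ is $\boldsymbol w$-invariant, and let $\mathscr C(\boldsymbol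 w)$ be the smallest relatively complete sub-$\sigma$-algebra containing all $\mathscr C_n^{\boldsymbol w}$. Put $\boldsymbol w_{\mathscr C}=\mathbb E(\boldsymbol w\mid\mathscr C\times\mathscr C)$. For $\mathscr C$ relatively complete, the quotient $\mathbb I/\mathscr C$ is the standard probability space, unique up to isomorphism modulo null sets, with a measure preserving map $q:\mathbb I\to\mathbb I/\mathscr C$ such that $\mathscr C$ consists, up to null sets, of the preimages of measurable sets; $\boldsymbol w/\mathscr C$ is the kernel on it with $\boldsymbol w_{\mathscr C}(\xi,\zeta)=(\boldsymbol w/\mathscr C)(q(\xi),q(\zeta))$ almost everywhere. Two kernels are isomorphic if an isomorphism modulo null sets of the underlying probability spaces carries one to the other almost everywhere. Finally, $\|\boldsymbol w\|_\square=\sup\langle \boldsymbol e,\int_{S\times T}\boldsymbol w\rangle$ over $|\boldsymbol e|\le1$ and measurable $S,T\subset\mathbb I$. If $\mathbb I_1,\mathbb I_2$ are atomless, $\delta_\square(\boldsymbol w,\boldsymbol u)=\inf_\Phi\|\boldsymbol w-\boldsymbol u(\Phi(\cdot),\Phi(\cdot))\|_\square$ over all measure preserving bijections $\Phi:\mathbb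 I_1\to\mathbb I_2$; otherwise $\delta_\square(\boldsymbol w,\boldsymbol u)$ is understood as the same distance between the extensions of $\boldsymbol w,\boldsymbol u$ to $\mathbb I_1\times[0,1]$ and $\mathbb I_2\times[0,1]$ that do not depend on the second coordinates. -/

import Mathlib

open MeasureTheory

namespace FracIso

noncomputable section

universe u v

/-! ### Kernels and their operators

A kernel in `L^∞(I × I; ℝ^d)` is given by a measurable representative
`w : I × I → EuclideanSpace ℝ (Fin d)`. -/

/-- The transposed kernel `w^T(ξ, ζ) = w(ζ, ξ)`. -/
def transposeKernel {I : Type u} {E : Type v} (w : I × I → E) : I × I → E :=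
  fun p => w (p.2, p.1)

/-- The scalar kernel `⟨e, w⟩`. -/
def scalarKernel {I : Type u} {d : ℕ} (e : EuclideanSpace ℝ (Fin d))
    (w : I × I → EuclideanSpace ℝ (Fin d)) : I × I → ℝ :=
  fun p => inner ℝ e (w p)

/-- The adjacency operator of a scalar kernel: `(T_k f)(ξ) = ∫ k(ξ, ζ) f(ζ) dμ(ζ)`. -/
def adjOp {I : Type u} {mI : MeasurableSpace I} (μ : Measure I) (k : I × I → ℝ) (f : I → ℝ) : I → ℝ :=
  fun ξ => ∫ ζ, k (ξ, ζ) * f ζ ∂μ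

/-! ### Oriented trees and tensorized homomorphism densities -/

/-- An oriented simple graph on the vertex set `V`. -/
structure OrientedGraph (V : Type) where
  /-- the directed edges -/
  edges : Finset (V × V)
  asymm : ∀ i j : V, (i, j) ∈ edges → (j, i) ∉ edges

/-- The underlying undirected graph. -/
def OrientedGraph.toSimpleGraph {V : Type} (F : OrientedGraph V) : SimpleGraph V :=
  SimpleGraph.fromRel fun i j => (i, j) ∈ F.edges

/-- An oriented tree is an oriented simple graph whose underlying undirected graph is a tree. -/
def OrientedGraph.IsOrientedTree {V : Type} (F : OrientedGraph V) : Prop :=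
  F.toSimpleGraph.IsTree

/-- The Hilbert tensor power `(ℝ^d)^{⊗ S}` of `ℝ^d` over a finite index set `S`, in coordinates with
respect to the orthonormal basis of tensors `⨂_{s} e_{l s}`, `l : S → Fin d`. -/
abbrev TensorPower (d : ℕ) (S : Type) [Fintype S] [DecidableEq S] : Type :=
  EuclideanSpace ℝ (S → Fin d)

/-- The elementary tensor `⨂_{s} x s`. -/
def pureTensor {d : ℕ} {S : Type} [Fintype S] [DecidableEq S]
    (x : S → EuclideanSpace ℝ (Fin d)) : TensorPower d S :=
  WithLp.toLp 2 fun l => ∏ s, x s (l s)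

/-- The tensorized homomorphism density
`t(F, w) = ∫_{I^V} ⨂_{(i,j) ∈ e(F)} w(ξ_i, ξ_j) ∏_i dξ_i`. -/
def homDensity {I : Type u} [MeasurableSpace I] (μ : Measure I) [IsProbabilityMeasure μ]
    {d : ℕ} {V : Type} [Fintype V] [DecidableEq V] (F : OrientedGraph V)
    (w : I × I → EuclideanSpace ℝ (Fin d)) : TensorPower d F.edges :=
  ∫ ξ : V → I, pureTensor (fun e : F.edges => w (ξ e.1.1, ξ e.1.2)) ∂(Measure.pi fun _ => μ)

/-! ### Distributions on iterated degree measures -/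

/-- `M_{≤1}(X)`: signed measures on `X` of total variation at most `1`. -/
def UnitSigned (X : Type) [MeasurableSpace X] : Type :=
  {m : SignedMeasure X // m.totalVariation Set.univ ≤ 1}

/-- The `σ`-algebra on `M_{≤1}(X)` generated by the evaluations `m ↦ m A`, for measurable `A`. For `X`
compact metrizable this is the Borel `σ`-algebra of the weak-* topology. -/
instance (X : Type) [MeasurableSpace X] : MeasurableSpace (UnitSigned X) :=
  ⨆ A : {A : Set X // MeasurableSet A},
    MeasurableSpace.comap (fun m : UnitSigned X => m.1 A.1) inferInstance

/-- The spaces `M_n` with their `σ`-algebras: `M_0` is a point, and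
`M_{n+1} = M_n × (M_{≤1}(M_n))^{2d}`; the index set `Fin d ⊕ Fin d` stands for `{1, …, 2d}`. -/
def iterLevel (d : ℕ) : ℕ → (X : Type) × MeasurableSpace X
  | 0 => ⟨PUnit, inferInstance⟩
  | n + 1 =>
    letI : MeasurableSpace (iterLevel d n).1 := (iterLevel d n).2
    ⟨(iterLevel d n).1 × (Fin d ⊕ Fin d → UnitSigned (iterLevel d n).1), inferInstance⟩

/-- `M_n = ∏_{i ≤ n} P^i`. -/
def IterSpace (d n : ℕ) : Type := (iterLevel d n).1

instance (d n : ℕ) : MeasurableSpace (IterSpace d n) := (iterLevel d n).2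

/-- `P^0` is a point and `P^{n+1} = (M_{≤1}(M_n))^{2d}`. -/
def IterFactor (d : ℕ) : ℕ → Type
  | 0 => PUnit
  | n + 1 => Fin d ⊕ Fin d → UnitSigned (IterSpace d n)

instance (d : ℕ) : (n : ℕ) → MeasurableSpace (IterFactor d n)
  | 0 => inferInstanceAs (MeasurableSpace PUnit)
  | n + 1 => inferInstanceAs (MeasurableSpace (Fin d ⊕ Fin d → UnitSigned (IterSpace d n)))

/-- `M = ∏_{n} P^n`, with the product `σ`-algebra. -/
abbrev DegreeSpace (d : ℕ) : Type := (n : ℕ) → IterFactor d n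

/-- The truncation of a real number to `[-1, 1]`. -/
def clip (x : ℝ) : ℝ := max (-1) (min 1 x)

theorem abs_clip_le (x : ℝ) : |clip x| ≤ 1 := by
  unfold clip
  rw [abs_le]
  constructor
  · exact le_max_left _ _
  · exact max_le (by norm_num) (min_le_left _ _)

/-- The image under `g` of the signed measure with density `clip ∘ f` with respect to `μ`. -/
def pushDensity {I : Type u} [MeasurableSpace I] (μ : Measure I) {X : Type} [MeasurableSpace X]
    (g : I → X) (f : I → ℝ) : SignedMeasure X :=
  (μ.withDensityᵥ fun ζ => clip (f ζ)).map g

theorem pushDensity_totalVariation_le {I : Type u} [MeasurableSpace I] (μ : Measure I)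
    [IsProbabilityMeasure μ] {X : Type} [MeasurableSpace X] (g : I → X) (f : I → ℝ) :
    (pushDensity μ g f).totalVariation Set.univ ≤ 1 := by
  rw [SignedMeasure.totalVariation_eq_variation]
  have h1 : (μ.withDensityᵥ fun ζ => clip (f ζ)).variation ≤ μ := by
    apply VectorMeasure.variation_le_of_forall_enorm_le
    intro E hE
    by_cases hf : Integrable (fun ζ => clip (f ζ)) μ
    · rw [withDensityᵥ_apply hf hE]
      refine (enorm_integral_le_lintegral_enorm _).trans ?_
      calc ∫⁻ a in E, ‖clip (f a)‖ₑ ∂μ ≤ ∫⁻ _ in E, 1 ∂μ := by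
            refine lintegral_mono fun a => ?_
            rw [Real.enorm_eq_ofReal_abs]
            exact ENNReal.ofReal_le_one.2 (abs_clip_le _)
        _ = μ E := by simp
    · simp [Measure.withDensityᵥ, hf]
  by_cases hg : Measurable g
  · calc (pushDensity μ g f).variation Set.univ
        ≤ ((μ.withDensityᵥ fun ζ => clip (f ζ)).variation.map g) Set.univ :=
          VectorMeasure.variation_map_le Set.univ
      _ ≤ (μ.map g) Set.univ := Measure.map_mono h1 hg Set.univ
      _ = 1 := by rw [Measure.map_apply hg MeasurableSet.univ]; simp
  · simp [pushDensity, VectorMeasure.map, hg]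

/-- The signed measure `A ↦ ∫_{g⁻¹(A)} f dμ` on `X`, for `f` with values in `[-1, 1]` almost
everywhere. The truncation changes `f` on a null set only, and makes the value an element of
`M_{≤1}(X)` for every `f`. -/
def degreeMeasure {I : Type u} [MeasurableSpace I] (μ : Measure I) [IsProbabilityMeasure μ]
    {X : Type} [MeasurableSpace X] (g : I → X) (f : I → ℝ) : UnitSigned X :=
  ⟨pushDensity μ g f, pushDensity_totalVariation_le μ g f⟩

/-- The component of index `n + 1` of the iterated degree map, given the map `g` into `M_n`: for
`l ≤ d` the measure `A ↦ ∫_{g⁻¹(A)} ⟨e_l, w(ξ, ζ)⟩ dμ(ζ)`, then the same with `w^T`. -/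
def nextDegree {I : Type u} [MeasurableSpace I] (μ : Measure I) [IsProbabilityMeasure μ] {d : ℕ}
    (w : I × I → EuclideanSpace ℝ (Fin d)) {X : Type} [MeasurableSpace X] (g : I → X) (ξ : I) :
    Fin d ⊕ Fin d → UnitSigned X
  | Sum.inl l => degreeMeasure μ g fun ζ => w (ξ, ζ) l
  | Sum.inr l => degreeMeasure μ g fun ζ => transposeKernel w (ξ, ζ) l

/-- The maps `i_{w,n} : I → M_n`. -/
def iterMap {I : Type u} [MeasurableSpace I] (μ : Measure I) [IsProbabilityMeasure μ] {d : ℕ}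
    (w : I × I → EuclideanSpace ℝ (Fin d)) : (n : ℕ) → I → IterSpace d n
  | 0 => fun _ => PUnit.unit
  | n + 1 => fun ξ => (iterMap μ w n ξ, nextDegree (X := IterSpace d n) μ w (iterMap μ w n) ξ)

/-- The map `i_w : I → M`. -/
def degreeMap {I : Type u} [MeasurableSpace I] (μ : Measure I) [IsProbabilityMeasure μ] {d : ℕ}
    (w : I × I → EuclideanSpace ℝ (Fin d)) (ξ : I) : DegreeSpace d
  | 0 => PUnit.unit
  | n + 1 => nextDegree μ w (iterMap μ w n) ξ

/-- The distribution on iterated degree measures `ν_w`: the law of `i_w`. -/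
def degreeLaw {I : Type u} [MeasurableSpace I] (μ : Measure I) [IsProbabilityMeasure μ] {d : ℕ}
    (w : I × I → EuclideanSpace ℝ (Fin d)) : Measure (DegreeSpace d) :=
  μ.map (degreeMap μ w)

/-! ### Invariant sub-`σ`-algebras -/

/-- Relative completeness of a sub-`σ`-algebra `C`: a measurable set which agrees with a member
of `C` up to a null set is a member of `C`. -/
def IsRelComplete {I : Type u} {mI : MeasurableSpace I} (μ : Measure I) (C : MeasurableSpace I) : Prop :=
  ∀ Z Z₀ : Set I, MeasurableSet[mI] Z → MeasurableSet[C] Z₀ → μ (Z \ Z₀) = 0 → μ (Z₀ \ Z) = 0 →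
    MeasurableSet[C] Z

/-- `(D, E)` is a `w`-invariant pair: `T_{⟨e,w⟩}` and `T_{⟨e,w^T⟩}` map `L²(D)` into `L²(E)` for
every `e`. -/
def IsInvariantPair {I : Type u} {mI : MeasurableSpace I} (μ : Measure I) {d : ℕ}
    (w : I × I → EuclideanSpace ℝ (Fin d)) (D E : MeasurableSpace I) : Prop :=
  ∀ f : I → ℝ, Measurable[D] f → MemLp f 2 μ → ∀ e : EuclideanSpace ℝ (Fin d),
    AEStronglyMeasurable[E] (adjOp μ (scalarKernel e w) f) μ ∧
    AEStronglyMeasurable[E] (adjOp μ (scalarKernel e (transposeKernel w)) f) μ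

/-- `C` is a relatively complete `w`-invariant sub-`σ`-algebra. -/
structure IsInvariantAlgebra {I : Type u} {mI : MeasurableSpace I} (μ : Measure I) {d : ℕ}
    (w : I × I → EuclideanSpace ℝ (Fin d)) (C : MeasurableSpace I) : Prop where
  le : C ≤ mI
  relComplete : IsRelComplete μ C
  invariant : IsInvariantPair μ w C C

/-- The smallest relatively complete sub-`σ`-algebra that contains the family `S`. -/
@[reducible] def relGenerated {I : Type u} {mI : MeasurableSpace I} (μ : Measure I) (S : Set (Set I)) :
    MeasurableSpace I :=
  sInf {E | E ≤ mI ∧ IsRelComplete μ E ∧ ∀ s ∈ S, MeasurableSet[E] s}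

/-- `m(D)`: the intersection of all relatively complete sub-`σ`-algebras `E` such that `(D, E)` is
a `w`-invariant pair. -/
@[reducible] def nextAlgebra {I : Type u} {mI : MeasurableSpace I} (μ : Measure I) {d : ℕ}
    (w : I × I → EuclideanSpace ℝ (Fin d)) (D : MeasurableSpace I) : MeasurableSpace I :=
  sInf {E | E ≤ mI ∧ IsRelComplete μ E ∧ IsInvariantPair μ w D E}

/-- The canonical sequence `C_n^w`. -/
@[reducible] def canonicalSeq {I : Type u} {mI : MeasurableSpace I} (μ : Measure I) {d : ℕ}
    (w : I × I → EuclideanSpace ℝ (Fin d)) : ℕ → MeasurableSpace I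
  | 0 => relGenerated μ {∅, Set.univ}
  | n + 1 => nextAlgebra μ w (canonicalSeq μ w n)

/-- The canonical sub-`σ`-algebra `C(w)`. -/
@[reducible] def canonicalAlgebra {I : Type u} {mI : MeasurableSpace I} (μ : Measure I) {d : ℕ}
    (w : I × I → EuclideanSpace ℝ (Fin d)) : MeasurableSpace I :=
  relGenerated μ {s | ∃ n, MeasurableSet[canonicalSeq μ w n] s}

/-- The averaged kernel `w_C = E(w | C × C)`. -/
def average {I : Type u} (C : MeasurableSpace I) {mI : MeasurableSpace I} (μ : Measure I)
    {d : ℕ} (w : I × I → EuclideanSpace ℝ (Fin d)) : I × I → EuclideanSpace ℝ (Fin d) :=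
  condExp (C.prod C) (μ.prod μ) w

/-! ### Quotients and isomorphism -/

/-- `q : (I, μ) → (J, ρ)` realizes `J` as the quotient space `I / C`: it preserves the measure and the
members of `C` are, up to null sets, the preimages of the measurable sets of `J`. -/
structure IsQuotientMap {I : Type u} (C : MeasurableSpace I) {mI : MeasurableSpace I} (μ : Measure I)
    {J : Type v} [MeasurableSpace J] (ρ : Measure J) (q : I → J) : Prop where
  measurePreserving : MeasurePreserving q μ ρ
  measurableSet_iff : ∀ s : Set I, MeasurableSet[C] s ↔
    MeasurableSet[mI] s ∧ ∃ B : Set J, MeasurableSet B ∧ s =ᵐ[μ] q ⁻¹' B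

/-- The kernel `a` on `(J, ρ)` is the quotient kernel `w / C`: `J` is the quotient space `I / C`, and
`a` corresponds to `w_C` under the quotient map. -/
def IsQuotientKernel {I : Type u} (C : MeasurableSpace I) {mI : MeasurableSpace I}
    (μ : Measure I) {d : ℕ} (w : I × I → EuclideanSpace ℝ (Fin d))
    {J : Type v} [MeasurableSpace J] (ρ : Measure J)
    (a : J × J → EuclideanSpace ℝ (Fin d)) : Prop :=
  Measurable a ∧ ∃ q : I → J, IsQuotientMap C μ ρ q ∧
    average C μ w =ᵐ[μ.prod μ] fun p => a (q p.1, q p.2)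

/-- Isomorphism of kernels: an isomorphism modulo null sets of the underlying measure spaces
carries one kernel to the other almost everywhere. -/
def KernelIsomorphic {J : Type u} {K : Type v} [MeasurableSpace J] [MeasurableSpace K] {d : ℕ}
    (ρ : Measure J) (σ : Measure K) (a : J × J → EuclideanSpace ℝ (Fin d))
    (b : K × K → EuclideanSpace ℝ (Fin d)) : Prop :=
  ∃ (φ : J → K) (ψ : K → J), MeasurePreserving φ ρ σ ∧ MeasurePreserving ψ σ ρ ∧
    (∀ᵐ x ∂ρ, ψ (φ x) = x) ∧ (∀ᵐ y ∂σ, φ (ψ y) = y) ∧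
    a =ᵐ[ρ.prod ρ] fun p => b (φ p.1, φ p.2)

/-- The quotient kernels `w / C` and `u / D`, on the standard probability spaces `I₁ / C` and
`I₂ / D` (each determined up to isomorphism), are isomorphic. -/
def QuotientsIsomorphic {I₁ : Type u} {I₂ : Type v}
    (C : MeasurableSpace I₁) (D : MeasurableSpace I₂)
    {m₁ : MeasurableSpace I₁} {m₂ : MeasurableSpace I₂} (μ₁ : Measure I₁) (μ₂ : Measure I₂) {d : ℕ}
    (w : I₁ × I₁ → EuclideanSpace ℝ (Fin d)) (u : I₂ × I₂ → EuclideanSpace ℝ (Fin d)) : Prop :=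
  ∃ (J : Type) (_ : MeasurableSpace J) (_ : StandardBorelSpace J) (ρ : Measure J)
    (a : J × J → EuclideanSpace ℝ (Fin d))
    (K : Type) (_ : MeasurableSpace K) (_ : StandardBorelSpace K) (σ : Measure K)
    (b : K × K → EuclideanSpace ℝ (Fin d)),
    IsQuotientKernel C μ₁ w ρ a ∧ IsQuotientKernel D μ₂ u σ b ∧ KernelIsomorphic ρ σ a b

/-! ### Couplings -/

/-- A coupling of `μ₁` and `μ₂`: a measure on the product with these marginals. -/
structure Coupling {I₁ : Type u} {I₂ : Type v} [MeasurableSpace I₁] [MeasurableSpace I₂]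
    (μ₁ : Measure I₁) (μ₂ : Measure I₂) where
  /-- the measure on the product -/
  toMeasure : Measure (I₁ × I₂)
  fst_eq : toMeasure.fst = μ₁
  snd_eq : toMeasure.snd = μ₂

instance {I₁ : Type u} {I₂ : Type v} [MeasurableSpace I₁] [MeasurableSpace I₂]
    (μ₁ : Measure I₁) (μ₂ : Measure I₂) [IsProbabilityMeasure μ₁] (γ : Coupling μ₁ μ₂) :
    IsProbabilityMeasure γ.toMeasure :=
  ⟨by rw [← Measure.fst_univ, γ.fst_eq]; exact measure_univ⟩

/-- The transposed coupling `γ^T`. -/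
def Coupling.transpose {I₁ : Type u} {I₂ : Type v} [MeasurableSpace I₁] [MeasurableSpace I₂]
    {μ₁ : Measure I₁} {μ₂ : Measure I₂} (γ : Coupling μ₁ μ₂) : Coupling μ₂ μ₁ where
  toMeasure := γ.toMeasure.map Prod.swap
  fst_eq := by rw [Measure.fst_map_swap, γ.snd_eq]
  snd_eq := by rw [Measure.snd_map_swap, γ.fst_eq]

/-- The adjacency operator of a coupling, `(T_γ f)(ξ) = ∫ f(ζ) γ(ξ, dζ)`, through the
disintegration `γ(dξ, dζ) = μ₁(dξ) γ(ξ, dζ)`. -/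
def Coupling.op {I₁ : Type u} {I₂ : Type v} [MeasurableSpace I₁] [MeasurableSpace I₂]
    [StandardBorelSpace I₂] {μ₁ : Measure I₁} {μ₂ : Measure I₂} [IsProbabilityMeasure μ₁]
    [IsProbabilityMeasure μ₂] (γ : Coupling μ₁ μ₂) (f : I₂ → ℝ) : I₁ → ℝ :=
  haveI : Nonempty I₂ := nonempty_of_isProbabilityMeasure μ₂
  fun ξ => ∫ ζ, f ζ ∂(γ.toMeasure.condKernel ξ)

/-! ### Cut distance -/

/-- The cut norm `sup ⟨e, ∫_{S × T} w⟩` over `‖e‖ ≤ 1` and measurable `S`, `T`. -/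
def cutNorm {I : Type u} {mI : MeasurableSpace I} (μ : Measure I) {d : ℕ}
    (w : I × I → EuclideanSpace ℝ (Fin d)) : ENNReal :=
  ⨆ (e : EuclideanSpace ℝ (Fin d)) (_ : ‖e‖ ≤ 1) (S : Set I) (_ : MeasurableSet S)
    (T : Set I) (_ : MeasurableSet T),
    ENNReal.ofReal (inner ℝ e (∫ p in S ×ˢ T, w p ∂(μ.prod μ)))

/-- The infimum of `‖w - u^Φ‖_□` over all measure preserving bijections `Φ`. -/
def bijCutDist {I₁ : Type u} {I₂ : Type v} {m₁ : MeasurableSpace I₁} {m₂ : MeasurableSpace I₂}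
    (μ₁ : Measure I₁) (μ₂ : Measure I₂) {d : ℕ}
    (w : I₁ × I₁ → EuclideanSpace ℝ (Fin d)) (u : I₂ × I₂ → EuclideanSpace ℝ (Fin d)) : ENNReal :=
  ⨅ (Φ : I₁ ≃ᵐ I₂) (_ : MeasurePreserving Φ μ₁ μ₂),
    cutNorm μ₁ fun p => w p - u (Φ p.1, Φ p.2)

/-- The extension of a kernel on `I` to the atomless space `I × [0,1]`. -/
def blowUp {I : Type u} {d : ℕ} (w : I × I → EuclideanSpace ℝ (Fin d)) :
    (I × unitInterval) × (I × unitInterval) → EuclideanSpace ℝ (Fin d) :=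
  fun p => w (p.1.1, p.2.1)

open Classical in
/-- The unlabeled cut distance `δ_□`. On atomless spaces it is the infimum over measure preserving
bijections; if there are atoms, both kernels are first extended to the atomless spaces
`I₁ × [0,1]` and `I₂ × [0,1]` (for a finite `I` this is the piecewise constant extension). -/
def cutDist {I₁ : Type u} {I₂ : Type v} {m₁ : MeasurableSpace I₁} {m₂ : MeasurableSpace I₂}
    (μ₁ : Measure I₁) (μ₂ : Measure I₂) {d : ℕ}
    (w : I₁ × I₁ → EuclideanSpace ℝ (Fin d)) (u : I₂ × I₂ → EuclideanSpace ℝ (Fin d)) : ENNReal :=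
  if (∀ x, μ₁ {x} = 0) ∧ (∀ y, μ₂ {y} = 0) then bijCutDist μ₁ μ₂ w u
  else bijCutDist (μ₁.prod (volume : Measure unitInterval))
    (μ₂.prod (volume : Measure unitInterval)) (blowUp w) (blowUp u)

end

end FracIso

set_option linter.unusedSectionVars false

namespace FracIso

open ProbabilityTheory

/-! The implications form the cycle (1) → (4) → (2) → (3) → (5) → (1). Conditions (1) and (5) are
handled through one quantity, the integrals of the functions `treeFun`: the density of a rooted tree
as a function of the position of its root, where the edges carry a coordinate of the kernel or of
its transpose. These functions are closed under products (identify the roots) and under the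
operators of the coordinate kernels (hang the tree on a new edge).

(1) → (4). Densities of oriented trees determine all integrals of tree functions, since an edge with
a transposed label is an edge with the opposite orientation. The values of all tree functions at a
point form its `profile`, an element of a compact cube. By closure under products, the moments of
the law of the profile are integrals of tree functions, so by Stone–Weierstrass both kernels have
the same profile law `ν`. Hence `L²(ν)` embeds in both `L²` spaces, by isometries `J₁` and `J₂`. By
closure under the operators, each operator acts on the two copies in the same way. The relatively
independent coupling over `ν` has the operator `J₁ J₂*`, which therefore intertwines
(`factorCoupling_intertwines`).

(4) → (2). If `f` and `g` agree almost everywhere for an intertwining coupling, so do their images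
under the operators, because the square of the difference integrates to zero
(`Coupling.Intertwines.ae_adjOp_eq`). Inductively, corresponding points have equal iterated degrees,
so the laws agree.

(2) → (3). The canonical algebra is the relative completion of the `σ`-algebra of the degree map
(`canonicalAlgebra_eq`), so the law of degrees is a model of the quotient. On this model the
integral of the quotient kernel over a set times a cylinder can be read off from the degree measures
themselves (`setIntegral_quotient_kernel`). The law thus determines the quotient kernel.

(3) → (5). The averaged kernels are pullbacks of one kernel along two factor maps with the same law.
On atomless spaces there are measure preserving bijections that match any finite number of bits of
the factor maps, and approximation of the kernel by continuous functions makes the `L¹` distance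
arbitrarily small.

(5) → (1). Tree functions are measurable for an invariant algebra and do not change when the kernel
is averaged over it. A counting lemma bounds their variation by the cut norm, so distance zero gives
equal integrals. Removing leaves one at a time writes the density of a tree through rooted trees
(`integral_forestFun_eq`). -/

/-! ### Operators of bounded scalar kernels -/

/-- A measurable scalar kernel bounded by `C` almost everywhere. -/
structure BoundedKernel {I : Type*} [MeasurableSpace I] (μ : Measure I) (C : ℝ) (k : I × I → ℝ) :
    Prop where
  measurable : Measurable k
  bound : ∀ᵐ p ∂μ.prod μ, |k p| ≤ C

section Operators

variable {I : Type*} [MeasurableSpace I] {μ : Measure I} [IsProbabilityMeasure μ]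
  {C : ℝ} {k : I × I → ℝ}

theorem BoundedKernel.transpose (hk : BoundedKernel μ C k) :
    BoundedKernel μ C (transposeKernel k) where
  measurable := hk.measurable.comp measurable_swap
  bound := (Measure.measurePreserving_swap (μ := μ) (ν := μ)).quasiMeasurePreserving.ae hk.bound

theorem BoundedKernel.ae_bound (hk : BoundedKernel μ C k) :
    ∀ᵐ ξ ∂μ, ∀ᵐ ζ ∂μ, |k (ξ, ζ)| ≤ C :=
  Measure.ae_ae_of_ae_prod hk.bound

theorem BoundedKernel.nonneg (hk : BoundedKernel μ C k) : 0 ≤ C := by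
  obtain ⟨p, hp⟩ := hk.bound.exists
  exact (abs_nonneg _).trans hp

theorem BoundedKernel.integrable (hk : BoundedKernel μ C k) : Integrable k (μ.prod μ) :=
  Integrable.of_bound hk.measurable.aestronglyMeasurable C (by simpa using hk.bound)

theorem BoundedKernel.integrable_section (hk : BoundedKernel μ C k) {f : I → ℝ}
    (hf : Integrable f μ) : ∀ᵐ ξ ∂μ, Integrable (fun ζ => k (ξ, ζ) * f ζ) μ := by
  filter_upwards [hk.ae_bound] with ξ hξ
  exact hf.bdd_mul (c := C) (hk.measurable.comp measurable_prodMk_left).aestronglyMeasurable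
    (by simpa using hξ)

theorem adjOp_congr {f g : I → ℝ} (h : f =ᵐ[μ] g) : adjOp μ k f = adjOp μ k g := by
  funext ξ
  refine integral_congr_ae ?_
  filter_upwards [h] with ζ hζ
  rw [hζ]

theorem adjOp_congr_kernel {k' : I × I → ℝ} (h : k =ᵐ[μ.prod μ] k') (f : I → ℝ) :
    adjOp μ k f =ᵐ[μ] adjOp μ k' f := by
  filter_upwards [Measure.ae_ae_of_ae_prod h] with ξ hξ
  refine integral_congr_ae ?_
  filter_upwards [hξ] with ζ hζ
  rw [hζ]

theorem stronglyMeasurable_adjOp (hk : Measurable k) {f : I → ℝ} (hf : AEStronglyMeasurable f μ) :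
    StronglyMeasurable (adjOp μ k f) := by
  rw [adjOp_congr hf.ae_eq_mk]
  have : StronglyMeasurable (fun p : I × I => k p * hf.mk f p.2) :=
    hk.stronglyMeasurable.mul (hf.stronglyMeasurable_mk.comp_measurable measurable_snd)
  exact this.integral_prod_right

theorem BoundedKernel.abs_adjOp_le (hk : BoundedKernel μ C k) {f : I → ℝ} (hf : Integrable f μ) :
    ∀ᵐ ξ ∂μ, |adjOp μ k f ξ| ≤ C * ∫ ζ, |f ζ| ∂μ := by
  filter_upwards [hk.ae_bound] with ξ hξ
  rw [← integral_const_mul, ← Real.norm_eq_abs]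
  refine norm_integral_le_of_norm_le (hf.abs.const_mul C) ?_
  filter_upwards [hξ] with ζ hζ
  rw [norm_mul]
  exact mul_le_mul_of_nonneg_right hζ (abs_nonneg _)

theorem BoundedKernel.memLp_adjOp (hk : BoundedKernel μ C k) {f : I → ℝ} (hf : Integrable f μ)
    (p : ENNReal) : MemLp (adjOp μ k f) p μ :=
  MemLp.of_bound (stronglyMeasurable_adjOp hk.measurable hf.1).aestronglyMeasurable _
    (by simpa using hk.abs_adjOp_le hf)

theorem BoundedKernel.integrable_adjOp (hk : BoundedKernel μ C k) {f : I → ℝ}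
    (hf : Integrable f μ) : Integrable (adjOp μ k f) μ :=
  memLp_one_iff_integrable.1 (hk.memLp_adjOp hf 1)

theorem BoundedKernel.adjOp_add (hk : BoundedKernel μ C k) {f g : I → ℝ} (hf : Integrable f μ)
    (hg : Integrable g μ) : adjOp μ k (f + g) =ᵐ[μ] adjOp μ k f + adjOp μ k g := by
  filter_upwards [hk.integrable_section hf, hk.integrable_section hg] with ξ h1 h2
  simp only [adjOp, Pi.add_apply, mul_add]
  exact integral_add h1 h2

theorem adjOp_smul (c : ℝ) (f : I → ℝ) : adjOp μ k (c • f) = c • adjOp μ k f := by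
  funext ξ
  simp only [adjOp, Pi.smul_apply, smul_eq_mul, ← integral_const_mul]
  congr 1; funext ζ; ring

theorem BoundedKernel.adjOp_sub (hk : BoundedKernel μ C k) {f g : I → ℝ} (hf : Integrable f μ)
    (hg : Integrable g μ) : adjOp μ k (f - g) =ᵐ[μ] adjOp μ k f - adjOp μ k g := by
  filter_upwards [hk.integrable_section hf, hk.integrable_section hg] with ξ h1 h2
  simp only [adjOp, Pi.sub_apply, mul_sub]
  exact integral_sub h1 h2

theorem BoundedKernel.integrable_mul_mul (hk : BoundedKernel μ C k) {f g : I → ℝ}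
    (hf : Integrable f μ) (hg : Integrable g μ) :
    Integrable (fun p : I × I => k p * (g p.1 * f p.2)) (μ.prod μ) :=
  (hg.mul_prod hf).bdd_mul (c := C) hk.measurable.aestronglyMeasurable (by simpa using hk.bound)

theorem BoundedKernel.integral_adjOp_mul (hk : BoundedKernel μ C k) {f g : I → ℝ}
    (hf : Integrable f μ) (hg : Integrable g μ) :
    ∫ ξ, adjOp μ k f ξ * g ξ ∂μ = ∫ p, k p * (g p.1 * f p.2) ∂μ.prod μ := by
  rw [integral_prod _ (hk.integrable_mul_mul hf hg)]
  congr 1; funext ξ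
  rw [adjOp, ← integral_mul_const]
  congr 1; funext ζ; ring

theorem BoundedKernel.adjoint (hk : BoundedKernel μ C k) {f g : I → ℝ}
    (hf : Integrable f μ) (hg : Integrable g μ) :
    ∫ ξ, adjOp μ k f ξ * g ξ ∂μ = ∫ ξ, f ξ * adjOp μ (transposeKernel k) g ξ ∂μ := by
  rw [hk.integral_adjOp_mul hf hg, ← integral_prod_swap]
  have := hk.transpose.integral_adjOp_mul hg hf
  simp only [mul_comm (f _) (adjOp _ _ _ _)]
  rw [this]
  refine integral_congr_ae (ae_of_all _ fun p => ?_)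
  simp only [transposeKernel, Prod.swap]
  ring

theorem MemLp.integrable_two {f : I → ℝ} (hf : MemLp f 2 μ) : Integrable f μ :=
  hf.integrable (by norm_num)

/-- The operator of a bounded kernel on `L²`. -/
noncomputable def opL2 (hk : BoundedKernel μ C k) : Lp ℝ 2 μ →L[ℝ] Lp ℝ 2 μ :=
  LinearMap.mkContinuous
    { toFun := fun f => (hk.memLp_adjOp (MemLp.integrable_two (Lp.memLp f)) 2).toLp _
      map_add' := fun f g => by
        rw [← MemLp.toLp_add]
        refine MemLp.toLp_congr _ _ ?_
        rw [adjOp_congr (Lp.coeFn_add f g)]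
        exact hk.adjOp_add (MemLp.integrable_two (Lp.memLp f)) (MemLp.integrable_two (Lp.memLp g))
      map_smul' := fun c f => by
        rw [RingHom.id_apply, ← MemLp.toLp_const_smul]
        refine MemLp.toLp_congr _ _ ?_
        rw [adjOp_congr (Lp.coeFn_smul c f), adjOp_smul] }
    C (fun f => by
      have hf := Lp.memLp f
      have h0 := MemLp.integrable_two hf
      have h1 : ∫ ζ, |f ζ| ∂μ ≤ ‖f‖ := by
        have := eLpNorm_le_eLpNorm_of_exponent_le (μ := μ) (p := 1) (q := 2) (by norm_num) hf.1
        rw [Lp.norm_def]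
        calc ∫ ζ, |f ζ| ∂μ = (eLpNorm f 1 μ).toReal := by
              rw [eLpNorm_one_eq_lintegral_enorm, ← integral_norm_eq_lintegral_enorm hf.1]; rfl
          _ ≤ _ := ENNReal.toReal_mono hf.2.ne this
      have hC := hk.nonneg
      -- The image is bounded pointwise by `C` times the `L¹` norm, and on a probability space the
      -- `L¹` norm is at most the `L²` norm.
      have h2 : ∀ᵐ x ∂μ, ‖(hk.memLp_adjOp h0 2).toLp _ x‖ ≤ C * ‖f‖ := by
        filter_upwards [MemLp.coeFn_toLp (hk.memLp_adjOp h0 2), hk.abs_adjOp_le h0] with x hx hx'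
        rw [hx]
        exact hx'.trans (mul_le_mul_of_nonneg_left h1 hC)
      have := Lp.norm_le_of_ae_bound (by positivity) h2
      simpa [measureUnivNNReal] using this)

theorem coeFn_opL2 (hk : BoundedKernel μ C k) (f : Lp ℝ 2 μ) :
    opL2 hk f =ᵐ[μ] adjOp μ k f :=
  (hk.memLp_adjOp (MemLp.integrable_two (Lp.memLp f)) 2).coeFn_toLp

theorem inner_L2_eq (f g : Lp ℝ 2 μ) : inner ℝ f g = ∫ x, f x * g x ∂μ := by
  rw [L2.inner_def]
  refine integral_congr_ae (ae_of_all _ fun x => ?_)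
  simp [mul_comm]

theorem inner_opL2 (hk : BoundedKernel μ C k) (f g : Lp ℝ 2 μ) :
    inner ℝ (opL2 hk f) g = inner ℝ f (opL2 hk.transpose g) := by
  rw [inner_L2_eq, inner_L2_eq]
  calc ∫ x, opL2 hk f x * g x ∂μ = ∫ x, adjOp μ k f x * g x ∂μ := by
        refine integral_congr_ae ?_
        filter_upwards [coeFn_opL2 hk f] with x hx
        rw [hx]
    _ = ∫ x, f x * adjOp μ (transposeKernel k) g x ∂μ :=
        hk.adjoint (MemLp.integrable_two (Lp.memLp f)) (MemLp.integrable_two (Lp.memLp g))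
    _ = _ := by
        refine integral_congr_ae ?_
        filter_upwards [coeFn_opL2 hk.transpose g] with x hx
        rw [hx]

end Operators

/-! ### Rooted trees and their density functions -/

/-- Terms for finite rooted trees with edges labelled by `S`: `graft s c r` attaches the root of `c`
to the root of `r` by an edge labelled `s`. -/
inductive RootedTree (S : Type) : Type
  | one : RootedTree S
  | graft (s : S) (c r : RootedTree S) : RootedTree S

namespace RootedTree

variable {S : Type}

/-- Identification of the roots of two rooted trees. -/
def mul : RootedTree S → RootedTree S → RootedTree S
  | one, t => t
  | graft s c r, t => graft s c (r.mul t)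

/-- A code for rooted trees. -/
def encode (e : S → ℕ) : RootedTree S → ℕ
  | one => 0
  | graft s c r => Nat.pair (e s) (Nat.pair (c.encode e) (r.encode e)) + 1

theorem encode_injective {e : S → ℕ} (he : Function.Injective e) :
    Function.Injective (encode e) := by
  intro a
  induction a with
  | one => intro b h; cases b with
    | one => rfl
    | graft s c r => simp [encode] at h
  | graft s c r hc hr => intro b h; cases b with
    | one => simp [encode] at h
    | graft s' c' r' =>
      simp only [encode, Nat.add_right_cancel_iff, Nat.pair_eq_pair] at h
      rw [he h.1, hc h.2.1, hr h.2.2]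

/-- Countability of the set of trees makes the profile space a countable product, whose product
`σ`-algebra is the Borel one. -/
instance [Countable S] : Countable (RootedTree S) := by
  obtain ⟨e, he⟩ := exists_injective_nat S
  exact (encode_injective he).countable

end RootedTree

/-- A family of kernels bounded by `1` which is closed under transposition, by an involution of the
index set. -/
structure KernelFamily {I : Type*} [MeasurableSpace I] (μ : Measure I) {S : Type} (inv : S → S)
    (K : S → I × I → ℝ) : Prop where
  bdd : ∀ s, BoundedKernel μ 1 (K s)
  transpose : ∀ s, transposeKernel (K s) = K (inv s)

section TreeFun

variable {I : Type*} [MeasurableSpace I] {μ : Measure I} [IsProbabilityMeasure μ]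
  {S : Type} {inv : S → S} {K : S → I × I → ℝ}

/-- The density of a rooted tree as a function of the position of the root. -/
noncomputable def treeFun (μ : Measure I) (K : S → I × I → ℝ) : RootedTree S → I → ℝ
  | .one => fun _ => 1
  | .graft s c r => fun ξ => adjOp μ (K s) (treeFun μ K c) ξ * treeFun μ K r ξ

/-- Branches at a common root are independent given the root. It follows that monomials in tree
functions are again tree functions. -/
theorem treeFun_mul (a b : RootedTree S) :
    treeFun μ K (a.mul b) = treeFun μ K a * treeFun μ K b := by
  induction a with
  | one => funext ξ; simp [RootedTree.mul, treeFun]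
  | graft s c r _ hr =>
    funext ξ
    simp only [RootedTree.mul, treeFun, hr, Pi.mul_apply]
    ring

theorem stronglyMeasurable_treeFun (hK : KernelFamily μ inv K) (t : RootedTree S) :
    StronglyMeasurable (treeFun μ K t) := by
  induction t with
  | one => exact stronglyMeasurable_const
  | graft s c r hc hr =>
    exact (stronglyMeasurable_adjOp (hK.bdd s).measurable hc.aestronglyMeasurable).mul hr

theorem abs_treeFun_le (hK : KernelFamily μ inv K) (t : RootedTree S) :
    ∀ᵐ ξ ∂μ, |treeFun μ K t ξ| ≤ 1 := by
  induction t with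
  | one => simp [treeFun]
  | graft s c r hc hr =>
    have hci : Integrable (treeFun μ K c) μ :=
      Integrable.of_bound (stronglyMeasurable_treeFun hK c).aestronglyMeasurable 1 (by simpa using hc)
    have h1 : ∫ ζ, |treeFun μ K c ζ| ∂μ ≤ 1 := by
      calc ∫ ζ, |treeFun μ K c ζ| ∂μ ≤ ∫ _, 1 ∂μ := integral_mono_ae hci.abs (by simp) hc
        _ = 1 := by simp
    filter_upwards [(hK.bdd s).abs_adjOp_le hci, hr] with ξ h2 h3
    simp only [treeFun, abs_mul]
    exact mul_le_one₀ (h2.trans (by linarith)) (abs_nonneg _) h3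

theorem memLp_treeFun (hK : KernelFamily μ inv K) (t : RootedTree S) (p : ENNReal) :
    MemLp (treeFun μ K t) p μ :=
  MemLp.of_bound (stronglyMeasurable_treeFun hK t).aestronglyMeasurable 1
    (by simpa using abs_treeFun_le hK t)

theorem integrable_treeFun (hK : KernelFamily μ inv K) (t : RootedTree S) :
    Integrable (treeFun μ K t) μ :=
  memLp_one_iff_integrable.1 (memLp_treeFun hK t 1)

theorem treeFun_graft_one (s : S) (c : RootedTree S) :
    treeFun μ K (.graft s c .one) = adjOp μ (K s) (treeFun μ K c) := by
  funext ξ; simp [treeFun]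

end TreeFun

/-! ### The space of tree profiles -/

/-- The compact space of `[-1,1]`-valued functions on the set of rooted trees. -/
abbrev ProfileSpace (S : Type) : Type := RootedTree S → Set.Icc (-1 : ℝ) 1

/-- The coordinate functions of the profile space. -/
def coordinate {S : Type} (t : RootedTree S) : C(ProfileSpace S, ℝ) :=
  ⟨fun x => x t, by fun_prop⟩

/-- Stone–Weierstrass in the form used twice below, once for equality of laws and once for
invariance of the factor: the coordinates separate points, and the algebra that they generate is the
linear span of the monomials. -/
theorem eq_top_of_coordinate_mem {S : Type} (P : Submodule ℝ C(ProfileSpace S, ℝ))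
    (hP : IsClosed (P : Set C(ProfileSpace S, ℝ)))
    (h : ∀ F ∈ Submonoid.closure (Set.range (coordinate (S := S))), F ∈ P) : P = ⊤ := by
  set A := Algebra.adjoin ℝ (Set.range (coordinate (S := S)))
  have hA : A.SeparatesPoints := by
    intro x y hxy
    obtain ⟨t, ht⟩ := Function.ne_iff.1 hxy
    exact ⟨_, ⟨coordinate t, Algebra.subset_adjoin ⟨t, rfl⟩, rfl⟩, fun h => ht (Subtype.ext h)⟩
  have hle : (A : Set C(ProfileSpace S, ℝ)) ⊆ P := by
    intro F hF
    have : F ∈ Subalgebra.toSubmodule A := hF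
    rw [Algebra.adjoin_eq_span] at this
    exact Submodule.span_le.2 h this
  have htop := ContinuousMap.subalgebra_topologicalClosure_eq_top_of_separatesPoints A hA
  rw [eq_top_iff]
  intro F _
  have hF : F ∈ A.topologicalClosure := htop ▸ Algebra.mem_top
  exact closure_minimal hle hP hF

section Profile

variable {I : Type*} [MeasurableSpace I] {μ : Measure I} [IsProbabilityMeasure μ]
  {S : Type} {inv : S → S} {K : S → I × I → ℝ}

/-- The profile of a point: the values of all tree functions. -/
noncomputable def profile (μ : Measure I) (K : S → I × I → ℝ) (ξ : I) : ProfileSpace S :=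
  fun t => Set.projIcc (-1) 1 (by norm_num) (treeFun μ K t ξ)

theorem measurable_profile (hK : KernelFamily μ inv K) : Measurable (profile μ K) :=
  measurable_pi_lambda _ fun t =>
    continuous_projIcc.measurable.comp (stronglyMeasurable_treeFun hK t).measurable

theorem coordinate_profile (hK : KernelFamily μ inv K) (t : RootedTree S) :
    (fun ξ => coordinate t (profile μ K ξ)) =ᵐ[μ] treeFun μ K t := by
  filter_upwards [abs_treeFun_le hK t] with ξ hξ
  have := Set.projIcc_of_mem (show (-1 : ℝ) ≤ 1 by norm_num) (abs_le.1 hξ)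
  simp [coordinate, profile, this]

end Profile

section Law

variable {I₁ I₂ : Type*} [MeasurableSpace I₁] [MeasurableSpace I₂] {μ₁ : Measure I₁}
  {μ₂ : Measure I₂} [IsProbabilityMeasure μ₁] [IsProbabilityMeasure μ₂]
  {S : Type} {inv : S → S} {K₁ : S → I₁ × I₁ → ℝ} {K₂ : S → I₂ × I₂ → ℝ}

/-- A monomial in the coordinates corresponds to the tree obtained by gluing its factors at the
root. The essential point is that one tree serves both kernels. -/
theorem exists_treeFun_eq (h₁ : KernelFamily μ₁ inv K₁) (h₂ : KernelFamily μ₂ inv K₂)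
    {F : C(ProfileSpace S, ℝ)} (hF : F ∈ Submonoid.closure (Set.range (coordinate (S := S)))) :
    ∃ t : RootedTree S, (fun ξ => F (profile μ₁ K₁ ξ)) =ᵐ[μ₁] treeFun μ₁ K₁ t ∧
      (fun ξ => F (profile μ₂ K₂ ξ)) =ᵐ[μ₂] treeFun μ₂ K₂ t := by
  induction hF using Submonoid.closure_induction with
  | mem F hF =>
    obtain ⟨t, rfl⟩ := hF
    exact ⟨t, coordinate_profile h₁ t, coordinate_profile h₂ t⟩
  | one => exact ⟨.one, by simp [treeFun], by simp [treeFun]⟩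
  | mul F G _ _ hF hG =>
    obtain ⟨a, ha₁, ha₂⟩ := hF
    obtain ⟨b, hb₁, hb₂⟩ := hG
    refine ⟨a.mul b, ?_, ?_⟩
    · rw [treeFun_mul]; exact ha₁.mul hb₁
    · rw [treeFun_mul]; exact ha₂.mul hb₂

theorem continuous_integral_continuousMap {X : Type*} [TopologicalSpace X] [CompactSpace X]
    [MeasurableSpace X] [BorelSpace X] (ν : Measure X) [IsProbabilityMeasure ν] :
    Continuous fun F : C(X, ℝ) => ∫ x, F x ∂ν := by
  refine (LipschitzWith.of_dist_le_mul (K := 1) fun F G => ?_).continuous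
  have hi : ∀ H : C(X, ℝ), Integrable H ν := fun H =>
    Integrable.of_bound H.continuous.measurable.aestronglyMeasurable ‖H‖
      (ae_of_all _ H.norm_coe_le_norm)
  rw [dist_eq_norm, ← integral_sub (hi F) (hi G), NNReal.coe_one, one_mul, dist_eq_norm]
  refine (norm_integral_le_of_norm_le_const (C := ‖F - G‖)
    (ae_of_all _ fun x => (F - G).norm_coe_le_norm x)).trans ?_
  simp

/-- The method of moments: the functions with equal integrals under both laws form a closed
subspace, which contains the monomials because these integrate to integrals of tree functions. -/
theorem map_profile_eq [Countable S] (h₁ : KernelFamily μ₁ inv K₁) (h₂ : KernelFamily μ₂ inv K₂)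
    (h : ∀ t : RootedTree S, ∫ ξ, treeFun μ₁ K₁ t ξ ∂μ₁ = ∫ ξ, treeFun μ₂ K₂ t ξ ∂μ₂) :
    μ₁.map (profile μ₁ K₁) = μ₂.map (profile μ₂ K₂) := by
  have m₁ := measurable_profile h₁
  have m₂ := measurable_profile h₂
  have := Measure.isProbabilityMeasure_map (μ := μ₁) m₁.aemeasurable
  have := Measure.isProbabilityMeasure_map (μ := μ₂) m₂.aemeasurable
  set ν₁ := μ₁.map (profile μ₁ K₁)
  set ν₂ := μ₂.map (profile μ₂ K₂)
  have hi : ∀ (ν : Measure (ProfileSpace S)) [IsProbabilityMeasure ν] (H : C(ProfileSpace S, ℝ)),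
      Integrable H ν := fun ν _ H =>
    Integrable.of_bound H.continuous.measurable.aestronglyMeasurable ‖H‖
      (ae_of_all _ H.norm_coe_le_norm)
  let P : Submodule ℝ C(ProfileSpace S, ℝ) :=
    { carrier := {F | ∫ x, F x ∂ν₁ = ∫ x, F x ∂ν₂}
      add_mem' := fun {F G} hF hG => by
        simp only [Set.mem_ofPred_eq, ContinuousMap.add_apply] at *
        rw [integral_add (hi _ _) (hi _ _), integral_add (hi _ _) (hi _ _), hF, hG]
      zero_mem' := by simp
      smul_mem' := fun c F hF => by
        simp only [Set.mem_ofPred_eq, ContinuousMap.smul_apply, integral_smul] at *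
        rw [hF] }
  have hP : P = ⊤ := by
    refine eq_top_of_coordinate_mem P (isClosed_eq (continuous_integral_continuousMap ν₁)
      (continuous_integral_continuousMap ν₂)) fun F hF => ?_
    obtain ⟨t, ht₁, ht₂⟩ := exists_treeFun_eq h₁ h₂ hF
    show ∫ x, F x ∂ν₁ = ∫ x, F x ∂ν₂
    rw [integral_map m₁.aemeasurable F.continuous.measurable.aestronglyMeasurable,
      integral_map m₂.aemeasurable F.continuous.measurable.aestronglyMeasurable]
    rw [integral_congr_ae ht₁, integral_congr_ae ht₂, h t]
  refine ext_of_forall_integral_eq_of_IsFiniteMeasure fun F => ?_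
  have : F.toContinuousMap ∈ P := hP ▸ Submodule.mem_top
  exact this

end Law

/-! ### Intertwining operators over a common factor -/

section Hilbert

variable {H₁ H₂ N : Type*} [NormedAddCommGroup H₁] [InnerProductSpace ℝ H₁] [CompleteSpace H₁]
  [NormedAddCommGroup H₂] [InnerProductSpace ℝ H₂] [CompleteSpace H₂]
  [NormedAddCommGroup N] [InnerProductSpace ℝ N] [CompleteSpace N]

/-- The weak form of `J₁ J₂* A₂ = A₁ J₁ J₂*`, where `B₁` and `B₂` are the adjoints of `A₁` and `A₂`.
After all isometries are moved to the side of `g`, what remains is that `B₁` and `B₂` restrict to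
the same operator on the common subspace. -/
theorem inner_adjoint_intertwine (J₁ : N →ₗᵢ[ℝ] H₁) (J₂ : N →ₗᵢ[ℝ] H₂)
    {A₁ B₁ : H₁ →L[ℝ] H₁} {A₂ B₂ : H₂ →L[ℝ] H₂}
    (h₁ : ∀ x y, inner ℝ (A₁ x) y = inner ℝ x (B₁ y))
    (h₂ : ∀ x y, inner ℝ (A₂ x) y = inner ℝ x (B₂ y))
    (hA : ∀ x, ∃ y, A₁ (J₁ x) = J₁ y)
    (hB : ∀ x, ∃ y, B₁ (J₁ x) = J₁ y ∧ B₂ (J₂ x) = J₂ y) (f : H₂) (g : H₁) :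
    inner ℝ (J₁ (J₂.toContinuousLinearMap.adjoint (A₂ f))) g =
      inner ℝ (J₁ (J₂.toContinuousLinearMap.adjoint f)) (B₁ g) := by
  have e₂ : ∀ (f : H₂) (x : N), inner ℝ (J₂.toContinuousLinearMap.adjoint f) x = inner ℝ f (J₂ x) :=
    fun f x => ContinuousLinearMap.adjoint_inner_left _ _ _
  have e₁ : ∀ (x : N) (g : H₁), inner ℝ (J₁ x) g =
      inner ℝ x (J₁.toContinuousLinearMap.adjoint g) :=
    fun x g => (ContinuousLinearMap.adjoint_inner_right J₁.toContinuousLinearMap x g).symm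
  obtain ⟨y, hy₁, hy₂⟩ := hB (J₁.toContinuousLinearMap.adjoint g)
  -- The range of `J₁` is invariant under `A₁`, so the part of `g` orthogonal to this range
  -- contributes nothing to `J₁* B₁ g`, and `g` may be replaced by its projection `J₁ J₁* g`.
  have key : J₁.toContinuousLinearMap.adjoint (B₁ g) = y := by
    refine ext_inner_left ℝ fun z => ?_
    obtain ⟨z', hz'⟩ := hA z
    rw [← e₁, ← h₁, hz', e₁, ← J₁.inner_map_map, ← hz', h₁, hy₁, J₁.inner_map_map]
  rw [e₁, e₂, h₂, hy₂, e₁, e₂, key]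

/-- The vector `y` is forced to be `L x` with the bounded operator `L = J₂* A₂ J₂`. Both equations
for `L x` then define a closed subspace of `N`, so it suffices to check them on the generating set
`D`, here the monomials. -/
theorem exists_factor_of_dense {V : Type*} [NormedAddCommGroup V] [NormedSpace ℝ V]
    (J₁ : N →ₗᵢ[ℝ] H₁) (J₂ : N →ₗᵢ[ℝ] H₂) (A₁ : H₁ →L[ℝ] H₁) (A₂ : H₂ →L[ℝ] H₂)
    (ι : V →L[ℝ] N) (hι : DenseRange ι) {D : Set V}
    (hD : ∀ P : Submodule ℝ V, IsClosed (P : Set V) → (∀ v ∈ D, v ∈ P) → P = ⊤)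
    (h : ∀ v ∈ D, ∃ y, A₁ (J₁ (ι v)) = J₁ y ∧ A₂ (J₂ (ι v)) = J₂ y) (x : N) :
    ∃ y, A₁ (J₁ x) = J₁ y ∧ A₂ (J₂ x) = J₂ y := by
  obtain ⟨L, hL⟩ : ∃ L : N →L[ℝ] N, ∀ x z, inner ℝ (L x) z = inner ℝ (A₂ (J₂ x)) (J₂ z) :=
    ⟨J₂.toContinuousLinearMap.adjoint ∘L A₂ ∘L J₂.toContinuousLinearMap, fun x z =>
      ContinuousLinearMap.adjoint_inner_left J₂.toContinuousLinearMap z (A₂ (J₂ x))⟩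
  set T₁ : N →L[ℝ] H₁ :=
    A₁ ∘L J₁.toContinuousLinearMap - J₁.toContinuousLinearMap ∘L L with hT₁
  set T₂ : N →L[ℝ] H₂ :=
    A₂ ∘L J₂.toContinuousLinearMap - J₂.toContinuousLinearMap ∘L L with hT₂
  have e₁ : ∀ x, T₁ x = A₁ (J₁ x) - J₁ (L x) := fun _ => rfl
  have e₂ : ∀ x, T₂ x = A₂ (J₂ x) - J₂ (L x) := fun _ => rfl
  let W : Submodule ℝ N := LinearMap.ker T₁.toLinearMap ⊓ LinearMap.ker T₂.toLinearMap
  have hmem : ∀ x, x ∈ W ↔ T₁ x = 0 ∧ T₂ x = 0 := fun _ => Iff.rfl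
  have hW : IsClosed (W : Set N) := T₁.isClosed_ker.inter T₂.isClosed_ker
  have hP : W.comap ι.toLinearMap = ⊤ := by
    refine hD _ (hW.preimage ι.continuous) fun v hv => ?_
    obtain ⟨y, hy₁, hy₂⟩ := h v hv
    have hLy : L (ι v) = y := by
      refine ext_inner_right ℝ fun z => ?_
      rw [hL, hy₂, J₂.inner_map_map]
    show ι v ∈ W
    rw [hmem, e₁, e₂, hLy, hy₁, hy₂, sub_self, sub_self]
    exact ⟨rfl, rfl⟩
  have hx : x ∈ W := by
    refine closure_minimal ?_ hW (hι x)
    rintro _ ⟨v, rfl⟩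
    have : v ∈ W.comap ι.toLinearMap := hP ▸ Submodule.mem_top
    exact this
  rw [hmem, e₁, e₂] at hx
  exact ⟨L x, sub_eq_zero.1 hx.1, sub_eq_zero.1 hx.2⟩

end Hilbert

/-! ### Composition with a factor map and its adjoint, the conditional expectation. -/

section Factor

variable {I X : Type*} [MeasurableSpace I] [MeasurableSpace X] {μ : Measure I} {ν : Measure X}
  [IsProbabilityMeasure μ] [IsProbabilityMeasure ν]

/-- Composition with a factor map as an isometry of `L²` spaces. -/
noncomputable def factorL2 {q : I → X} (hq : MeasurePreserving q μ ν) :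
    Lp ℝ 2 ν →ₗᵢ[ℝ] Lp ℝ 2 μ :=
  Lp.compMeasurePreservingₗᵢ ℝ q hq

theorem coeFn_factorL2 {q : I → X} (hq : MeasurePreserving q μ ν) (F : Lp ℝ 2 ν) :
    factorL2 hq F =ᵐ[μ] F ∘ q :=
  Lp.coeFn_compMeasurePreserving F hq

/-- Both sides are the conditional expectation of `f` given `q`, as a function on `X`: each
integrates over `A` to the integral of `f` over `q ⁻¹' A`. -/
theorem integral_condDistrib_eq_adjoint [StandardBorelSpace I] [Nonempty I] {q : I → X}
    (hq : MeasurePreserving q μ ν) (f : Lp ℝ 2 μ) :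
    (fun x => ∫ ζ, f ζ ∂(condDistrib id q μ x)) =ᵐ[ν]
      (factorL2 hq).toContinuousLinearMap.adjoint f := by
  have hf := MemLp.integrable_two (Lp.memLp f)
  have hν : ν ⊗ₘ condDistrib id q μ = μ.map fun a => (q a, a) := by
    have : μ.map q ⊗ₘ condDistrib id q μ = μ.map fun a => (q a, id a) :=
      compProd_map_condDistrib measurable_id.aemeasurable
    rwa [hq.map_eq] at this
  have hm : Measurable fun a => (q a, a) := hq.measurable.prodMk measurable_id
  have hfi : Integrable (fun p : X × I => f p.2) (ν ⊗ₘ condDistrib id q μ) := by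
    rw [hν]
    refine (integrable_map_measure ?_ hm.aemeasurable).2 hf
    exact ((Lp.stronglyMeasurable f).comp_measurable measurable_snd).aestronglyMeasurable
  have hi' : Integrable (fun x => ∫ ζ, f ζ ∂(condDistrib id q μ x)) ν :=
    Integrable.integral_compProd (κ := Kernel.const Unit ν)
      (η := Kernel.prodMkLeft Unit (condDistrib id q μ)) (a := ()) hfi
  refine Integrable.ae_eq_of_forall_setIntegral_eq _ _ hi'
    (MemLp.integrable_two (Lp.memLp _)) fun A hA _ => ?_
  have h1 : ∫ x in A, ∫ ζ, f ζ ∂(condDistrib id q μ x) ∂ν = ∫ ζ in q ⁻¹' A, f ζ ∂μ := by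
    have := Measure.setIntegral_compProd (μ := ν) (κ := condDistrib id q μ) hA MeasurableSet.univ
      hfi.integrableOn
    simp only [Measure.restrict_univ] at this
    rw [← this, hν, setIntegral_map (hA.prod MeasurableSet.univ) _ hm.aemeasurable]
    · congr 2
      ext a; simp
    · exact ((Lp.stronglyMeasurable f).comp_measurable measurable_snd).aestronglyMeasurable
  rw [h1]
  have h2 : inner ℝ ((factorL2 hq).toContinuousLinearMap.adjoint f)
      (indicatorConstLp 2 hA (measure_ne_top ν A) (1 : ℝ)) =
      inner ℝ f (factorL2 hq (indicatorConstLp 2 hA (measure_ne_top ν A) (1 : ℝ))) :=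
    ContinuousLinearMap.adjoint_inner_left _ _ _
  rw [inner_L2_eq, inner_L2_eq] at h2
  rw [← integral_indicator hA, ← integral_indicator (hq.measurable hA)]
  refine Eq.trans ?_ (h2.symm.trans ?_)
  · refine integral_congr_ae ?_
    filter_upwards [coeFn_factorL2 hq (indicatorConstLp 2 hA (measure_ne_top ν A) (1 : ℝ)),
      hq.quasiMeasurePreserving.ae
        (indicatorConstLp_coeFn (p := 2) (hs := hA) (hμs := measure_ne_top ν A) (c := (1 : ℝ)))]
      with ζ h3 h4
    rw [h3, Function.comp_apply, h4]
    by_cases h : q ζ ∈ A <;> simp [h]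
  · refine integral_congr_ae ?_
    filter_upwards [indicatorConstLp_coeFn (p := 2) (hs := hA) (hμs := measure_ne_top ν A)
      (c := (1 : ℝ))] with ζ h4
    rw [h4]
    by_cases h : ζ ∈ A <;> simp [h]

theorem inner_opL2_family {S : Type} {inv : S → S} {K : S → I × I → ℝ}
    (hK : KernelFamily μ inv K) (s : S) (x y : Lp ℝ 2 μ) :
    inner ℝ (opL2 (hK.bdd s) x) y = inner ℝ x (opL2 (hK.bdd (inv s)) y) := by
  rw [inner_opL2]
  congr 1
  refine Lp.ext ?_
  refine (coeFn_opL2 _ _).trans ?_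
  rw [hK.transpose]
  exact (coeFn_opL2 _ _).symm

/-- The operator with label `s` sends the function of a tree to that of the tree hung on a new edge
`s`. The image is thus a coordinate of the profile, whose choice depends on `t` and `s` only and not
on the kernel. -/
theorem opL2_factorL2_toLp {S : Type} [Countable S] {inv : S → S} {K : S → I × I → ℝ}
    {ν : Measure (ProfileSpace S)} [IsProbabilityMeasure ν] (hK : KernelFamily μ inv K)
    (hq : MeasurePreserving (profile μ K) μ ν) (s : S) {F : C(ProfileSpace S, ℝ)}
    {t : RootedTree S} (ht : (fun ξ => F (profile μ K ξ)) =ᵐ[μ] treeFun μ K t) :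
    opL2 (hK.bdd s) (factorL2 hq (ContinuousMap.toLp 2 ν ℝ F)) =
      factorL2 hq (ContinuousMap.toLp 2 ν ℝ (coordinate (.graft s t .one))) := by
  have e : ∀ G : C(ProfileSpace S, ℝ), factorL2 hq (ContinuousMap.toLp 2 ν ℝ G) =ᵐ[μ]
      fun ξ => G (profile μ K ξ) := fun G => by
    filter_upwards [coeFn_factorL2 hq (ContinuousMap.toLp 2 ν ℝ G),
      hq.quasiMeasurePreserving.ae (ContinuousMap.coeFn_toLp (p := 2) (𝕜 := ℝ) ν G)] with ξ h1 h2
    rw [h1, Function.comp_apply, h2]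
  refine Lp.ext ((coeFn_opL2 _ _).trans ?_)
  rw [adjOp_congr ((e F).trans ht), ← treeFun_graft_one]
  exact ((e _).trans (coordinate_profile hK _)).symm

end Factor

/-! ### The relatively independent coupling and its intertwining property. -/

section Coupling

variable {I₁ I₂ X : Type*} [MeasurableSpace I₁] [MeasurableSpace I₂] [MeasurableSpace X]
  {μ₁ : Measure I₁} {μ₂ : Measure I₂} {ν : Measure X}
  [IsProbabilityMeasure μ₁] [IsProbabilityMeasure μ₂] [IsProbabilityMeasure ν]

/-- The relatively independent coupling over a common factor. -/
noncomputable def factorCoupling [StandardBorelSpace I₂] [Nonempty I₂] {q₁ : I₁ → X} {q₂ : I₂ → X}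
    (h₁ : MeasurePreserving q₁ μ₁ ν) (h₂ : MeasurePreserving q₂ μ₂ ν) : Coupling μ₁ μ₂ where
  toMeasure := μ₁ ⊗ₘ (condDistrib id q₂ μ₂).comap q₁ h₁.measurable
  fst_eq := Measure.fst_compProd _ _
  snd_eq := by
    have e : (condDistrib id q₂ μ₂).comap q₁ h₁.measurable ∘ₘ μ₁ =
        condDistrib id q₂ μ₂ ∘ₘ (μ₁.map q₁) := by
      ext s hs
      rw [Measure.bind_apply hs (Kernel.aemeasurable _), Measure.bind_apply hs (Kernel.aemeasurable _),
        lintegral_map (Kernel.measurable_coe _ hs) h₁.measurable]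
      rfl
    rw [Measure.snd_compProd, e, h₁.map_eq, ← h₂.map_eq,
      condDistrib_comp_map h₂.measurable.aemeasurable measurable_id.aemeasurable, Measure.map_id]

theorem Coupling.ae_fst (γ : Coupling μ₁ μ₂) {p : I₁ → Prop} (h : ∀ᵐ x ∂μ₁, p x) :
    ∀ᵐ z ∂γ.toMeasure, p z.1 :=
  (show MeasurePreserving Prod.fst γ.toMeasure μ₁ from
    ⟨measurable_fst, γ.fst_eq⟩).quasiMeasurePreserving.ae h

theorem Coupling.ae_snd (γ : Coupling μ₁ μ₂) {p : I₂ → Prop} (h : ∀ᵐ x ∂μ₂, p x) :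
    ∀ᵐ z ∂γ.toMeasure, p z.2 :=
  (show MeasurePreserving Prod.snd γ.toMeasure μ₂ from
    ⟨measurable_snd, γ.snd_eq⟩).quasiMeasurePreserving.ae h

theorem Coupling.memLp_fst (γ : Coupling μ₁ μ₂) {f : I₁ → ℝ} {p : ENNReal} (h : MemLp f p μ₁) :
    MemLp (fun z => f z.1) p γ.toMeasure :=
  h.comp_measurePreserving (⟨measurable_fst, γ.fst_eq⟩ : MeasurePreserving Prod.fst γ.toMeasure μ₁)

theorem Coupling.memLp_snd (γ : Coupling μ₁ μ₂) {f : I₂ → ℝ} {p : ENNReal} (h : MemLp f p μ₂) :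
    MemLp (fun z => f z.2) p γ.toMeasure :=
  h.comp_measurePreserving (⟨measurable_snd, γ.snd_eq⟩ : MeasurePreserving Prod.snd γ.toMeasure μ₂)

theorem Coupling.integral_fst (γ : Coupling μ₁ μ₂) {f : I₁ → ℝ} (h : AEStronglyMeasurable f μ₁) :
    ∫ z, f z.1 ∂γ.toMeasure = ∫ x, f x ∂μ₁ := by
  conv_rhs => rw [← γ.fst_eq]
  rw [Measure.fst, integral_map measurable_fst.aemeasurable]
  rw [← Measure.fst, γ.fst_eq]; exact h

theorem Coupling.integral_snd (γ : Coupling μ₁ μ₂) {f : I₂ → ℝ} (h : AEStronglyMeasurable f μ₂) :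
    ∫ z, f z.2 ∂γ.toMeasure = ∫ x, f x ∂μ₂ := by
  conv_rhs => rw [← γ.snd_eq]
  rw [Measure.snd, integral_map measurable_snd.aemeasurable]
  rw [← Measure.snd, γ.snd_eq]; exact h

/-- This identifies the operator of the coupling as `J₁ J₂*`: condition on the factor in the second
space, then pull back to the first. -/
theorem integral_factorCoupling [StandardBorelSpace I₂] [Nonempty I₂] {q₁ : I₁ → X} {q₂ : I₂ → X}
    (h₁ : MeasurePreserving q₁ μ₁ ν) (h₂ : MeasurePreserving q₂ μ₂ ν) (f : Lp ℝ 2 μ₂)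
    (g : Lp ℝ 2 μ₁) :
    ∫ z, f z.2 * g z.1 ∂(factorCoupling h₁ h₂).toMeasure =
      inner ℝ (factorL2 h₁ ((factorL2 h₂).toContinuousLinearMap.adjoint f)) g := by
  have hi : Integrable (fun z : I₁ × I₂ => f z.2 * g z.1) (factorCoupling h₁ h₂).toMeasure :=
    ((factorCoupling h₁ h₂).memLp_snd (Lp.memLp f)).integrable_mul
      ((factorCoupling h₁ h₂).memLp_fst (Lp.memLp g))
  rw [inner_L2_eq]
  refine (Measure.integral_compProd hi).trans (integral_congr_ae ?_)
  filter_upwards [h₁.quasiMeasurePreserving.ae (integral_condDistrib_eq_adjoint h₂ f),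
    coeFn_factorL2 h₁ ((factorL2 h₂).toContinuousLinearMap.adjoint f)] with ξ h3 h4
  rw [h4, Function.comp_apply, ← h3]
  simp only [integral_mul_const, Kernel.comap_apply]

variable {S : Type} {inv : S → S} {K₁ : S → I₁ × I₁ → ℝ} {K₂ : S → I₂ × I₂ → ℝ}

/-- The coupling `γ` intertwines the families of kernels, in weak form. -/
def Coupling.Intertwines (γ : Coupling μ₁ μ₂) (inv : S → S) (K₁ : S → I₁ × I₁ → ℝ)
    (K₂ : S → I₂ × I₂ → ℝ) : Prop :=
  ∀ s, ∀ f : I₂ → ℝ, MemLp f 2 μ₂ → ∀ g : I₁ → ℝ, MemLp g 2 μ₁ →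
    ∫ z, adjOp μ₂ (K₂ s) f z.2 * g z.1 ∂γ.toMeasure =
      ∫ z, f z.2 * adjOp μ₁ (K₁ (inv s)) g z.1 ∂γ.toMeasure

theorem factorCoupling_intertwines [StandardBorelSpace I₂] [Nonempty I₂] {q₁ : I₁ → X}
    {q₂ : I₂ → X} (h₁ : MeasurePreserving q₁ μ₁ ν) (h₂ : MeasurePreserving q₂ μ₂ ν)
    (hK₁ : KernelFamily μ₁ inv K₁) (hK₂ : KernelFamily μ₂ inv K₂)
    (h : ∀ s, ∀ x : Lp ℝ 2 ν, ∃ y, opL2 (hK₁.bdd s) (factorL2 h₁ x) = factorL2 h₁ y ∧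
      opL2 (hK₂.bdd s) (factorL2 h₂ x) = factorL2 h₂ y) :
    (factorCoupling h₁ h₂).Intertwines inv K₁ K₂ := by
  intro s f hf g hg
  have := inner_adjoint_intertwine (factorL2 h₁) (factorL2 h₂) (inner_opL2_family hK₁ s)
    (inner_opL2_family hK₂ s) (fun x => (h s x).imp fun _ hy => hy.1) (h (inv s))
    (hf.toLp f) (hg.toLp g)
  rw [← integral_factorCoupling, ← integral_factorCoupling] at this
  refine Eq.trans ?_ (this.trans ?_)
  · refine integral_congr_ae ?_
    filter_upwards [Coupling.ae_fst _ hg.coeFn_toLp,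
      Coupling.ae_snd _ (coeFn_opL2 (hK₂.bdd s) (hf.toLp f))] with z h3 h4
    rw [h3, h4, adjOp_congr hf.coeFn_toLp]
  · refine integral_congr_ae ?_
    filter_upwards [Coupling.ae_snd _ hf.coeFn_toLp,
      Coupling.ae_fst _ (coeFn_opL2 (hK₁.bdd (inv s)) (hg.toLp g))] with z h3 h4
    rw [h3, h4, adjOp_congr hg.coeFn_toLp]

theorem exists_factor_profile [Countable S] {ν : Measure (ProfileSpace S)} [IsProbabilityMeasure ν]
    (hK₁ : KernelFamily μ₁ inv K₁) (hK₂ : KernelFamily μ₂ inv K₂)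
    (h₁ : MeasurePreserving (profile μ₁ K₁) μ₁ ν) (h₂ : MeasurePreserving (profile μ₂ K₂) μ₂ ν)
    (s : S) (x : Lp ℝ 2 ν) :
    ∃ y, opL2 (hK₁.bdd s) (factorL2 h₁ x) = factorL2 h₁ y ∧
      opL2 (hK₂.bdd s) (factorL2 h₂ x) = factorL2 h₂ y := by
  refine exists_factor_of_dense (factorL2 h₁) (factorL2 h₂) _ _
    (ContinuousMap.toLp 2 ν ℝ : C(ProfileSpace S, ℝ) →L[ℝ] Lp ℝ 2 ν)
    (ContinuousMap.toLp_denseRange ℝ ν ℝ (by norm_num)) (fun P hP h => eq_top_of_coordinate_mem P hP h)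
    (fun F hF => ?_) x
  obtain ⟨t, ht₁, ht₂⟩ := exists_treeFun_eq hK₁ hK₂ hF
  exact ⟨ContinuousMap.toLp 2 ν ℝ (coordinate (.graft s t .one)),
    opL2_factorL2_toLp hK₁ h₁ s ht₁, opL2_factorL2_toLp hK₂ h₂ s ht₂⟩

theorem exists_intertwining_coupling [Countable S] [StandardBorelSpace I₂]
    (hK₁ : KernelFamily μ₁ inv K₁) (hK₂ : KernelFamily μ₂ inv K₂)
    (h : ∀ t : RootedTree S, ∫ ξ, treeFun μ₁ K₁ t ξ ∂μ₁ = ∫ ξ, treeFun μ₂ K₂ t ξ ∂μ₂) :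
    ∃ γ : Coupling μ₁ μ₂, γ.Intertwines inv K₁ K₂ := by
  have : Nonempty I₂ := nonempty_of_isProbabilityMeasure μ₂
  have h₁ : MeasurePreserving (profile μ₁ K₁) μ₁ (μ₁.map (profile μ₁ K₁)) :=
    ⟨measurable_profile hK₁, rfl⟩
  have h₂ : MeasurePreserving (profile μ₂ K₂) μ₂ (μ₁.map (profile μ₁ K₁)) :=
    ⟨measurable_profile hK₂, (map_profile_eq hK₁ hK₂ h).symm⟩
  have := Measure.isProbabilityMeasure_map (μ := μ₁) h₁.measurable.aemeasurable
  exact ⟨factorCoupling h₁ h₂, factorCoupling_intertwines h₁ h₂ hK₁ hK₂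
    (exists_factor_profile hK₁ hK₂ h₁ h₂)⟩

end Coupling

/-! ### Intertwining in operator form and in weak form -/

section WeakForm

variable {I₁ I₂ : Type*} [MeasurableSpace I₁] [MeasurableSpace I₂]
  {μ₁ : Measure I₁} {μ₂ : Measure I₂} [IsProbabilityMeasure μ₁] [IsProbabilityMeasure μ₂]

theorem transposeKernel_transposeKernel {I E : Type*} (w : I × I → E) :
    transposeKernel (transposeKernel w) = w := rfl

/-- `γ` intertwines the operators of the kernels `k₁` and `k₂`, in weak form. -/
def Coupling.WeakIntertwine (γ : Coupling μ₁ μ₂) (k₁ : I₁ × I₁ → ℝ) (k₂ : I₂ × I₂ → ℝ) : Prop :=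
  ∀ f : I₂ → ℝ, MemLp f 2 μ₂ → ∀ g : I₁ → ℝ, MemLp g 2 μ₁ →
    ∫ z, adjOp μ₂ k₂ f z.2 * g z.1 ∂γ.toMeasure =
      ∫ z, f z.2 * adjOp μ₁ (transposeKernel k₁) g z.1 ∂γ.toMeasure

theorem Coupling.integral_op_mul [StandardBorelSpace I₂] (γ : Coupling μ₁ μ₂) {f : I₂ → ℝ}
    {g : I₁ → ℝ} (h : Integrable (fun z => f z.2 * g z.1) γ.toMeasure) :
    ∫ ξ, γ.op f ξ * g ξ ∂μ₁ = ∫ z, f z.2 * g z.1 ∂γ.toMeasure := by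
  have : Nonempty I₂ := nonempty_of_isProbabilityMeasure μ₂
  have e : μ₁ ⊗ₘ γ.toMeasure.condKernel = γ.toMeasure := by
    have := Measure.disintegrate γ.toMeasure γ.toMeasure.condKernel
    rwa [γ.fst_eq] at this
  have h' := h
  rw [← e] at h'
  have := Measure.integral_compProd h'
  rw [e] at this
  rw [this]
  simp only [integral_mul_const]
  rfl

theorem Coupling.integrable_op [StandardBorelSpace I₂] (γ : Coupling μ₁ μ₂) {f : I₂ → ℝ}
    (hf : Integrable f μ₂) : Integrable (γ.op f) μ₁ := by
  have : Nonempty I₂ := nonempty_of_isProbabilityMeasure μ₂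
  have e : μ₁ ⊗ₘ γ.toMeasure.condKernel = γ.toMeasure := by
    have := Measure.disintegrate γ.toMeasure γ.toMeasure.condKernel
    rwa [γ.fst_eq] at this
  have h : Integrable (fun z : I₁ × I₂ => f z.2) (μ₁ ⊗ₘ γ.toMeasure.condKernel) := by
    rw [e]
    exact memLp_one_iff_integrable.1 (γ.memLp_snd (memLp_one_iff_integrable.2 hf))
  exact Integrable.integral_compProd (κ := Kernel.const Unit μ₁)
      (η := Kernel.prodMkLeft Unit γ.toMeasure.condKernel) (a := ()) h

theorem Coupling.integrable_mul (γ : Coupling μ₁ μ₂) {f : I₂ → ℝ} {g : I₁ → ℝ}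
    (hf : MemLp f 2 μ₂) (hg : MemLp g 2 μ₁) :
    Integrable (fun z => f z.2 * g z.1) γ.toMeasure :=
  (γ.memLp_snd hf).integrable_mul (γ.memLp_fst hg)

/-- The weak form is the operator identity tested against `g`, with the operator of `k₁` moved to
`g` as its adjoint. Indicators are enough as test functions for the converse. -/
theorem Coupling.weakIntertwine_iff [StandardBorelSpace I₂] (γ : Coupling μ₁ μ₂)
    {k₁ : I₁ × I₁ → ℝ} {k₂ : I₂ × I₂ → ℝ} {C₁ C₂ : ℝ} (h₁ : BoundedKernel μ₁ C₁ k₁)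
    (h₂ : BoundedKernel μ₂ C₂ k₂) :
    γ.WeakIntertwine k₁ k₂ ↔
      ∀ f : I₂ → ℝ, MemLp f 2 μ₂ → adjOp μ₁ k₁ (γ.op f) =ᵐ[μ₁] γ.op (adjOp μ₂ k₂ f) := by
  have key : ∀ f : I₂ → ℝ, MemLp f 2 μ₂ → ∀ g : I₁ → ℝ, MemLp g 2 μ₁ →
      ∫ ξ, adjOp μ₁ k₁ (γ.op f) ξ * g ξ ∂μ₁ =
        ∫ z, f z.2 * adjOp μ₁ (transposeKernel k₁) g z.1 ∂γ.toMeasure := fun f hf g hg => by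
    have hg1 := MemLp.integrable_two hg
    rw [h₁.adjoint (γ.integrable_op (MemLp.integrable_two hf)) hg1,
      γ.integral_op_mul (γ.integrable_mul hf (h₁.transpose.memLp_adjOp hg1 2))]
  have key2 : ∀ f : I₂ → ℝ, MemLp f 2 μ₂ → ∀ g : I₁ → ℝ, MemLp g 2 μ₁ →
      ∫ ξ, γ.op (adjOp μ₂ k₂ f) ξ * g ξ ∂μ₁ = ∫ z, adjOp μ₂ k₂ f z.2 * g z.1 ∂γ.toMeasure :=
    fun f hf g hg => γ.integral_op_mul
      (γ.integrable_mul (h₂.memLp_adjOp (MemLp.integrable_two hf) 2) hg)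
  constructor
  · intro h f hf
    have hf1 := MemLp.integrable_two hf
    refine Integrable.ae_eq_of_forall_setIntegral_eq _ _
      (h₁.integrable_adjOp (γ.integrable_op hf1))
      (γ.integrable_op (h₂.integrable_adjOp hf1)) fun A hA _ => ?_
    have hg : MemLp (A.indicator fun _ => (1 : ℝ)) 2 μ₁ :=
      memLp_indicator_const 2 hA 1 (Or.inr (measure_ne_top _ _))
    have := (key f hf _ hg).trans ((h f hf _ hg).symm.trans (key2 f hf _ hg).symm)
    have e : ∀ F : I₁ → ℝ, ∫ ξ, F ξ * A.indicator (fun _ => (1 : ℝ)) ξ ∂μ₁ = ∫ ξ in A, F ξ ∂μ₁ :=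
      fun F => by
        rw [← integral_indicator hA]
        refine integral_congr_ae (ae_of_all _ fun ξ => ?_)
        by_cases h : ξ ∈ A <;> simp [h]
    rwa [e, e] at this
  · intro h f hf g hg
    rw [← key f hf g hg, ← key2 f hf g hg]
    refine integral_congr_ae ?_
    filter_upwards [h f hf] with ξ hξ
    rw [hξ]

theorem Coupling.integral_transpose (γ : Coupling μ₁ μ₂) {F : I₂ × I₁ → ℝ} :
    ∫ z, F z ∂γ.transpose.toMeasure = ∫ z, F z.swap ∂γ.toMeasure := by
  show ∫ z, F z ∂(γ.toMeasure.map Prod.swap) = _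
  exact integral_map_equiv MeasurableEquiv.prodComm F

/-- Exchanging the roles of `f` and `g` turns the second identity of (4) into a weak intertwining by
`γ` itself, for the transposed kernels. -/
theorem Coupling.weakIntertwine_transpose (γ : Coupling μ₁ μ₂) (k₁ : I₁ × I₁ → ℝ)
    (k₂ : I₂ × I₂ → ℝ) :
    γ.transpose.WeakIntertwine k₂ k₁ ↔
      γ.WeakIntertwine (transposeKernel k₁) (transposeKernel k₂) := by
  simp only [Coupling.WeakIntertwine, Coupling.integral_transpose, Prod.fst_swap, Prod.snd_swap]
  constructor
  · intro h f hf g hg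
    have := (h g hg f hf).symm
    simpa only [mul_comm, transposeKernel_transposeKernel] using this
  · intro h f hf g hg
    have := (h g hg f hf).symm
    simpa only [mul_comm, transposeKernel_transposeKernel] using this

theorem adjOp_sum {I : Type*} [MeasurableSpace I] {μ : Measure I} [IsProbabilityMeasure μ]
    {ι : Type*} [Fintype ι] {C : ℝ} {k : ι → I × I → ℝ} (hk : ∀ i, BoundedKernel μ C (k i))
    (c : ι → ℝ) {f : I → ℝ} (hf : Integrable f μ) :
    adjOp μ (fun p => ∑ i, c i * k i p) f =ᵐ[μ] fun ξ => ∑ i, c i * adjOp μ (k i) f ξ := by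
  filter_upwards [ae_all_iff.2 fun i => (hk i).integrable_section hf] with ξ hξ
  simp only [adjOp, Finset.sum_mul, ← integral_const_mul]
  rw [← integral_finsetSum]
  · refine integral_congr_ae (ae_of_all _ fun ζ => Finset.sum_congr rfl fun i _ => by ring)
  · exact fun i _ => (hξ i).const_mul _

theorem Coupling.weakIntertwine_sum (γ : Coupling μ₁ μ₂) {ι : Type*} [Fintype ι] {C : ℝ}
    {k₁ : ι → I₁ × I₁ → ℝ} {k₂ : ι → I₂ × I₂ → ℝ} (h₁ : ∀ i, BoundedKernel μ₁ C (k₁ i))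
    (h₂ : ∀ i, BoundedKernel μ₂ C (k₂ i)) (c : ι → ℝ)
    (h : ∀ i, γ.WeakIntertwine (k₁ i) (k₂ i)) :
    γ.WeakIntertwine (fun p => ∑ i, c i * k₁ i p) (fun p => ∑ i, c i * k₂ i p) := by
  intro f hf g hg
  have hf1 := MemLp.integrable_two hf
  have hg1 := MemLp.integrable_two hg
  have e2 := γ.ae_snd (adjOp_sum h₂ c hf1)
  have e1 := γ.ae_fst (adjOp_sum (fun i => (h₁ i).transpose) c hg1)
  calc ∫ z, adjOp μ₂ (fun p => ∑ i, c i * k₂ i p) f z.2 * g z.1 ∂γ.toMeasure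
      = ∫ z, ∑ i, c i * (adjOp μ₂ (k₂ i) f z.2 * g z.1) ∂γ.toMeasure := by
        refine integral_congr_ae ?_
        filter_upwards [e2] with z hz
        rw [hz, Finset.sum_mul]
        exact Finset.sum_congr rfl fun i _ => by ring
    _ = ∑ i, c i * ∫ z, adjOp μ₂ (k₂ i) f z.2 * g z.1 ∂γ.toMeasure := by
        rw [integral_finsetSum]
        · simp only [integral_const_mul]
        · exact fun i _ => (γ.integrable_mul ((h₂ i).memLp_adjOp hf1 2) hg).const_mul _
    _ = ∑ i, c i * ∫ z, f z.2 * adjOp μ₁ (transposeKernel (k₁ i)) g z.1 ∂γ.toMeasure := by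
        exact Finset.sum_congr rfl fun i _ => by rw [h i f hf g hg]
    _ = ∫ z, ∑ i, c i * (f z.2 * adjOp μ₁ (transposeKernel (k₁ i)) g z.1) ∂γ.toMeasure := by
        rw [integral_finsetSum]
        · simp only [integral_const_mul]
        · exact fun i _ => (γ.integrable_mul hf ((h₁ i).transpose.memLp_adjOp hg1 2)).const_mul _
    _ = _ := by
        refine integral_congr_ae ?_
        filter_upwards [e1] with z hz
        have : transposeKernel (fun p => ∑ i, c i * k₁ i p) =
          fun p => ∑ i, c i * transposeKernel (k₁ i) p := rfl
        rw [this, hz, Finset.mul_sum]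
        exact Finset.sum_congr rfl fun i _ => by ring

end WeakForm

/-! ### The coordinate kernels of a vector valued kernel -/

section Coordinates

variable {I : Type*} [MeasurableSpace I] {μ : Measure I} [IsProbabilityMeasure μ] {d : ℕ}
  {w : I × I → EuclideanSpace ℝ (Fin d)}

/-- The coordinates of `w` and of its transpose, and the zero kernel. -/
def coordKernel (w : I × I → EuclideanSpace ℝ (Fin d)) : Option (Fin d ⊕ Fin d) → I × I → ℝ
  -- The extra label keeps the label type inhabited when `d = 0`, so that labellings of all pairs of
  -- vertices exist.
  | none => 0
  | some (.inl l) => fun p => w p l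
  | some (.inr l) => fun p => transposeKernel w p l

/-- Transposition on the indices of the coordinate kernels. -/
def coordInv (d : ℕ) : Option (Fin d ⊕ Fin d) → Option (Fin d ⊕ Fin d) :=
  Option.map Sum.swap

theorem boundedKernel_coord (hw : Measurable w) (hw1 : ∀ᵐ p ∂μ.prod μ, ‖w p‖ ≤ 1) (l : Fin d) :
    BoundedKernel μ 1 (fun p => w p l) where
  measurable := (EuclideanSpace.proj (𝕜 := ℝ) l).continuous.measurable.comp hw
  bound := hw1.mono fun p hp => (PiLp.norm_apply_le (w p) l).trans hp

theorem kernelFamily_coord (hw : Measurable w) (hw1 : ∀ᵐ p ∂μ.prod μ, ‖w p‖ ≤ 1) :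
    KernelFamily μ (coordInv d) (coordKernel w) where
  bdd := by
    rintro (_ | l | l)
    · exact ⟨measurable_const, by simp [coordKernel]⟩
    · exact boundedKernel_coord hw hw1 l
    · exact (boundedKernel_coord hw hw1 l).transpose
  transpose := by
    rintro (_ | l | l) <;> rfl

theorem scalarKernel_eq_sum (e : EuclideanSpace ℝ (Fin d)) :
    scalarKernel e w = fun p => ∑ l, e l * w p l := by
  funext p
  simp [scalarKernel, PiLp.inner_apply, mul_comm]

theorem scalarKernel_single (l : Fin d) :
    scalarKernel (EuclideanSpace.single l 1) w = fun p => w p l := by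
  funext p
  rw [scalarKernel, EuclideanSpace.inner_single_left]
  simp

theorem boundedKernel_scalar (hw : Measurable w) (hw1 : ∀ᵐ p ∂μ.prod μ, ‖w p‖ ≤ 1)
    (e : EuclideanSpace ℝ (Fin d)) : BoundedKernel μ ‖e‖ (scalarKernel e w) where
  measurable := measurable_const.inner hw
  bound := hw1.mono fun _ hp => (abs_real_inner_le_norm _ _).trans
    (mul_le_of_le_one_right (norm_nonneg _) hp)

end Coordinates

section Equivalence

variable {I₁ I₂ : Type*} [MeasurableSpace I₁] [MeasurableSpace I₂]
  [StandardBorelSpace I₁] [StandardBorelSpace I₂]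
  {μ₁ : Measure I₁} {μ₂ : Measure I₂} [IsProbabilityMeasure μ₁] [IsProbabilityMeasure μ₂] {d : ℕ}
  {w : I₁ × I₁ → EuclideanSpace ℝ (Fin d)} {u : I₂ × I₂ → EuclideanSpace ℝ (Fin d)}

/-- Labels `inl` account for the first half of (4) and labels `inr` for the second. Linearity passes
from basis vectors to arbitrary `e`. -/
theorem Coupling.intertwines_iff (hw : Measurable w) (hw1 : ∀ᵐ p ∂μ₁.prod μ₁, ‖w p‖ ≤ 1)
    (hu : Measurable u) (hu1 : ∀ᵐ p ∂μ₂.prod μ₂, ‖u p‖ ≤ 1) (γ : Coupling μ₁ μ₂) :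
    γ.Intertwines (coordInv d) (coordKernel w) (coordKernel u) ↔
      ∀ e : EuclideanSpace ℝ (Fin d),
        (∀ f : I₂ → ℝ, MemLp f 2 μ₂ →
          adjOp μ₁ (scalarKernel e w) (γ.op f) =ᵐ[μ₁] γ.op (adjOp μ₂ (scalarKernel e u) f)) ∧
        (∀ g : I₁ → ℝ, MemLp g 2 μ₁ →
          γ.transpose.op (adjOp μ₁ (scalarKernel e w) g) =ᵐ[μ₂]
            adjOp μ₂ (scalarKernel e u) (γ.transpose.op g)) := by
  have h2 : ∀ e : EuclideanSpace ℝ (Fin d), (∀ g : I₁ → ℝ, MemLp g 2 μ₁ →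
          γ.transpose.op (adjOp μ₁ (scalarKernel e w) g) =ᵐ[μ₂]
            adjOp μ₂ (scalarKernel e u) (γ.transpose.op g)) ↔
      γ.WeakIntertwine (transposeKernel (scalarKernel e w)) (transposeKernel (scalarKernel e u)) := by
    intro e
    rw [← γ.weakIntertwine_transpose, γ.transpose.weakIntertwine_iff (boundedKernel_scalar hu hu1 e)
      (boundedKernel_scalar hw hw1 e)]
    exact forall₂_congr fun g _ => ⟨fun h => h.symm, fun h => h.symm⟩
  simp only [h2, ← γ.weakIntertwine_iff (boundedKernel_scalar hw hw1 _)
    (boundedKernel_scalar hu hu1 _)]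
  constructor
  · intro h e
    rw [scalarKernel_eq_sum, scalarKernel_eq_sum]
    exact ⟨γ.weakIntertwine_sum (boundedKernel_coord hw hw1) (boundedKernel_coord hu hu1) e
      fun l => h (some (.inl l)),
      γ.weakIntertwine_sum (fun l => (boundedKernel_coord hw hw1 l).transpose)
        (fun l => (boundedKernel_coord hu hu1 l).transpose) e fun l => h (some (.inr l))⟩
  · rintro h (_ | l | l)
    · intro f _ g _
      simp [coordKernel, coordInv, adjOp]
    · have := (h (EuclideanSpace.single l 1)).1
      rwa [scalarKernel_single, scalarKernel_single] at this
    · have := (h (EuclideanSpace.single l 1)).2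
      rwa [scalarKernel_single, scalarKernel_single] at this

theorem exists_coupling_of_integral_treeFun_eq (hw : Measurable w)
    (hw1 : ∀ᵐ p ∂μ₁.prod μ₁, ‖w p‖ ≤ 1)
    (hu : Measurable u) (hu1 : ∀ᵐ p ∂μ₂.prod μ₂, ‖u p‖ ≤ 1)
    (h : ∀ t, ∫ ξ, treeFun μ₁ (coordKernel w) t ξ ∂μ₁ = ∫ ξ, treeFun μ₂ (coordKernel u) t ξ ∂μ₂) :
    ∃ γ : Coupling μ₁ μ₂, ∀ e : EuclideanSpace ℝ (Fin d),
        (∀ f : I₂ → ℝ, MemLp f 2 μ₂ →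
          adjOp μ₁ (scalarKernel e w) (γ.op f) =ᵐ[μ₁] γ.op (adjOp μ₂ (scalarKernel e u) f)) ∧
        (∀ g : I₁ → ℝ, MemLp g 2 μ₁ →
          γ.transpose.op (adjOp μ₁ (scalarKernel e w) g) =ᵐ[μ₂]
            adjOp μ₂ (scalarKernel e u) (γ.transpose.op g)) := by
  obtain ⟨γ, hγ⟩ := exists_intertwining_coupling (kernelFamily_coord hw hw1)
    (kernelFamily_coord hu hu1) h
  exact ⟨γ, (γ.intertwines_iff hw hw1 hu hu1).1 hγ⟩

end Equivalence

/-! ### The spaces of iterated degree measures -/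

section CountablyGenerated

open MeasurableSpace

theorem countablyGenerated_iSup {α ι : Type*} [Countable ι] (m : ι → MeasurableSpace α)
    (h : ∀ i, @CountablyGenerated α (m i)) : @CountablyGenerated α (⨆ i, m i) := by
  choose b hb hm using fun i => (h i).isCountablyGenerated
  refine @CountablyGenerated.mk α (⨆ i, m i) ⟨⋃ i, b i, Set.countable_iUnion hb, ?_⟩
  rw [← iSup_generateFrom]
  exact iSup_congr hm

/-- A countable determining class allows equality of measure-valued maps almost everywhere to be
checked one set at a time. The whole space is included because signed measures that agree on a
π-system may still differ in total mass. -/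
theorem exists_countable_algebra (X : Type*) [m : MeasurableSpace X] [CountablyGenerated X] :
    ∃ A : Set (Set X), A.Countable ∧ IsPiSystem A ∧ Set.univ ∈ A ∧ m = generateFrom A ∧
      ∀ s ∈ A, MeasurableSet s := by
  obtain ⟨b, hb, hm⟩ := CountablyGenerated.isCountablyGenerated (α := X)
  have hA := isSetAlgebra_generateSetAlgebra (𝒜 := b)
  have hgen : m = generateFrom (generateSetAlgebra b) := by
    rw [generateFrom_generateSetAlgebra_eq, hm]
  refine ⟨generateSetAlgebra b, countable_generateSetAlgebra hb, fun s hs t ht _ => hA.inter_mem hs ht,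
    hA.univ_mem, hgen, fun s hs => ?_⟩
  rw [hgen]
  exact measurableSet_generateFrom hs

end CountablyGenerated

namespace UnitSigned

variable {X : Type} [MeasurableSpace X]

theorem measurable_eval {A : Set X} (hA : MeasurableSet A) :
    Measurable fun m : UnitSigned X => m.1 A := by
  refine Measurable.mono (comap_measurable _) ?_ le_rfl
  exact le_iSup (fun A : {A : Set X // MeasurableSet A} =>
    MeasurableSpace.comap (fun m : UnitSigned X => m.1 A.1) inferInstance) ⟨A, hA⟩

theorem measurable_iff {Y : Type*} [MeasurableSpace Y] {f : Y → UnitSigned X} :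
    Measurable f ↔ ∀ A, MeasurableSet A → Measurable fun y => (f y).1 A := by
  refine ⟨fun h A hA => (measurable_eval hA).comp h, fun h => ?_⟩
  refine measurable_iff_comap_le.2 ?_
  show MeasurableSpace.comap f (⨆ A : {A : Set X // MeasurableSet A},
    MeasurableSpace.comap (fun m : UnitSigned X => m.1 A.1) inferInstance) ≤ _
  rw [MeasurableSpace.comap_iSup]
  refine iSup_le fun A => ?_
  rw [MeasurableSpace.comap_comp]
  exact (h A.1 A.2).comap_le

theorem ext_of_generateFrom {C : Set (Set X)} (hgen : ‹MeasurableSpace X› = .generateFrom C)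
    (hC : IsPiSystem C) (huniv : Set.univ ∈ C) {m m' : UnitSigned X}
    (h : ∀ A ∈ C, m.1 A = m'.1 A) : m = m' :=
  Subtype.ext (VectorMeasure.ext_of_generateFrom C h hgen hC (h _ huniv))

/-- Evaluations on a countable algebra generate: the sets with measurable evaluation are closed
under complements and countable disjoint unions, so the π-λ theorem applies. -/
instance [MeasurableSpace.CountablyGenerated X] :
    MeasurableSpace.CountablyGenerated (UnitSigned X) := by
  obtain ⟨C, hC, hpi, huniv, hgen, hmeas⟩ := exists_countable_algebra X
  have : Countable C := hC
  let m₀ : MeasurableSpace (UnitSigned X) :=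
    ⨆ A : C, MeasurableSpace.comap (fun m : UnitSigned X => m.1 A.1) inferInstance
  have key : ∀ A : Set X, MeasurableSet A → Measurable[m₀] fun m : UnitSigned X => m.1 A := by
    intro A hA
    have hb : ∀ A ∈ C, Measurable[m₀] fun m : UnitSigned X => m.1 A := fun A hA =>
      (comap_measurable _).mono (le_iSup (fun A : C =>
        MeasurableSpace.comap (fun m : UnitSigned X => m.1 A.1) inferInstance) ⟨A, hA⟩) le_rfl
    induction A, hA using MeasurableSpace.induction_on_inter hgen hpi with
    | empty => simp
    | basic A hA => exact hb A hA
    | compl A hA ih =>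
      have : (fun m : UnitSigned X => m.1 Aᶜ) = fun m => m.1 Set.univ - m.1 A := by
        funext m
        rw [VectorMeasure.of_compl hA]
      rw [this]
      exact (hb _ huniv).sub ih
    | iUnion f hd hf ih =>
      have : (fun m : UnitSigned X => m.1 (⋃ i, f i)) = fun m => ∑' i, m.1 (f i) := by
        funext m
        exact VectorMeasure.of_disjoint_iUnion hf hd
      rw [this]
      exact Measurable.tsum ih
  have h0 : (⨆ A : {A : Set X // MeasurableSet A},
      MeasurableSpace.comap (fun m : UnitSigned X => m.1 A.1) inferInstance) = m₀ := by
    refine le_antisymm (iSup_le fun A => (key A.1 A.2).comap_le) (iSup_le fun A => ?_)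
    exact le_iSup (fun A : {A : Set X // MeasurableSet A} =>
      MeasurableSpace.comap (fun m : UnitSigned X => m.1 A.1) inferInstance) ⟨A.1, hmeas _ A.2⟩
  have h1 : @MeasurableSpace.CountablyGenerated (UnitSigned X) m₀ :=
    countablyGenerated_iSup _ fun A => .comap _
  rw [← h0] at h1
  exact h1

end UnitSigned

instance countablyGenerated_pi_countable {ι : Type*} [Countable ι] {Y : ι → Type*} [∀ i, MeasurableSpace (Y i)]
    [∀ i, MeasurableSpace.CountablyGenerated (Y i)] :
    MeasurableSpace.CountablyGenerated (∀ i, Y i) :=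
  countablyGenerated_iSup _ fun _ => .comap _

instance (d n : ℕ) : MeasurableSpace.CountablyGenerated (IterSpace d n) := by
  induction n with
  | zero => exact inferInstanceAs (MeasurableSpace.CountablyGenerated PUnit)
  | succ n ih =>
    exact inferInstanceAs (MeasurableSpace.CountablyGenerated
      (IterSpace d n × (Fin d ⊕ Fin d → UnitSigned (IterSpace d n))))

instance (d n : ℕ) : MeasurableSpace.CountablyGenerated (IterFactor d n) := by
  cases n with
  | zero => exact inferInstanceAs (MeasurableSpace.CountablyGenerated PUnit)
  | succ n =>
    exact inferInstanceAs (MeasurableSpace.CountablyGenerated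
      (Fin d ⊕ Fin d → UnitSigned (IterSpace d n)))

/-! ### The iterated degree maps -/

section DegreeMaps

variable {I : Type*} [MeasurableSpace I] {μ : Measure I} [IsProbabilityMeasure μ] {d : ℕ}
  {w : I × I → EuclideanSpace ℝ (Fin d)}

theorem measurable_clip : Measurable clip :=
  measurable_const.max (measurable_const.min measurable_id)

theorem clip_eq_self {x : ℝ} (hx : |x| ≤ 1) : clip x = x := by
  rw [abs_le] at hx
  rw [clip, min_eq_right hx.2, max_eq_right hx.1]

theorem measurable_coordKernel (hw : Measurable w) (s : Option (Fin d ⊕ Fin d)) :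
    Measurable (coordKernel w s) := by
  have h : ∀ l, Measurable fun p => w p l := fun l =>
    (EuclideanSpace.proj (𝕜 := ℝ) l).continuous.measurable.comp hw
  rcases s with (_ | l | l)
  · exact measurable_const
  · exact h l
  · exact (h l).comp measurable_swap

theorem nextDegree_eq {X : Type} [MeasurableSpace X] (g : I → X) (ξ : I) (s : Fin d ⊕ Fin d) :
    nextDegree μ w g ξ s = degreeMeasure μ g fun ζ => coordKernel w (some s) (ξ, ζ) := by
  cases s <;> rfl

theorem nextDegree_apply (hw : Measurable w) {X : Type} [MeasurableSpace X] {g : I → X}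
    (hg : Measurable g) (ξ : I) (s : Fin d ⊕ Fin d) {A : Set X} (hA : MeasurableSet A) :
    (nextDegree μ w g ξ s).1 A =
      adjOp μ (fun p => clip (coordKernel w (some s) p)) ((g ⁻¹' A).indicator 1) ξ := by
  have hm : Measurable fun ζ => clip (coordKernel w (some s) (ξ, ζ)) :=
    measurable_clip.comp ((measurable_coordKernel hw _).comp measurable_prodMk_left)
  have hi : Integrable (fun ζ => clip (coordKernel w (some s) (ξ, ζ))) μ :=
    Integrable.of_bound hm.aestronglyMeasurable 1 (ae_of_all _ fun ζ => abs_clip_le _)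
  rw [nextDegree_eq]
  show ((μ.withDensityᵥ _).map g) A = _
  rw [VectorMeasure.map_apply _ hg hA, withDensityᵥ_apply hi (hg hA), ← integral_indicator (hg hA)]
  refine integral_congr_ae (ae_of_all _ fun ζ => ?_)
  by_cases h : ζ ∈ g ⁻¹' A <;> simp [h]

/-- Degree measures are operators applied to indicators. Through this every statement on operators
becomes one on degrees. -/
theorem nextDegree_ae (hw : Measurable w) (hw1 : ∀ᵐ p ∂μ.prod μ, ‖w p‖ ≤ 1) {X : Type}
    [MeasurableSpace X] {g : I → X} (hg : Measurable g) (s : Fin d ⊕ Fin d) {A : Set X}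
    (hA : MeasurableSet A) :
    (fun ξ => (nextDegree μ w g ξ s).1 A) =ᵐ[μ]
      adjOp μ (coordKernel w (some s)) ((g ⁻¹' A).indicator 1) := by
  have h : (fun ξ => (nextDegree μ w g ξ s).1 A) =
      adjOp μ (fun p => clip (coordKernel w (some s) p)) ((g ⁻¹' A).indicator 1) :=
    funext fun ξ => nextDegree_apply hw hg ξ s hA
  rw [h]
  refine adjOp_congr_kernel ?_ _
  filter_upwards [((kernelFamily_coord hw hw1).bdd (some s)).bound] with p hp
  exact clip_eq_self hp

theorem measurable_nextDegree (hw : Measurable w) {X : Type} [MeasurableSpace X] {g : I → X}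
    (hg : Measurable g) : Measurable (nextDegree μ w g) := by
  refine measurable_pi_lambda _ fun s => UnitSigned.measurable_iff.2 fun A hA => ?_
  simp only [nextDegree_apply hw hg _ s hA]
  exact (stronglyMeasurable_adjOp (measurable_clip.comp (measurable_coordKernel hw _))
    (stronglyMeasurable_one.indicator (hg hA)).aestronglyMeasurable).measurable

theorem measurable_iterMap (hw : Measurable w) (n : ℕ) : Measurable (iterMap μ w n) := by
  induction n with
  | zero => exact measurable_const
  | succ n ih => exact ih.prodMk (measurable_nextDegree hw ih)

theorem measurable_degreeMap (hw : Measurable w) : Measurable (degreeMap μ w) := by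
  refine measurable_pi_lambda _ fun n => ?_
  cases n with
  | zero => exact measurable_const
  | succ n => exact measurable_nextDegree hw (measurable_iterMap hw n)

end DegreeMaps

/-! ### Intertwining couplings preserve the iterated degrees -/

section Intertwining

variable {I₁ I₂ : Type*} [MeasurableSpace I₁] [MeasurableSpace I₂]
  {μ₁ : Measure I₁} {μ₂ : Measure I₂} [IsProbabilityMeasure μ₁] [IsProbabilityMeasure μ₂]
  {S : Type} {inv : S → S} {K₁ : S → I₁ × I₁ → ℝ} {K₂ : S → I₂ × I₂ → ℝ}

theorem KernelFamily.inv_inv {I : Type*} [MeasurableSpace I] {μ : Measure I}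
    {K : S → I × I → ℝ} (hK : KernelFamily μ inv K) (s : S) : K (inv (inv s)) = K s := by
  rw [← hK.transpose, ← hK.transpose, transposeKernel_transposeKernel]

/-- Write `F` and `G` for the two images. Intertwining for `s`, with `f` replaced by `g`, gives `∫ F
G = ∫ G²`. Intertwining for `inv s`, with `g` replaced by `f`, gives `∫ F G = ∫ F²`. Hence `∫ (F -
G)² = 0`. Closure of the family under transposition is what makes the second relation available. -/
theorem Coupling.Intertwines.ae_adjOp_eq {γ : Coupling μ₁ μ₂} (hγ : γ.Intertwines inv K₁ K₂)
    (hK₁ : KernelFamily μ₁ inv K₁) (hK₂ : KernelFamily μ₂ inv K₂) {f : I₂ → ℝ} {g : I₁ → ℝ}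
    (hf : MemLp f 2 μ₂) (hg : MemLp g 2 μ₁) (h : ∀ᵐ z ∂γ.toMeasure, f z.2 = g z.1) (s : S) :
    ∀ᵐ z ∂γ.toMeasure, adjOp μ₂ (K₂ s) f z.2 = adjOp μ₁ (K₁ s) g z.1 := by
  have hf1 := MemLp.integrable_two hf
  have hg1 := MemLp.integrable_two hg
  set F := adjOp μ₂ (K₂ s) f
  set G := adjOp μ₁ (K₁ s) g
  have hF : MemLp F 2 μ₂ := (hK₂.bdd s).memLp_adjOp hf1 2
  have hG : MemLp G 2 μ₁ := (hK₁.bdd s).memLp_adjOp hg1 2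
  have hFG : ∫ z, F z.2 * G z.1 ∂γ.toMeasure = ∫ ξ, G ξ * G ξ ∂μ₁ := by
    calc ∫ z, F z.2 * G z.1 ∂γ.toMeasure
        = ∫ z, f z.2 * adjOp μ₁ (K₁ (inv s)) G z.1 ∂γ.toMeasure := hγ s f hf G hG
      _ = ∫ z, g z.1 * adjOp μ₁ (K₁ (inv s)) G z.1 ∂γ.toMeasure := by
          refine integral_congr_ae ?_
          filter_upwards [h] with z hz
          rw [hz]
      _ = ∫ ξ, g ξ * adjOp μ₁ (K₁ (inv s)) G ξ ∂μ₁ :=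
          γ.integral_fst (f := fun ξ => g ξ * adjOp μ₁ (K₁ (inv s)) G ξ)
            (hg.1.mul ((hK₁.bdd _).memLp_adjOp (MemLp.integrable_two hG) 2).1)
      _ = _ := by
          rw [← hK₁.transpose, ← (hK₁.bdd s).adjoint hg1 (MemLp.integrable_two hG)]
  have hFF : ∫ z, F z.2 * G z.1 ∂γ.toMeasure = ∫ ζ, F ζ * F ζ ∂μ₂ := by
    calc ∫ z, F z.2 * G z.1 ∂γ.toMeasure
        = ∫ z, adjOp μ₂ (K₂ (inv s)) F z.2 * g z.1 ∂γ.toMeasure := by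
          rw [hγ (inv s) F hF g hg, hK₁.inv_inv]
      _ = ∫ z, adjOp μ₂ (K₂ (inv s)) F z.2 * f z.2 ∂γ.toMeasure := by
          refine integral_congr_ae ?_
          filter_upwards [h] with z hz
          rw [hz]
      _ = ∫ ζ, adjOp μ₂ (K₂ (inv s)) F ζ * f ζ ∂μ₂ :=
          γ.integral_snd (f := fun ζ => adjOp μ₂ (K₂ (inv s)) F ζ * f ζ)
            (((hK₂.bdd _).memLp_adjOp (MemLp.integrable_two hF) 2).1.mul hf.1)
      _ = _ := by
          rw [(hK₂.bdd _).adjoint (MemLp.integrable_two hF) hf1, hK₂.transpose, hK₂.inv_inv]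
  have i1 : Integrable (fun z : I₁ × I₂ => F z.2 * F z.2) γ.toMeasure :=
    (γ.memLp_snd hF).integrable_mul (γ.memLp_snd hF)
  have i2 : Integrable (fun z : I₁ × I₂ => G z.1 * G z.1) γ.toMeasure :=
    (γ.memLp_fst hG).integrable_mul (γ.memLp_fst hG)
  have i3 : Integrable (fun z : I₁ × I₂ => 2 * (F z.2 * G z.1)) γ.toMeasure :=
    (γ.integrable_mul hF hG).const_mul 2
  have e : ∀ z : I₁ × I₂, (F z.2 - G z.1) ^ 2 = F z.2 * F z.2 + G z.1 * G z.1 - 2 * (F z.2 * G z.1) :=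
    fun z => by ring
  have h0 : ∫ z, (F z.2 - G z.1) ^ 2 ∂γ.toMeasure = 0 := by
    simp only [e]
    rw [integral_sub (f := fun z : I₁ × I₂ => F z.2 * F z.2 + G z.1 * G z.1) (i1.add i2) i3,
      integral_add i1 i2, integral_const_mul,
      γ.integral_snd (f := fun ζ => F ζ * F ζ) (hF.1.mul hF.1),
      γ.integral_fst (f := fun ζ => G ζ * G ζ) (hG.1.mul hG.1), ← hFF, hFG]
    ring
  have hi : Integrable (fun z : I₁ × I₂ => (F z.2 - G z.1) ^ 2) γ.toMeasure := by
    simp only [e]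
    exact (i1.add i2).sub i3
  filter_upwards [(integral_eq_zero_iff_of_nonneg (fun z => sq_nonneg _) hi).1 h0] with z hz
  exact sub_eq_zero.1 (pow_eq_zero_iff (two_ne_zero) |>.1 hz)

variable {d : ℕ} {w : I₁ × I₁ → EuclideanSpace ℝ (Fin d)} {u : I₂ × I₂ → EuclideanSpace ℝ (Fin d)}

/-- If the degree maps agree up to level `n` along `γ`, then so do the indicators of their level
sets, hence the images of these under the operators, which are the values of the degree measures of
level `n + 1`. The coupling is thus carried by pairs of points with equal degrees. -/
theorem Coupling.Intertwines.degreeLaw_eq {γ : Coupling μ₁ μ₂}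
    (hγ : γ.Intertwines (coordInv d) (coordKernel w) (coordKernel u))
    (hw : Measurable w) (hw1 : ∀ᵐ p ∂μ₁.prod μ₁, ‖w p‖ ≤ 1)
    (hu : Measurable u) (hu1 : ∀ᵐ p ∂μ₂.prod μ₂, ‖u p‖ ≤ 1) :
    degreeLaw μ₁ w = degreeLaw μ₂ u := by
  have step : ∀ n, (∀ᵐ z ∂γ.toMeasure, iterMap μ₂ u n z.2 = iterMap μ₁ w n z.1) →
      ∀ᵐ z ∂γ.toMeasure, nextDegree μ₂ u (iterMap μ₂ u n) z.2 =
        nextDegree μ₁ w (iterMap μ₁ w n) z.1 := by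
    intro n hn
    obtain ⟨C, hC, hpi, huniv, hgen, hmeas⟩ := exists_countable_algebra (IterSpace d n)
    have key : ∀ s : Fin d ⊕ Fin d, ∀ᵐ z ∂γ.toMeasure, ∀ A ∈ C,
        (nextDegree μ₂ u (iterMap μ₂ u n) z.2 s).1 A =
          (nextDegree μ₁ w (iterMap μ₁ w n) z.1 s).1 A := by
      intro s
      rw [ae_ball_iff hC]
      intro A hA
      have m₁ := measurable_iterMap (μ := μ₁) hw n
      have m₂ := measurable_iterMap (μ := μ₂) hu n
      have := hγ.ae_adjOp_eq (kernelFamily_coord hw hw1) (kernelFamily_coord hu hu1)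
        (f := (iterMap μ₂ u n ⁻¹' A).indicator 1) (g := (iterMap μ₁ w n ⁻¹' A).indicator 1)
        (memLp_indicator_const 2 (m₂ (hmeas A hA)) 1 (Or.inr (measure_ne_top _ _)))
        (memLp_indicator_const 2 (m₁ (hmeas A hA)) 1 (Or.inr (measure_ne_top _ _)))
        (by
          filter_upwards [hn] with z hz
          have hiff : z.2 ∈ iterMap μ₂ u n ⁻¹' A ↔ z.1 ∈ iterMap μ₁ w n ⁻¹' A := by
            show iterMap μ₂ u n z.2 ∈ A ↔ iterMap μ₁ w n z.1 ∈ A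
            rw [hz]
          by_cases h : z.1 ∈ iterMap μ₁ w n ⁻¹' A
          · rw [Set.indicator_of_mem h, Set.indicator_of_mem (hiff.2 h)]; rfl
          · rw [Set.indicator_of_notMem h, Set.indicator_of_notMem fun h' => h (hiff.1 h')]) (some s)
      filter_upwards [this, γ.ae_fst (nextDegree_ae hw hw1 m₁ s (hmeas A hA)),
        γ.ae_snd (nextDegree_ae hu hu1 m₂ s (hmeas A hA))] with z h1 h2 h3
      rw [h3, h2, h1]
    filter_upwards [ae_all_iff.2 key] with z hz
    funext s
    exact UnitSigned.ext_of_generateFrom hgen hpi huniv (hz s)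
  have hiter : ∀ n, ∀ᵐ z ∂γ.toMeasure, iterMap μ₂ u n z.2 = iterMap μ₁ w n z.1 := by
    intro n
    induction n with
    | zero => exact ae_of_all _ fun _ => rfl
    | succ n ih =>
      filter_upwards [ih, step n ih] with z h1 h2
      exact Prod.ext h1 h2
  have hdeg : ∀ᵐ z ∂γ.toMeasure, degreeMap μ₂ u z.2 = degreeMap μ₁ w z.1 := by
    filter_upwards [ae_all_iff.2 fun n => step n (hiter n)] with z hz
    funext n
    cases n with
    | zero => rfl
    | succ n => exact hz n
  have e₁ : μ₁.map (degreeMap μ₁ w) = γ.toMeasure.map fun z => degreeMap μ₁ w z.1 := by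
    have := Measure.map_map (μ := γ.toMeasure) (measurable_degreeMap (μ := μ₁) hw) measurable_fst
    rwa [← Measure.fst, γ.fst_eq] at this
  have e₂ : μ₂.map (degreeMap μ₂ u) = γ.toMeasure.map fun z => degreeMap μ₂ u z.2 := by
    have := Measure.map_map (μ := γ.toMeasure) (measurable_degreeMap (μ := μ₂) hu) measurable_snd
    rwa [← Measure.snd, γ.snd_eq] at this
  rw [degreeLaw, degreeLaw, e₁, e₂]
  exact (Measure.map_congr hdeg).symm

end Intertwining

/-! ### Relative completion -/

section RelCompletion

variable {I : Type*}

/-- The sets of the ambient `σ`-algebra that agree with a member of `D` up to a null set. -/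
@[reducible] def relCompletion (D : MeasurableSpace I) {mI : MeasurableSpace I} (μ : Measure I) :
    MeasurableSpace I where
  MeasurableSet' s := MeasurableSet[mI] s ∧ ∃ t, MeasurableSet[D] t ∧ s =ᵐ[μ] t
  measurableSet_empty := ⟨MeasurableSet.empty, ∅, @MeasurableSet.empty I D, ae_eq_rfl⟩
  measurableSet_compl := fun _ ⟨h, t, ht, hst⟩ => ⟨h.compl, tᶜ, @MeasurableSet.compl I t D ht,
    ae_eq_set_compl_compl.2 hst⟩
  measurableSet_iUnion := fun f hf => by
    choose h t ht hst using hf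
    exact ⟨MeasurableSet.iUnion h, ⋃ i, t i, @MeasurableSet.iUnion I ℕ D _ t ht,
      Filter.EventuallyEq.countable_iUnion hst⟩

theorem relCompletion_le (D : MeasurableSpace I) {mI : MeasurableSpace I} (μ : Measure I) :
    relCompletion D μ ≤ mI := fun _ h => h.1

theorem le_relCompletion {D : MeasurableSpace I} {mI : MeasurableSpace I} (μ : Measure I)
    (h : D ≤ mI) : D ≤ relCompletion D μ := fun s hs => ⟨h s hs, s, hs, ae_eq_rfl⟩

theorem isRelComplete_relCompletion (D : MeasurableSpace I) {mI : MeasurableSpace I}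
    (μ : Measure I) : IsRelComplete μ (relCompletion D μ) := by
  rintro Z Z₀ hZ ⟨-, t, ht, hst⟩ h1 h2
  exact ⟨hZ, t, ht, (ae_eq_set.2 ⟨h1, h2⟩).trans hst⟩

theorem IsRelComplete.measurableSet_of_ae_eq {E : MeasurableSpace I} {mI : MeasurableSpace I}
    {μ : Measure I} (hE : IsRelComplete μ E) {s t : Set I} (hs : MeasurableSet[mI] s)
    (ht : MeasurableSet[E] t) (h : s =ᵐ[μ] t) : MeasurableSet[E] s :=
  hE s t hs ht (ae_eq_set.1 h).1 (ae_eq_set.1 h).2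

theorem relCompletion_le_of_isRelComplete {D E : MeasurableSpace I} {mI : MeasurableSpace I}
    {μ : Measure I} (hE : IsRelComplete μ E) (h : D ≤ E) : relCompletion D μ ≤ E := by
  rintro s ⟨hs, t, ht, hst⟩
  exact hE.measurableSet_of_ae_eq hs (h t ht) hst

theorem IsRelComplete.measurable {E : MeasurableSpace I} {mI : MeasurableSpace I}
    {μ : Measure I} (hE : IsRelComplete μ E) {f : I → ℝ} (hf : Measurable[mI] f)
    (hfE : AEStronglyMeasurable[E] f μ) : Measurable[E] f := by
  obtain ⟨g, hg, hfg⟩ := hfE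
  intro B hB
  refine hE.measurableSet_of_ae_eq (hf hB) (hg.measurable hB) ?_
  filter_upwards [hfg] with x hx
  apply propext
  show f x ∈ B ↔ g x ∈ B
  rw [hx]

end RelCompletion

/-! ### Criteria for invariance -/

section Invariance

variable {I : Type*}

theorem stronglyMeasurable_tsum_real {E : MeasurableSpace I} {g : ℕ → I → ℝ}
    (hg : ∀ i, StronglyMeasurable (g i)) : StronglyMeasurable fun ξ => ∑' i, g i ξ :=
  (Measurable.tsum fun i => (hg i).measurable).stronglyMeasurable

/-- Simple functions are dense in `L²(D)`, the operator is continuous, and the `E`-measurable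
classes form a closed subset of `L²`. -/
theorem aestronglyMeasurable_adjOp_of_sets {D E : MeasurableSpace I} {mI : MeasurableSpace I}
    {μ : Measure I} [IsProbabilityMeasure μ] (hD : D ≤ mI) (hE : E ≤ mI) {k : I × I → ℝ} {C : ℝ}
    (hk : BoundedKernel μ C k)
    (h : ∀ A, MeasurableSet[D] A → AEStronglyMeasurable[E] (adjOp μ k (A.indicator 1)) μ)
    {f : I → ℝ} (hf : MemLp f 2 μ) (hfD : AEStronglyMeasurable[D] f μ) :
    AEStronglyMeasurable[E] (adjOp μ k f) μ := by
  refine MemLp.induction_stronglyMeasurable hD (by norm_num)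
    (fun f => AEStronglyMeasurable[E] (adjOp μ k f) μ) ?_ ?_ ?_ ?_ hf hfD
  · intro c s hs _
    have : (s.indicator fun _ => c) = c • s.indicator (1 : I → ℝ) := by
      funext x
      by_cases hx : x ∈ s <;> simp [hx]
    rw [this, adjOp_smul]
    exact (h s hs).const_smul c
  · intro f g _ hf hg _ _ hf' hg'
    exact (hf'.add hg').congr
      (hk.adjOp_add (MemLp.integrable_two hf) (MemLp.integrable_two hg)).symm
  · have hcl : IsClosed {g : Lp ℝ 2 μ | AEStronglyMeasurable[E] g μ} :=
      isClosed_aestronglyMeasurable hE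
    have hc : Continuous fun f : lpMeas ℝ ℝ D 2 μ => opL2 hk (f : Lp ℝ 2 μ) :=
      (opL2 hk).continuous.comp continuous_subtype_val
    convert hcl.preimage hc using 1
    ext f
    exact ⟨fun hf => AEStronglyMeasurable.congr hf (coeFn_opL2 hk _).symm,
      fun hf => AEStronglyMeasurable.congr hf (coeFn_opL2 hk _)⟩
  · intro f g hfg _ hf
    rwa [← adjOp_congr hfg]

/-- A π-λ argument: for almost every `ξ` the value is a signed measure of `q ⁻¹' A`, so complements
become differences and disjoint unions become sums. -/
theorem aestronglyMeasurable_adjOp_of_piSystem {X : Type*} {E : MeasurableSpace I}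
    {mI : MeasurableSpace I} [mX : MeasurableSpace X]
    {μ : Measure I} [IsProbabilityMeasure μ] {k : I × I → ℝ} {C : ℝ}
    (hk : BoundedKernel μ C k) {q : I → X} (hq : Measurable q) {P : Set (Set X)}
    (hgen : mX = .generateFrom P) (hP : IsPiSystem P) (huniv : Set.univ ∈ P)
    (h : ∀ A ∈ P, AEStronglyMeasurable[E] (adjOp μ k ((q ⁻¹' A).indicator 1)) μ)
    {A : Set X} (hA : MeasurableSet A) :
    AEStronglyMeasurable[E] (adjOp μ k ((q ⁻¹' A).indicator 1)) μ := by
  have hint : ∀ {A : Set X}, MeasurableSet A → Integrable ((q ⁻¹' A).indicator (1 : I → ℝ)) μ :=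
    fun hA => (integrable_const (1 : ℝ)).indicator (hq hA)
  induction A, hA using MeasurableSpace.induction_on_inter hgen hP with
  | empty =>
    simp only [Set.preimage_empty, Set.indicator_empty]
    have : adjOp μ k (fun _ => (0 : ℝ)) = fun _ => 0 := by funext ξ; simp [adjOp]
    rw [this]
    exact aestronglyMeasurable_const
  | basic A hA => exact h A hA
  | compl A hA ih =>
    have e : (q ⁻¹' Aᶜ).indicator (1 : I → ℝ) =
        (q ⁻¹' Set.univ).indicator 1 - (q ⁻¹' A).indicator 1 := by
      funext x
      by_cases hx : q x ∈ A <;> simp [hx]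
    rw [e]
    exact ((h _ huniv).sub ih).congr (hk.adjOp_sub (hint MeasurableSet.univ) (hint hA)).symm
  | iUnion f hd hf ih =>
    choose g hg hfg using ih
    refine ⟨fun ξ => ∑' i, g i ξ, ?_, ?_⟩
    · exact stronglyMeasurable_tsum_real hg
    · filter_upwards [ae_all_iff.2 hfg, hk.ae_bound] with ξ h1 h2
      have hkξ : Integrable (fun ζ => k (ξ, ζ)) μ :=
        Integrable.of_bound (hk.measurable.comp measurable_prodMk_left).aestronglyMeasurable C
          (by simpa using h2)
      have e : ∀ B : Set I, MeasurableSet B →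
          adjOp μ k (B.indicator 1) ξ = ∫ ζ in B, k (ξ, ζ) ∂μ := fun B hB => by
        rw [← integral_indicator hB]
        refine integral_congr_ae (ae_of_all _ fun ζ => ?_)
        by_cases h : ζ ∈ B <;> simp [h]
      rw [e _ (hq (MeasurableSet.iUnion hf)), Set.preimage_iUnion,
        integral_iUnion (fun i => hq (hf i))
          (fun i j hij => (hd hij).preimage q) hkξ.integrableOn]
      exact tsum_congr fun i => by rw [← h1, e _ (hq (hf i))]

theorem isInvariantPair_of_coord {d : ℕ} {D E : MeasurableSpace I} {mI : MeasurableSpace I}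
    {μ : Measure I} [IsProbabilityMeasure μ] {w : I × I → EuclideanSpace ℝ (Fin d)}
    (hw : Measurable w) (hw1 : ∀ᵐ p ∂μ.prod μ, ‖w p‖ ≤ 1)
    (h : ∀ f : I → ℝ, Measurable[D] f → MemLp f 2 μ → ∀ s : Fin d ⊕ Fin d,
      AEStronglyMeasurable[E] (adjOp μ (coordKernel w (some s)) f) μ) :
    IsInvariantPair μ w D E := by
  intro f hfD hf e
  have key : ∀ (k : Fin d → I × I → ℝ), (∀ l, BoundedKernel μ 1 (k l)) →
      (∀ l, AEStronglyMeasurable[E] (adjOp μ (k l) f) μ) →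
      AEStronglyMeasurable[E] (adjOp μ (fun p => ∑ l, e l * k l p) f) μ := fun k hk hm => by
    refine AEStronglyMeasurable.congr ?_ (adjOp_sum hk e (MemLp.integrable_two hf)).symm
    choose g hg hfg using hm
    refine ⟨fun ξ => ∑ l, e l * g l ξ, ?_, ?_⟩
    · exact Finset.stronglyMeasurable_fun_sum _ fun l _ => (hg l).const_mul (e l)
    · filter_upwards [ae_all_iff.2 hfg] with ξ hξ
      exact Finset.sum_congr rfl fun l _ => by rw [hξ]
  rw [scalarKernel_eq_sum, scalarKernel_eq_sum]
  exact ⟨key _ (boundedKernel_coord hw hw1) fun l => h f hfD hf (.inl l),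
    key _ (fun l => (boundedKernel_coord hw hw1 l).transpose) fun l => h f hfD hf (.inr l)⟩

theorem IsInvariantPair.coord {d : ℕ} {D E : MeasurableSpace I} {mI : MeasurableSpace I}
    {μ : Measure I} {w : I × I → EuclideanSpace ℝ (Fin d)}
    (h : IsInvariantPair μ w D E) {f : I → ℝ} (hfD : Measurable[D] f) (hf : MemLp f 2 μ)
    (s : Fin d ⊕ Fin d) : AEStronglyMeasurable[E] (adjOp μ (coordKernel w (some s)) f) μ := by
  rcases s with l | l
  · have := (h f hfD hf (EuclideanSpace.single l 1)).1
    rwa [scalarKernel_single] at this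
  · have := (h f hfD hf (EuclideanSpace.single l 1)).2
    rwa [scalarKernel_single] at this

theorem IsInvariantPair.mono_left {d : ℕ} {D D' E : MeasurableSpace I} {_ : MeasurableSpace I}
    {μ : Measure I} {w : I × I → EuclideanSpace ℝ (Fin d)}
    (h : IsInvariantPair μ w D E) (hD : D' ≤ D) : IsInvariantPair μ w D' E :=
  fun f hfD => h f (hfD.mono hD le_rfl)

end Invariance

/-! ### Truncations of degree sequences -/

section Truncation

variable {d : ℕ}

/-- The truncation `M → M_n`. -/
def truncate (d : ℕ) : (n : ℕ) → DegreeSpace d → IterSpace d n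
  | 0 => fun _ => PUnit.unit
  | n + 1 => fun x => (truncate d n x, x (n + 1))

theorem measurable_truncate (n : ℕ) : Measurable (truncate d n) := by
  induction n with
  | zero => exact measurable_const
  | succ n ih => exact ih.prodMk (measurable_pi_apply (n + 1))

theorem truncate_degreeMap {I : Type*} [MeasurableSpace I] (μ : Measure I) [IsProbabilityMeasure μ]
    (w : I × I → EuclideanSpace ℝ (Fin d)) (n : ℕ) (ξ : I) :
    truncate d n (degreeMap μ w ξ) = iterMap μ w n ξ := by
  induction n with
  | zero => rfl
  | succ n ih => exact Prod.ext ih rfl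

/-- The sets of degree sequences determined by a truncation. -/
def cylinders (d : ℕ) : Set (Set (DegreeSpace d)) :=
  {B | ∃ (n : ℕ) (A : Set (IterSpace d n)), MeasurableSet A ∧ B = truncate d n ⁻¹' A}

theorem exists_truncate_preimage {m n : ℕ} (h : m ≤ n) {A : Set (IterSpace d m)}
    (hA : MeasurableSet A) :
    ∃ A' : Set (IterSpace d n), MeasurableSet A' ∧ truncate d m ⁻¹' A = truncate d n ⁻¹' A' := by
  induction n, h using Nat.le_induction with
  | base => exact ⟨A, hA, rfl⟩
  | succ n _ ih =>
    obtain ⟨A', hA', h⟩ := ih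
    have hfst : @Measurable (IterSpace d (n + 1)) (IterSpace d n) _ _ Prod.fst :=
      @measurable_fst (IterSpace d n) (Fin d ⊕ Fin d → UnitSigned (IterSpace d n))
        inferInstance inferInstance
    exact ⟨Prod.fst ⁻¹' A', hfst hA', h⟩

theorem isPiSystem_cylinders : IsPiSystem (cylinders d) := by
  rintro _ ⟨m, A, hA, rfl⟩ _ ⟨n, B, hB, rfl⟩ -
  obtain ⟨A', hA', h⟩ := exists_truncate_preimage (le_max_left m n) hA
  obtain ⟨B', hB', h'⟩ := exists_truncate_preimage (le_max_right m n) hB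
  exact ⟨max m n, A' ∩ B', hA'.inter hB', by rw [h, h', Set.preimage_inter]⟩

theorem univ_mem_cylinders : Set.univ ∈ cylinders d := ⟨0, Set.univ, MeasurableSet.univ, rfl⟩

theorem generateFrom_cylinders :
    (inferInstance : MeasurableSpace (DegreeSpace d)) = .generateFrom (cylinders d) := by
  refine le_antisymm (iSup_le fun n => ?_) (MeasurableSpace.generateFrom_le ?_)
  · rintro _ ⟨A, hA, rfl⟩
    refine MeasurableSpace.measurableSet_generateFrom ?_
    cases n with
    | zero =>
      -- The factor of index `0` and the space `M_0` are both the one-point space, so a set in the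
      -- former serves as a set in the latter.
      refine ⟨0, Set.univ ∩ {x | x ∈ A}, MeasurableSet.univ.inter hA, ?_⟩
      rw [Set.univ_inter]
      rfl
    | succ n =>
      have hsnd : @Measurable (IterSpace d (n + 1)) (IterFactor d (n + 1)) _ _ Prod.snd :=
        @measurable_snd (IterSpace d n) (Fin d ⊕ Fin d → UnitSigned (IterSpace d n))
          inferInstance inferInstance
      exact ⟨n + 1, Prod.snd ⁻¹' A, hsnd hA, rfl⟩
  · rintro _ ⟨n, A, hA, rfl⟩
    exact measurable_truncate n hA

end Truncation

/-! ### The canonical algebra is generated by the degree map -/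

section Canonical

variable {I : Type*} [mI : MeasurableSpace I] {μ : Measure I} [IsProbabilityMeasure μ] {d : ℕ}
  {w : I × I → EuclideanSpace ℝ (Fin d)}

/-- The relative completion of the `σ`-algebra generated by the degree map. -/
@[reducible] noncomputable def degreeAlgebra (μ : Measure I) [IsProbabilityMeasure μ]
    (w : I × I → EuclideanSpace ℝ (Fin d)) : MeasurableSpace I :=
  relCompletion (MeasurableSpace.comap (degreeMap μ w) inferInstance) μ

/-- The image of the indicator of a cylinder of level `n` is the degree measure of level `n + 1`
evaluated at its base, hence a function of the degree map. Cylinders suffice by the two preceding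
criteria for invariance. -/
theorem isInvariantPair_degreeAlgebra (hw : Measurable w) (hw1 : ∀ᵐ p ∂μ.prod μ, ‖w p‖ ≤ 1) :
    IsInvariantPair μ w (degreeAlgebra μ w) (degreeAlgebra μ w) := by
  have hq := measurable_degreeMap (μ := μ) hw
  refine isInvariantPair_of_coord hw hw1 fun f hfD hf s => ?_
  have hk := (kernelFamily_coord hw hw1).bdd (some s)
  refine aestronglyMeasurable_adjOp_of_sets (relCompletion_le _ μ) (relCompletion_le _ μ) hk ?_ hf
    (Measurable.stronglyMeasurable hfD).aestronglyMeasurable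
  rintro A ⟨-, _, ⟨B, hB, rfl⟩, hAB⟩
  have e : A.indicator (1 : I → ℝ) =ᵐ[μ] (degreeMap μ w ⁻¹' B).indicator 1 :=
    indicator_ae_eq_of_ae_eq_set hAB
  rw [adjOp_congr e]
  refine aestronglyMeasurable_adjOp_of_piSystem hk hq generateFrom_cylinders isPiSystem_cylinders
    univ_mem_cylinders ?_ hB
  rintro _ ⟨n, A, hA, rfl⟩
  have hpre : degreeMap μ w ⁻¹' (truncate d n ⁻¹' A) = iterMap μ w n ⁻¹' A := by
    ext ξ
    simp only [Set.mem_preimage, truncate_degreeMap]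
  rw [hpre]
  have hm : Measurable fun x : DegreeSpace d => ((x (n + 1) : IterFactor d (n + 1)) s).1 A :=
    (UnitSigned.measurable_eval hA).comp ((measurable_pi_apply s).comp (measurable_pi_apply (n + 1)))
  refine ⟨fun ξ => ((degreeMap μ w ξ (n + 1) : IterFactor d (n + 1)) s).1 A, ?_, ?_⟩
  · refine Measurable.stronglyMeasurable ?_
    refine Measurable.mono (hm.comp (comap_measurable (degreeMap μ w)))
      (le_relCompletion μ hq.comap_le) le_rfl
  · exact (nextDegree_ae hw hw1 (measurable_iterMap hw n) s hA).symm

theorem isInvariantAlgebra_degreeAlgebra (hw : Measurable w)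
    (hw1 : ∀ᵐ p ∂μ.prod μ, ‖w p‖ ≤ 1) : IsInvariantAlgebra μ w (degreeAlgebra μ w) where
  le := relCompletion_le _ μ
  relComplete := isRelComplete_relCompletion _ μ
  invariant := isInvariantPair_degreeAlgebra hw hw1

theorem canonicalSeq_le_succ (w : I × I → EuclideanSpace ℝ (Fin d)) (n : ℕ) :
    canonicalSeq μ w n ≤ canonicalSeq μ w (n + 1) := by
  induction n with
  | zero =>
    refine le_sInf ?_
    rintro E ⟨hE, hEc, -⟩
    refine sInf_le ⟨hE, hEc, ?_⟩
    rintro s (rfl | rfl)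
    · exact @MeasurableSet.empty I E
    · exact @MeasurableSet.univ I E
  | succ n ih =>
    refine le_sInf ?_
    rintro E ⟨hE, hEc, hinv⟩
    exact sInf_le ⟨hE, hEc, hinv.mono_left ih⟩

theorem canonicalSeq_le_degreeAlgebra (hw : Measurable w) (hw1 : ∀ᵐ p ∂μ.prod μ, ‖w p‖ ≤ 1)
    (n : ℕ) : canonicalSeq μ w n ≤ degreeAlgebra μ w := by
  induction n with
  | zero =>
    refine sInf_le ⟨relCompletion_le _ μ, isRelComplete_relCompletion _ μ, ?_⟩
    rintro s (rfl | rfl)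
    · exact @MeasurableSet.empty I (degreeAlgebra μ w)
    · exact @MeasurableSet.univ I (degreeAlgebra μ w)
  | succ n ih =>
    exact sInf_le ⟨relCompletion_le _ μ, isRelComplete_relCompletion _ μ,
      (isInvariantPair_degreeAlgebra hw hw1).mono_left ih⟩

theorem measurable_sInf {J : Type*} {S : Set (MeasurableSpace J)} {Y : Type*} [MeasurableSpace Y]
    {f : J → Y} (h : ∀ E ∈ S, Measurable[E] f) : Measurable[sInf S] f := by
  intro A hA
  rw [MeasurableSpace.measurableSet_sInf]
  exact fun E hE => h E hE hA

end Canonical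

/-! ### Measurability of the degree maps along the canonical sequence. -/

section Measurability

variable {I : Type*}

theorem measurable_indicator_one {D : MeasurableSpace I} {s : Set I} (hs : MeasurableSet s) :
    Measurable (s.indicator (1 : I → ℝ)) :=
  measurable_const.indicator hs

theorem measurable_nextDegree_of_isInvariantPair {D E : MeasurableSpace I} [MeasurableSpace I]
    {μ : Measure I} [IsProbabilityMeasure μ] {d : ℕ} {w : I × I → EuclideanSpace ℝ (Fin d)}
    (hw : Measurable w) (hw1 : ∀ᵐ p ∂μ.prod μ, ‖w p‖ ≤ 1) {X : Type} [MeasurableSpace X] {g : I → X}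
    (hg : Measurable g) (hgD : Measurable[D] g) (hE : IsRelComplete μ E)
    (hinv : IsInvariantPair μ w D E) : Measurable[E] (nextDegree μ w g) := by
  refine @measurable_pi_lambda _ _ _ E _ _ fun s => (@UnitSigned.measurable_iff _ _ _ E _).2 fun A hA => ?_
  refine hE.measurable ?_ ?_
  · exact (UnitSigned.measurable_eval hA).comp
      ((measurable_pi_apply s).comp (measurable_nextDegree hw hg))
  · refine (hinv.coord (f := (g ⁻¹' A).indicator 1) ?_ ?_ s).congr (nextDegree_ae hw hw1 hg s hA).symm
    · exact measurable_indicator_one (hgD hA)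
    · exact memLp_indicator_const 2 (hg hA) 1 (Or.inr (measure_ne_top _ _))

theorem comap_degreeMap_le {E : MeasurableSpace I} [MeasurableSpace I] {μ : Measure I}
    [IsProbabilityMeasure μ] {d : ℕ} {w : I × I → EuclideanSpace ℝ (Fin d)}
    (h : ∀ n, Measurable[E] (iterMap μ w n)) :
    MeasurableSpace.comap (degreeMap μ w) inferInstance ≤ E := by
  refine Measurable.comap_le ?_
  refine @measurable_pi_lambda _ _ _ E _ _ fun n => ?_
  cases n with
  | zero => exact @measurable_const _ _ _ E _
  | succ n =>
    exact (@measurable_snd (IterSpace d n) (Fin d ⊕ Fin d → UnitSigned (IterSpace d n))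
          inferInstance inferInstance).comp (h (n + 1))

variable [mI : MeasurableSpace I] {μ : Measure I} [IsProbabilityMeasure μ] {d : ℕ}
  {w : I × I → EuclideanSpace ℝ (Fin d)}

theorem measurable_nextDegree_canonicalSeq (hw : Measurable w)
    (hw1 : ∀ᵐ p ∂μ.prod μ, ‖w p‖ ≤ 1) {n : ℕ}
    (h : Measurable[canonicalSeq μ w n] (iterMap μ w n)) :
    Measurable[canonicalSeq μ w (n + 1)] (nextDegree μ w (iterMap μ w n)) := by
  have hm := measurable_iterMap (μ := μ) hw n
  exact measurable_sInf fun E hE => @measurable_nextDegree_of_isInvariantPair I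
    (canonicalSeq μ w n) E mI μ _ d w hw hw1 _ _ _ hm h hE.2.1 hE.2.2

theorem measurable_iterMap_canonicalSeq (hw : Measurable w)
    (hw1 : ∀ᵐ p ∂μ.prod μ, ‖w p‖ ≤ 1) (n : ℕ) :
    Measurable[canonicalSeq μ w n] (iterMap μ w n) := by
  induction n with
  | zero => exact @measurable_const _ _ _ (canonicalSeq μ w 0) _
  | succ n ih =>
    exact @Measurable.prodMk I (canonicalSeq μ w (n + 1)) (IterSpace d n)
      (Fin d ⊕ Fin d → UnitSigned (IterSpace d n)) inferInstance inferInstance _ _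
      (ih.mono (canonicalSeq_le_succ w n) le_rfl) (measurable_nextDegree_canonicalSeq hw hw1 ih)

/-- The degree algebra is invariant, so it contains every term of the canonical sequence.
Conversely, the degree map of level `n` is measurable for the term of index `n`, so any relatively
complete algebra that contains all terms makes the whole degree map measurable. -/
theorem canonicalAlgebra_eq (hw : Measurable w) (hw1 : ∀ᵐ p ∂μ.prod μ, ‖w p‖ ≤ 1) :
    canonicalAlgebra μ w = degreeAlgebra μ w := by
  have hm := measurable_iterMap_canonicalSeq hw hw1
  refine le_antisymm (sInf_le ⟨relCompletion_le _ μ, isRelComplete_relCompletion _ μ, ?_⟩)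
    (le_sInf ?_)
  · rintro s ⟨n, hs⟩
    exact canonicalSeq_le_degreeAlgebra hw hw1 n s hs
  · rintro E ⟨-, hEc, hES⟩
    refine @relCompletion_le_of_isRelComplete I _ E mI μ hEc
      (@comap_degreeMap_le I E mI μ _ d w fun n => ?_)
    exact (hm n).mono (fun s hs => hES s ⟨n, hs⟩) le_rfl

theorem isInvariantAlgebra_canonicalAlgebra (hw : Measurable w)
    (hw1 : ∀ᵐ p ∂μ.prod μ, ‖w p‖ ≤ 1) : IsInvariantAlgebra μ w (canonicalAlgebra μ w) := by
  rw [canonicalAlgebra_eq hw hw1]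
  exact isInvariantAlgebra_degreeAlgebra hw hw1

end Measurability

/-! ### Quotient kernels -/

section Quotient

variable {I : Type*}

/-- Null modifications of a side of a rectangle are null in the product, so completing the factors
enlarges the product only inside its own completion. -/
theorem prod_le_relCompletion {J : Type*} [MeasurableSpace J] [MeasurableSpace I] {μ : Measure I}
    [IsProbabilityMeasure μ] {q : I → J} :
    (relCompletion (MeasurableSpace.comap q inferInstance) μ).prod
        (relCompletion (MeasurableSpace.comap q inferInstance) μ) ≤
      relCompletion (MeasurableSpace.comap (Prod.map q q) inferInstance) (μ.prod μ) := by
  refine sup_le ?_ ?_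
  · rintro _ ⟨s, ⟨hs, _, ⟨B, hB, rfl⟩, hst⟩, rfl⟩
    exact ⟨measurable_fst hs, Prod.fst ⁻¹' (q ⁻¹' B), ⟨Prod.fst ⁻¹' B, measurable_fst hB, rfl⟩,
      Measure.quasiMeasurePreserving_fst.preimage_ae_eq hst⟩
  · rintro _ ⟨s, ⟨hs, _, ⟨B, hB, rfl⟩, hst⟩, rfl⟩
    exact ⟨measurable_snd hs, Prod.snd ⁻¹' (q ⁻¹' B), ⟨Prod.snd ⁻¹' B, measurable_snd hB, rfl⟩,
      Measure.quasiMeasurePreserving_snd.preimage_ae_eq hst⟩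

theorem comap_prodMap_le {J : Type*} [MeasurableSpace J] [MeasurableSpace I] {μ : Measure I}
    {q : I → J} (hq : Measurable q) :
    MeasurableSpace.comap (Prod.map q q) inferInstance ≤
      (relCompletion (MeasurableSpace.comap q inferInstance) μ).prod
        (relCompletion (MeasurableSpace.comap q inferInstance) μ) := by
  have h : Measurable[relCompletion (MeasurableSpace.comap q inferInstance) μ] q :=
    (comap_measurable q).mono (le_relCompletion μ hq.comap_le) le_rfl
  exact Measurable.comap_le ((h.comp (@measurable_fst _ _ (relCompletion _ μ) (relCompletion _ μ))).prodMk
    (h.comp (@measurable_snd _ _ (relCompletion _ μ) (relCompletion _ μ))))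

/-- The conditional expectation given `q × q` factors through `q × q`. It is also a version of the
average, because the larger algebra contains only null modifications of the same sets. -/
theorem exists_quotient_kernel {J : Type*} [MeasurableSpace J] [MeasurableSpace I] {μ : Measure I}
    [IsProbabilityMeasure μ] {d : ℕ} {w : I × I → EuclideanSpace ℝ (Fin d)}
    (hwi : Integrable w (μ.prod μ)) {q : I → J} (hq : Measurable q) :
    ∃ a : J × J → EuclideanSpace ℝ (Fin d), Measurable a ∧
      average (relCompletion (MeasurableSpace.comap q inferInstance) μ) μ w =ᵐ[μ.prod μ]
        fun p => a (q p.1, q p.2) := by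
  set m' : MeasurableSpace (I × I) := MeasurableSpace.comap (Prod.map q q) inferInstance with hm'
  have hle : m' ≤ Prod.instMeasurableSpace := (hq.prodMap hq).comap_le
  obtain ⟨a, ha, hcomp⟩ := (stronglyMeasurable_condExp (m := m') (μ := μ.prod μ)
    (f := w)).exists_eq_measurable_comp
  refine ⟨a, ha.measurable, ?_⟩
  have hC : (relCompletion (MeasurableSpace.comap q inferInstance) μ).prod
      (relCompletion (MeasurableSpace.comap q inferInstance) μ) ≤ Prod.instMeasurableSpace :=
    (prod_le_relCompletion).trans (relCompletion_le _ _)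
  have hfin : condExp m' (μ.prod μ) w =ᵐ[μ.prod μ]
      average (relCompletion (MeasurableSpace.comap q inferInstance) μ) μ w := by
    refine ae_eq_condExp_of_forall_setIntegral_eq hC hwi
      (fun s _ _ => integrable_condExp.integrableOn) (fun s hs _ => ?_)
      (stronglyMeasurable_condExp.mono (comap_prodMap_le hq)).aestronglyMeasurable
    obtain ⟨-, t, ht, hst⟩ := prod_le_relCompletion s hs
    rw [setIntegral_congr_set hst, setIntegral_congr_set hst, setIntegral_condExp hle hwi ht]
  rw [hcomp] at hfin
  exact hfin.symm

theorem isQuotientMap_relCompletion {J : Type*} [MeasurableSpace J] [MeasurableSpace I]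
    {μ : Measure I} {q : I → J} (hq : Measurable q) :
    IsQuotientMap (relCompletion (MeasurableSpace.comap q inferInstance) μ) μ (μ.map q) q where
  measurePreserving := ⟨hq, rfl⟩
  measurableSet_iff s := by
    refine and_congr_right fun _ => ⟨?_, ?_⟩
    · rintro ⟨_, ⟨B, hB, rfl⟩, h⟩
      exact ⟨B, hB, h⟩
    · rintro ⟨B, hB, h⟩
      exact ⟨_, ⟨B, hB, rfl⟩, h⟩

end Quotient

/-! ### Equal degree laws give isomorphic quotients -/

/-- This replaces the degree space by the Cantor space, which is standard Borel. Only the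
`σ`-algebra has to be preserved, so the map need not be injective. -/
theorem comap_mapNatBool (X : Type*) [m : MeasurableSpace X] [MeasurableSpace.CountablyGenerated X] :
    MeasurableSpace.comap (MeasurableSpace.mapNatBool X) inferInstance = m := by
  refine le_antisymm (MeasurableSpace.measurable_mapNatBool X).comap_le ?_
  conv_lhs => rw [← MeasurableSpace.generateFrom_natGeneratingSequence X]
  refine MeasurableSpace.generateFrom_le ?_
  rintro _ ⟨n, rfl⟩
  refine ⟨(fun x : ℕ → Bool => x n) ⁻¹' {true}, measurable_pi_apply n (MeasurableSet.singleton _), ?_⟩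
  ext x
  simp [MeasurableSpace.mapNatBool]

theorem ae_eq_of_setIntegral_eq_of_piSystem {X : Type*} [mX : MeasurableSpace X] {ν : Measure X}
    [IsFiniteMeasure ν] {F G : X → ℝ} (hF : Integrable F ν) (hG : Integrable G ν) {P : Set (Set X)}
    (hgen : mX = .generateFrom P) (hP : IsPiSystem P) (huniv : Set.univ ∈ P)
    (h : ∀ A ∈ P, ∫ x in A, F x ∂ν = ∫ x in A, G x ∂ν) : F =ᵐ[ν] G := by
  have hm : ∀ A ∈ P, MeasurableSet A := fun A hA => hgen ▸ MeasurableSpace.measurableSet_generateFrom hA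
  have key : ∀ A ∈ P, ν.withDensityᵥ F A = ν.withDensityᵥ G A := fun A hA => by
    rw [withDensityᵥ_apply hF (hm A hA), withDensityᵥ_apply hG (hm A hA), h A hA]
  exact hF.ae_eq_of_withDensityᵥ_eq hG
    (VectorMeasure.ext_of_generateFrom P key hgen hP (key _ huniv))

section Law

variable {I : Type*} [mI : MeasurableSpace I] {μ : Measure I} [IsProbabilityMeasure μ] {d : ℕ}
  {w : I × I → EuclideanSpace ℝ (Fin d)}

instance : IsFiniteMeasure (degreeLaw μ w) := by
  unfold degreeLaw; infer_instance

theorem integrable_of_norm_le_one (hw : Measurable w) (hw1 : ∀ᵐ p ∂μ.prod μ, ‖w p‖ ≤ 1) :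
    Integrable w (μ.prod μ) :=
  Integrable.of_bound hw.aestronglyMeasurable 1 hw1

theorem degreeAlgebra_eq_comap {J : Type*} [MeasurableSpace J] {e : DegreeSpace d → J}
    (he : MeasurableSpace.comap e inferInstance = (inferInstance : MeasurableSpace (DegreeSpace d))) :
    degreeAlgebra μ w =
      relCompletion (MeasurableSpace.comap (fun ξ => e (degreeMap μ w ξ)) inferInstance) μ := by
  rw [degreeAlgebra, ← he, MeasurableSpace.comap_comp]

theorem prodMap_degreeMap_map (hw : Measurable w) :
    (μ.prod μ).map (Prod.map (degreeMap μ w) (degreeMap μ w)) =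
      (degreeLaw μ w).prod (degreeLaw μ w) :=
  (Measure.map_prod_map μ μ (measurable_degreeMap hw) (measurable_degreeMap hw)).symm

/-- The right side depends on `w` only through `degreeLaw μ w`. The reason is that the average and
`w` have the same integral over the preimage of the rectangle, and integrating `w` over the second
variable gives a degree measure. -/
theorem setIntegral_quotient_kernel (hw : Measurable w) (hw1 : ∀ᵐ p ∂μ.prod μ, ‖w p‖ ≤ 1)
    {b : DegreeSpace d × DegreeSpace d → EuclideanSpace ℝ (Fin d)} (hb : Measurable b)
    (hav : average (degreeAlgebra μ w) μ w =ᵐ[μ.prod μ]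
      fun p => b (degreeMap μ w p.1, degreeMap μ w p.2))
    {A : Set (DegreeSpace d)} (hA : MeasurableSet A) {n : ℕ} {B : Set (IterSpace d n)}
    (hB : MeasurableSet B) (l : Fin d) :
    ∫ p in A ×ˢ (truncate d n ⁻¹' B), b p l ∂(degreeLaw μ w).prod (degreeLaw μ w) =
      ∫ x in A, ((x (n + 1) : IterFactor d (n + 1)) (.inl l)).1 B ∂(degreeLaw μ w) := by
  have hq := measurable_degreeMap (μ := μ) hw
  have hwi := integrable_of_norm_le_one hw hw1
  have hB' := measurable_truncate n hB
  have hproj : Measurable fun x : EuclideanSpace ℝ (Fin d) => x l :=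
    (EuclideanSpace.proj (𝕜 := ℝ) l).continuous.measurable
  set A' := degreeMap μ w ⁻¹' A with hA'
  set B' := degreeMap μ w ⁻¹' (truncate d n ⁻¹' B) with hB''
  have hmA : MeasurableSet A' := hq hA
  have hmB : MeasurableSet B' := hq hB'
  have hiB : iterMap μ w n ⁻¹' B = B' := by
    ext ξ
    simp only [hB'', Set.mem_preimage, truncate_degreeMap]
  have hset : MeasurableSet[(degreeAlgebra μ w).prod (degreeAlgebra μ w)] (A' ×ˢ B') := by
    refine comap_prodMap_le hq _ ⟨A ×ˢ (truncate d n ⁻¹' B), hA.prod hB', rfl⟩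
  have hle : (degreeAlgebra μ w).prod (degreeAlgebra μ w) ≤ Prod.instMeasurableSpace :=
    prod_le_relCompletion.trans (relCompletion_le _ _)
  have hproj_int : ∀ {F : I × I → EuclideanSpace ℝ (Fin d)}, Integrable F (μ.prod μ) →
      ∫ p in A' ×ˢ B', F p l ∂μ.prod μ = (∫ p in A' ×ˢ B', F p ∂μ.prod μ) l := fun hF =>
    ContinuousLinearMap.integral_comp_comm (EuclideanSpace.proj (𝕜 := ℝ) l) hF.integrableOn
  calc ∫ p in A ×ˢ (truncate d n ⁻¹' B), b p l ∂(degreeLaw μ w).prod (degreeLaw μ w)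
      = ∫ p in A' ×ˢ B', b (degreeMap μ w p.1, degreeMap μ w p.2) l ∂μ.prod μ := by
        rw [← prodMap_degreeMap_map hw, setIntegral_map (f := fun p => b p l)
          (hA.prod hB') (hproj.comp hb).aestronglyMeasurable (hq.prodMap hq).aemeasurable]
        rfl
    _ = ∫ p in A' ×ˢ B', average (degreeAlgebra μ w) μ w p l ∂μ.prod μ := by
        refine integral_congr_ae (ae_restrict_of_ae ?_)
        filter_upwards [hav] with p hp
        rw [hp]
    _ = ∫ p in A' ×ˢ B', w p l ∂μ.prod μ := by
        rw [hproj_int (F := average (degreeAlgebra μ w) μ w) integrable_condExp, hproj_int hwi]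
        exact congrArg (fun v : EuclideanSpace ℝ (Fin d) => v l) (setIntegral_condExp hle hwi hset)
    _ = ∫ ξ in A', adjOp μ (fun p => w p l) (B'.indicator 1) ξ ∂μ := by
        rw [setIntegral_prod _ (boundedKernel_coord (μ := μ) hw hw1 l).integrable.integrableOn]
        refine integral_congr_ae (ae_of_all _ fun ξ => ?_)
        show ∫ ζ in B', w (ξ, ζ) l ∂μ = ∫ ζ, w (ξ, ζ) l * B'.indicator 1 ζ ∂μ
        rw [← integral_indicator hmB]
        refine integral_congr_ae (ae_of_all _ fun ζ => ?_)
        by_cases h : ζ ∈ B' <;> simp [h]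
    _ = ∫ ξ in A', ((degreeMap μ w ξ (n + 1) : IterFactor d (n + 1)) (.inl l)).1 B ∂μ := by
        refine integral_congr_ae (ae_restrict_of_ae ?_)
        filter_upwards [nextDegree_ae hw hw1 (measurable_iterMap (μ := μ) hw n) (.inl l) hB] with ξ hξ
        rw [hiB] at hξ
        exact hξ.symm
    _ = ∫ x in A, ((x (n + 1) : IterFactor d (n + 1)) (.inl l)).1 B ∂(degreeLaw μ w) := by
        have hm : Measurable fun x : DegreeSpace d =>
            ((x (n + 1) : IterFactor d (n + 1)) (.inl l)).1 B :=
          (UnitSigned.measurable_eval hB).comp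
            ((measurable_pi_apply _).comp (measurable_pi_apply (n + 1)))
        rw [degreeLaw, setIntegral_map hA hm.aestronglyMeasurable hq.aemeasurable]

theorem integrable_quotient_kernel (hw : Measurable w)
    {b : DegreeSpace d × DegreeSpace d → EuclideanSpace ℝ (Fin d)} (hb : Measurable b)
    (hav : average (degreeAlgebra μ w) μ w =ᵐ[μ.prod μ]
      fun p => b (degreeMap μ w p.1, degreeMap μ w p.2)) :
    Integrable b ((degreeLaw μ w).prod (degreeLaw μ w)) := by
  have hq := measurable_degreeMap (μ := μ) hw
  rw [← prodMap_degreeMap_map hw, integrable_map_measure hb.aestronglyMeasurable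
    (hq.prodMap hq).aemeasurable]
  exact integrable_condExp.congr hav

end Law

theorem generateFrom_prod_cylinders (d : ℕ) :
    (inferInstance : MeasurableSpace (DegreeSpace d × DegreeSpace d)) =
      .generateFrom (Set.image2 (· ×ˢ ·) {A | MeasurableSet A} (cylinders d)) :=
  (generateFrom_eq_prod MeasurableSpace.generateFrom_measurableSet generateFrom_cylinders.symm
    isCountablySpanning_measurableSet
    ⟨fun _ => Set.univ, fun _ => univ_mem_cylinders, Set.iUnion_const _⟩).symm

section

variable {I₁ I₂ : Type*} [MeasurableSpace I₁] [MeasurableSpace I₂]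
  {μ₁ : Measure I₁} {μ₂ : Measure I₂} [IsProbabilityMeasure μ₁] [IsProbabilityMeasure μ₂] {d : ℕ}
  {w : I₁ × I₁ → EuclideanSpace ℝ (Fin d)} {u : I₂ × I₂ → EuclideanSpace ℝ (Fin d)}

theorem quotient_kernel_ae_eq (hw : Measurable w) (hw1 : ∀ᵐ p ∂μ₁.prod μ₁, ‖w p‖ ≤ 1)
    (hu : Measurable u) (hu1 : ∀ᵐ p ∂μ₂.prod μ₂, ‖u p‖ ≤ 1)
    (h : degreeLaw μ₁ w = degreeLaw μ₂ u)
    {a b : DegreeSpace d × DegreeSpace d → EuclideanSpace ℝ (Fin d)} (ha : Measurable a)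
    (hb : Measurable b)
    (hav : average (degreeAlgebra μ₁ w) μ₁ w =ᵐ[μ₁.prod μ₁]
      fun p => a (degreeMap μ₁ w p.1, degreeMap μ₁ w p.2))
    (hbv : average (degreeAlgebra μ₂ u) μ₂ u =ᵐ[μ₂.prod μ₂]
      fun p => b (degreeMap μ₂ u p.1, degreeMap μ₂ u p.2)) :
    a =ᵐ[(degreeLaw μ₁ w).prod (degreeLaw μ₁ w)] b := by
  have hia := integrable_quotient_kernel hw ha hav
  have hib := integrable_quotient_kernel hu hb hbv
  rw [← h] at hib
  have key : ∀ l, (fun p => a p l) =ᵐ[(degreeLaw μ₁ w).prod (degreeLaw μ₁ w)] fun p => b p l := by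
    intro l
    refine ae_eq_of_setIntegral_eq_of_piSystem
      ((EuclideanSpace.proj (𝕜 := ℝ) l).integrable_comp hia)
      ((EuclideanSpace.proj (𝕜 := ℝ) l).integrable_comp hib) (generateFrom_prod_cylinders d)
      (MeasurableSpace.isPiSystem_measurableSet.prod isPiSystem_cylinders)
      ⟨Set.univ, Set.mem_ofPred_eq ▸ MeasurableSet.univ, Set.univ, univ_mem_cylinders, Set.univ_prod_univ⟩ ?_
    rintro _ ⟨A, hA, _, ⟨n, B, hB, rfl⟩, rfl⟩
    show ∫ p in A ×ˢ (truncate d n ⁻¹' B), a p l ∂_ = ∫ p in A ×ˢ (truncate d n ⁻¹' B), b p l ∂_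
    rw [setIntegral_quotient_kernel hw hw1 ha hav hA hB, h,
      setIntegral_quotient_kernel hu hu1 hb hbv hA hB]
  filter_upwards [ae_all_iff.2 key] with p hp
  exact PiLp.ext hp

/-- Both quotients are realized on the Cantor space with the same measure, and their kernels agree
almost everywhere, so the identity is an isomorphism. -/
theorem quotientsIsomorphic_of_degreeLaw_eq (hw : Measurable w)
    (hw1 : ∀ᵐ p ∂μ₁.prod μ₁, ‖w p‖ ≤ 1) (hu : Measurable u)
    (hu1 : ∀ᵐ p ∂μ₂.prod μ₂, ‖u p‖ ≤ 1) (h : degreeLaw μ₁ w = degreeLaw μ₂ u) :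
    QuotientsIsomorphic (canonicalAlgebra μ₁ w) (canonicalAlgebra μ₂ u) μ₁ μ₂ w u := by
  have he := MeasurableSpace.measurable_mapNatBool (DegreeSpace d)
  have hec := comap_mapNatBool (DegreeSpace d)
  set e := MeasurableSpace.mapNatBool (DegreeSpace d)
  have hq₁ : Measurable fun ξ => e (degreeMap μ₁ w ξ) := he.comp (measurable_degreeMap hw)
  have hq₂ : Measurable fun ξ => e (degreeMap μ₂ u ξ) := he.comp (measurable_degreeMap hu)
  obtain ⟨a, ha, hav⟩ := exists_quotient_kernel (integrable_of_norm_le_one hw hw1) hq₁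
  obtain ⟨b, hb, hbv⟩ := exists_quotient_kernel (integrable_of_norm_le_one hu hu1) hq₂
  have hm₁ : μ₁.map (fun ξ => e (degreeMap μ₁ w ξ)) = (degreeLaw μ₁ w).map e :=
    (Measure.map_map he (measurable_degreeMap hw)).symm
  have hm₂ : μ₂.map (fun ξ => e (degreeMap μ₂ u ξ)) = (degreeLaw μ₁ w).map e := by
    rw [h]
    exact (Measure.map_map he (measurable_degreeMap hu)).symm
  have hQ₁ := isQuotientMap_relCompletion (μ := μ₁) hq₁
  have hQ₂ := isQuotientMap_relCompletion (μ := μ₂) hq₂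
  rw [← degreeAlgebra_eq_comap hec, hm₁] at hQ₁
  rw [← degreeAlgebra_eq_comap hec, hm₂] at hQ₂
  rw [← degreeAlgebra_eq_comap hec] at hav hbv
  have hab := quotient_kernel_ae_eq hw hw1 hu hu1 h (ha.comp (he.prodMap he))
    (hb.comp (he.prodMap he)) hav hbv
  rw [canonicalAlgebra_eq hw hw1, canonicalAlgebra_eq hu hu1]
  refine ⟨ℕ → Bool, inferInstance, inferInstance, (degreeLaw μ₁ w).map e, a,
    ℕ → Bool, inferInstance, inferInstance, (degreeLaw μ₁ w).map e, b, ⟨ha, _, hQ₁, hav⟩,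
    ⟨hb, _, hQ₂, hbv⟩, id, id, MeasurePreserving.id _, MeasurePreserving.id _,
    ae_of_all _ fun _ => rfl, ae_of_all _ fun _ => rfl, ?_⟩
  show a =ᵐ[_] b
  rw [Measure.map_prod_map _ _ he he]
  exact (ae_map_iff (he.prodMap he).aemeasurable (measurableSet_eq_fun ha hb)).2 hab

end

/-! ### Measure preserving bijections of atomless standard Borel spaces -/

section Uniform

open Set Filter Topology

variable (ν : Measure ℝ) [IsFiniteMeasure ν]

theorem continuous_measureReal_Iic [NullSingletonClass ν] : Continuous fun t => ν.real (Iic t) := by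
  have h : (fun t => ν.real (Iic t)) = fun t => ν.real (Iic 0) + ∫ _ in (0 : ℝ)..t, (1 : ℝ) ∂ν := by
    funext t
    rw [intervalIntegral.integral_const_of_cdf]
    simp
  rw [h]
  exact continuous_const.add
    (intervalIntegral.continuous_primitive (fun a b => intervalIntegrable_const) 0)

/-- The distribution function of an atomless measure is uniformly distributed. Its sublevel set at
`c` is empty, a half-line on whose end point the value `c` is attained by continuity, or everything.
-/
theorem map_measureReal_Iic [NullSingletonClass ν] :
    ν.map (fun t => ν.real (Iic t)) = volume.restrict (Icc 0 (ν.real univ)) := by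
  have hc := continuous_measureReal_Iic ν
  have hmono : Monotone fun t => ν.real (Iic t) := fun s t h => measureReal_mono (Iic_subset_Iic.2 h)
  have hle : ∀ t, ν.real (Iic t) ≤ ν.real univ := fun t => measureReal_mono (subset_univ _)
  refine Measure.ext_of_Iic _ _ fun c => ?_
  rw [Measure.map_apply hc.measurable measurableSet_Iic, Measure.restrict_apply measurableSet_Iic]
  have hvol : volume (Iic c ∩ Icc 0 (ν.real univ)) = ENNReal.ofReal (min c (ν.real univ)) := by
    have : Iic c ∩ Icc 0 (ν.real univ) = Icc 0 (min c (ν.real univ)) := by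
      ext x
      simp only [mem_inter_iff, mem_Iic, mem_Icc, le_min_iff]
      tauto
    rw [this, Real.volume_Icc, sub_zero]
  rw [hvol]
  set S : Set ℝ := (fun t => ν.real (Iic t)) ⁻¹' Iic c with hS
  have hmem : ∀ t, t ∈ S ↔ ν.real (Iic t) ≤ c := fun t => Iff.rfl
  have hlim : Tendsto (fun t => ν.real (Iic t)) atTop (𝓝 (ν.real univ)) :=
    (ENNReal.tendsto_toReal (measure_ne_top ν _)).comp (tendsto_measure_Iic_atTop ν)
  have hlim' : Tendsto (fun t => ν.real (Iic t)) atBot (𝓝 0) := by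
    have h1 : Tendsto (fun t => ν.real (Ici t)) atBot (𝓝 (ν.real univ)) :=
      (ENNReal.tendsto_toReal (measure_ne_top ν _)).comp (tendsto_measure_Ici_atBot ν)
    have h2 : (fun t => ν.real (Iic t)) = fun t => ν.real univ - ν.real (Ici t) := by
      funext t
      rw [← measureReal_compl measurableSet_Ici, compl_Ici, measureReal_def, measureReal_def,
        measure_congr Iio_ae_eq_Iic]
    rw [h2]
    simpa using h1.const_sub (ν.real univ)
  rcases S.eq_empty_or_nonempty with he | hne
  · have hc0 : c ≤ 0 := by
      refine ge_of_tendsto hlim' (Eventually.of_forall fun t => ?_)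
      have : t ∉ S := by rw [he]; exact notMem_empty t
      exact (not_le.1 ((hmem t).not.1 this)).le
    rw [he, measure_empty, ENNReal.ofReal_of_nonpos ((min_le_left _ _).trans hc0)]
  by_cases hb : BddAbove S
  · have hcl : IsClosed S := isClosed_Iic.preimage hc
    have hsup : sSup S ∈ S := hcl.csSup_mem hne hb
    have hSI : S = Iic (sSup S) := by
      ext t
      exact ⟨fun ht => le_csSup hb ht, fun ht => (hmono ht).trans hsup⟩
    have hval : ν.real (Iic (sSup S)) = c := by
      refine le_antisymm hsup ?_
      refine ge_of_tendsto (hc.continuousWithinAt (s := Ioi (sSup S)) (x := sSup S)) ?_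
      filter_upwards [self_mem_nhdsWithin] with t ht
      have : t ∉ S := fun h => absurd (le_csSup hb h) (not_le.2 ht)
      exact (not_le.1 ((hmem t).not.1 this)).le
    have hct : c ≤ ν.real univ := hval ▸ hle _
    rw [min_eq_left hct, hSI, ← ofReal_measureReal, hval]
  · have hall : S = univ := by
      refine eq_univ_of_forall fun t => ?_
      obtain ⟨s, hs, hts⟩ := not_bddAbove_iff.1 hb t
      exact (hmono hts.le).trans hs
    have hct : ν.real univ ≤ c := le_of_tendsto hlim (Eventually.of_forall fun t => by
      have : t ∈ S := by rw [hall]; exact mem_univ t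
      exact this)
    rw [min_eq_right hct, hall, ofReal_measureReal]

/-- Injectivity fails only on intervals of constancy, each of which contains a rational point. The
fibres through rational points are null, because the image measure has no atoms. -/
theorem exists_injOn_measureReal_Iic [NullSingletonClass ν] :
    ∃ A : Set ℝ, MeasurableSet A ∧ ν Aᶜ = 0 ∧ InjOn (fun t => ν.real (Iic t)) A := by
  have hc := continuous_measureReal_Iic ν
  have hmono : Monotone fun t => ν.real (Iic t) := fun s t h => measureReal_mono (Iic_subset_Iic.2 h)
  set N : Set ℝ := ⋃ q : ℚ, (fun t => ν.real (Iic t)) ⁻¹' {ν.real (Iic (q : ℝ))} with hN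
  have hNm : MeasurableSet N :=
    MeasurableSet.iUnion fun q => hc.measurable (measurableSet_singleton _)
  refine ⟨Nᶜ, hNm.compl, ?_, ?_⟩
  · rw [compl_compl, hN]
    refine measure_iUnion_null fun q => ?_
    rw [← Measure.map_apply hc.measurable (measurableSet_singleton _), map_measureReal_Iic]
    exact measure_singleton _
  · have key : ∀ s t : ℝ, s ∈ Nᶜ → s < t → ν.real (Iic s) ≠ ν.real (Iic t) := by
      intro s t hs hst h
      obtain ⟨q, hsq, hqt⟩ := exists_rat_btwn hst
      exact hs (mem_iUnion.2 ⟨q, le_antisymm (hmono hsq.le) ((hmono hqt.le).trans h.ge)⟩)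
    intro s hs t ht hst
    rcases lt_trichotomy s t with h | h | h
    · exact absurd hst (key s t hs h)
    · exact h
    · exact absurd hst.symm (key t s ht h)

end Uniform

/-! ### Uniformizing maps on atomless standard Borel spaces. -/

section Transport

open Set

variable {X Y Z L : Type*} [MeasurableSpace X] [StandardBorelSpace X] [MeasurableSpace Y]
  [StandardBorelSpace Y] [MeasurableSpace Z] [StandardBorelSpace Z]

theorem exists_uniformizing_map (μ : Measure X) [IsFiniteMeasure μ] [NullSingletonClass μ] :
    ∃ G : X → ℝ, Measurable G ∧ μ.map G = volume.restrict (Icc 0 (μ.real univ)) ∧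
      ∃ A, MeasurableSet A ∧ μ Aᶜ = 0 ∧ InjOn G A := by
  have he := measurableEmbedding_embeddingReal X
  set e := embeddingReal X
  have : NullSingletonClass (μ.map e) := ⟨fun x => by
    rw [Measure.map_apply he.measurable (measurableSet_singleton _)]
    exact (subsingleton_singleton.preimage he.injective).measure_zero μ⟩
  obtain ⟨A, hA, hA0, hinj⟩ := exists_injOn_measureReal_Iic (μ.map e)
  have hm := (continuous_measureReal_Iic (μ.map e)).measurable
  refine ⟨fun x => (μ.map e).real (Iic (e x)), hm.comp he.measurable, ?_, e ⁻¹' A,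
    he.measurable hA, ?_, fun x hx y hy h => he.injective (hinj hx hy h)⟩
  · have h := map_measureReal_Iic (μ.map e)
    rw [Measure.map_map hm he.measurable] at h
    rw [map_measureReal_apply he.measurable MeasurableSet.univ, preimage_univ] at h
    exact h
  · rw [← preimage_compl, ← Measure.map_apply he.measurable hA.compl, hA0]

/-- Each fibre of `r` is uniformized separately. The resulting image measure depends on the law of
`r` only, so spaces with equally distributed labels acquire the same model. -/
theorem exists_labelled_uniformizing_map [MeasurableSpace L] [MeasurableSingletonClass L]
    [Countable L] (μ : Measure X) [IsFiniteMeasure μ] [NullSingletonClass μ] {r : X → L} (hr : Measurable r) :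
    ∃ G : X → L × ℝ, Measurable G ∧ (∀ x, (G x).1 = r x) ∧
      μ.map G = Measure.sum (fun k => (volume.restrict (Icc 0 ((μ.map r).real {k}))).map (Prod.mk k)) ∧
      ∃ A, MeasurableSet A ∧ μ Aᶜ = 0 ∧ InjOn G A := by
  have hfib : ∀ k, MeasurableSet (r ⁻¹' {k}) := fun k => hr (measurableSet_singleton k)
  choose G hG hmap A hA hA0 hinj using fun k => exists_uniformizing_map (μ.restrict (r ⁻¹' {k}))
  have hmG : Measurable fun x => G (r x) x := by
    have : Measurable fun p : L × X => G p.1 p.2 := measurable_from_prod_countable_right hG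
    exact this.comp (hr.prodMk measurable_id)
  have hmA : MeasurableSet {x | x ∈ A (r x)} := by
    have : {x | x ∈ A (r x)} = ⋃ k, r ⁻¹' {k} ∩ A k := by
      ext x
      simp
    rw [this]
    exact MeasurableSet.iUnion fun k => (hfib k).inter (hA k)
  refine ⟨fun x => (r x, G (r x) x), hr.prodMk hmG, fun _ => rfl, ?_, {x | x ∈ A (r x)}, hmA, ?_, ?_⟩
  · have hsum : μ = Measure.sum fun k => μ.restrict (r ⁻¹' {k}) := by
      rw [← Measure.restrict_iUnion (fun i j hij => ?_) hfib]
      · rw [← preimage_iUnion, iUnion_of_singleton, preimage_univ, Measure.restrict_univ]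
      · exact Disjoint.preimage _ (disjoint_singleton.2 hij)
    conv_lhs => rw [hsum]
    rw [Measure.map_sum (hr.prodMk hmG).aemeasurable]
    congr 1
    funext k
    rw [Measure.map_congr (g := Prod.mk k ∘ G k)]
    · rw [← Measure.map_map measurable_prodMk_left (hG k), hmap,
        measureReal_restrict_apply MeasurableSet.univ, univ_inter,
        map_measureReal_apply hr (measurableSet_singleton k)]
    · filter_upwards [ae_restrict_mem (hfib k)] with x hx
      have : r x = k := hx
      simp [this]
  · have : {x | x ∈ A (r x)}ᶜ = ⋃ k, (A k)ᶜ ∩ r ⁻¹' {k} := by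
      ext x
      simp
    rw [this]
    refine measure_iUnion_null fun k => ?_
    rw [← Measure.restrict_apply (hA k).compl]
    exact hA0 k
  · intro x hx y hy h
    obtain ⟨h1, h2⟩ := Prod.mk.inj h
    have hy' : y ∈ A (r x) := by rw [h1]; exact hy
    refine hinj (r x) hx hy' ?_
    rw [h2, h1]

/-- In a Borel copy of the plane, the vertical lines are uncountably many disjoint uncountable sets,
and only countably many can have positive measure. Such a null set leaves room to extend a bijection
of conull sets to the whole space. -/
theorem exists_uncountable_null (μ : Measure X) [IsFiniteMeasure μ] (hX : ¬Countable X) :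
    ∃ N : Set X, MeasurableSet N ∧ μ N = 0 ∧ ¬N.Countable := by
  have hR : ¬Countable ℝ := by
    rw [← not_uncountable_iff, not_not]; infer_instance
  have hRR : ¬Countable (ℝ × ℝ) := fun h =>
    hR (Function.Injective.countable (f := fun x : ℝ => (x, (0 : ℝ))) fun x y h => (Prod.mk.inj h).1)
  let e : X ≃ᵐ ℝ × ℝ := PolishSpace.measurableEquivOfNotCountable hX hRR
  have hm : ∀ x : ℝ, MeasurableSet (e ⁻¹' (Prod.fst ⁻¹' {x})) := fun x =>
    e.measurable (measurable_fst (measurableSet_singleton x))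
  have hd : Pairwise (Function.onFun Disjoint fun x : ℝ => e ⁻¹' (Prod.fst ⁻¹' {x})) :=
    fun x y hxy => Disjoint.preimage _ (Disjoint.preimage _ (disjoint_singleton.2 hxy))
  have hc := Measure.countable_meas_pos_of_disjoint_iUnion (μ := μ) hm hd
  obtain ⟨x, hx⟩ : ∃ x : ℝ, ¬0 < μ (e ⁻¹' (Prod.fst ⁻¹' {x})) := by
    by_contra! h
    refine hR (countable_univ_iff.1 (hc.mono fun x _ => h x))
  refine ⟨_, hm x, by simpa using hx, fun hcount => hR ?_⟩
  have h2 : (range fun y : ℝ => e.symm (x, y)).Countable := hcount.mono (by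
    rintro _ ⟨y, rfl⟩
    simp)
  have hinj : Function.Injective fun y : ℝ => e.symm (x, y) := fun y z h =>
    (Prod.mk.inj (e.symm.injective h)).2
  have := h2.to_subtype
  exact (rangeFactorization_injective.2 hinj).countable

end Transport

/-! ### Measure preserving bijections that respect labels. -/

section Transport

open Set

variable {X Y Z L : Type*} [MeasurableSpace X] [StandardBorelSpace X] [MeasurableSpace Y]
  [StandardBorelSpace Y] [MeasurableSpace Z] [StandardBorelSpace Z]

theorem exists_measurableEquiv_of_range_eq {f : X → Z} {g : Y → Z} (hf : MeasurableEmbedding f)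
    (hg : MeasurableEmbedding g) (h : range f = range g) : ∃ ψ : X ≃ᵐ Y, ∀ x, g (ψ x) = f x := by
  have hcast : ∀ s t : Set Z, s = t → ∃ e : s ≃ᵐ t, ∀ x, (e x : Z) = x := by
    rintro s _ rfl
    exact ⟨MeasurableEquiv.refl _, fun _ => rfl⟩
  obtain ⟨e, he⟩ := hcast _ _ h
  refine ⟨hf.equivRange.trans (e.trans hg.equivRange.symm), fun x => ?_⟩
  have h1 : ∀ y, (hg.equivRange y : Z) = g y := fun y => by rw [hg.equivRange_apply]
  rw [← h1]
  simp [he, hf.equivRange_apply]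

/-- The complements are uncountable standard Borel spaces, hence Borel isomorphic. -/
theorem exists_measurableEquiv_extending {A : Set X} {B : Set Y} (hA : MeasurableSet A)
    (hB : MeasurableSet B) (hAc : ¬(Aᶜ).Countable) (hBc : ¬(Bᶜ).Countable) (ψ : A ≃ᵐ B) :
    ∃ Φ : X ≃ᵐ Y, ∀ x : A, Φ x = ψ x := by
  classical
  have := hA.compl.standardBorel
  have := hB.compl.standardBorel
  let χ : (Aᶜ : Set X) ≃ᵐ (Bᶜ : Set Y) := PolishSpace.measurableEquivOfNotCountable
    (fun h => hAc (countable_coe_iff.1 h)) (fun h => hBc (countable_coe_iff.1 h))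
  refine ⟨(MeasurableEquiv.sumCompl hA).symm.trans
    ((MeasurableEquiv.sumCongr ψ χ).trans (MeasurableEquiv.sumCompl hB)), fun x => ?_⟩
  have h : (MeasurableEquiv.sumCompl hA).symm x = Sum.inl x :=
    Equiv.Set.sumCompl_symm_apply_of_mem x.2
  simp only [MeasurableEquiv.trans_apply, h]
  rfl

/-- By the Lusin–Souslin theorem, injective measurable images of measurable sets are measurable, so
the measure of a set is recovered from the image measure. -/
theorem measure_eq_of_map_eq_of_injOn {m₁ m₂ : Measure Y} {G : Y → Z} (hG : Measurable G)
    (h : m₁.map G = m₂.map G) {A : Set Y} (hA : MeasurableSet A) (h₁ : m₁ Aᶜ = 0) (h₂ : m₂ Aᶜ = 0)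
    (hinj : InjOn G A) : m₁ = m₂ := by
  have key : ∀ m : Measure Y, m Aᶜ = 0 → ∀ E, MeasurableSet E → m E = m.map G (G '' (E ∩ A)) := by
    intro m hm E hE
    have hi : MeasurableSet (G '' (E ∩ A)) :=
      (hE.inter hA).image_of_measurable_injOn hG (hinj.mono inter_subset_right)
    rw [Measure.map_apply hG hi]
    refine measure_congr ?_
    have hae : ∀ᵐ x ∂m, x ∈ A := by
      rw [ae_iff]
      exact hm
    filter_upwards [hae] with x hx
    refine propext ⟨fun hxE => ⟨x, ⟨hxE, hx⟩, rfl⟩, ?_⟩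
    rintro ⟨y, ⟨hyE, hyA⟩, hxy⟩
    exact hinj hyA hx hxy ▸ hyE
  refine Measure.ext fun E hE => ?_
  rw [key m₁ h₁ E hE, key m₂ h₂ E hE, h]

theorem not_countable_of_atomless (μ : Measure X) [IsProbabilityMeasure μ] [NullSingletonClass μ] :
    ¬Countable X := fun h => by
  have h0 := (countable_univ (α := X)).measure_zero μ
  rw [measure_univ] at h0
  exact one_ne_zero h0

theorem exists_injOn_uncountable_compl {μ : Measure X} [IsProbabilityMeasure μ]
    [NullSingletonClass μ] {G : X → Z}
    (h : ∃ A, MeasurableSet A ∧ μ Aᶜ = 0 ∧ InjOn G A) :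
    ∃ A, MeasurableSet A ∧ μ Aᶜ = 0 ∧ InjOn G A ∧ ¬(Aᶜ).Countable := by
  obtain ⟨A, hA, hA0, hinj⟩ := h
  obtain ⟨N, hN, hN0, hNc⟩ := exists_uncountable_null μ (not_countable_of_atomless μ)
  refine ⟨A \ N, hA.diff hN, ?_, hinj.mono sdiff_subset, fun hc => hNc (hc.mono ?_)⟩
  · rw [sdiff_eq, compl_inter, compl_compl]
    exact measure_union_null hA0 hN0
  · exact fun x hx hx' => hx'.2 hx

/-- A point `x` is matched with the `y` for which `G₂ y = G₁ x`. Equality of the laws makes the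
matched parts conull, and the unmatched parts are null and uncountable, so any Borel isomorphism
between them completes the map. -/
theorem exists_measurePreserving_equiv {μ : Measure X} {ν : Measure Y} [IsProbabilityMeasure μ]
    [IsProbabilityMeasure ν] [NullSingletonClass μ] [NullSingletonClass ν] {G₁ : X → Z} {G₂ : Y → Z}
    (hG₁ : Measurable G₁) (hG₂ : Measurable G₂) (hmap : μ.map G₁ = ν.map G₂)
    (h₁ : ∃ A, MeasurableSet A ∧ μ Aᶜ = 0 ∧ InjOn G₁ A)
    (h₂ : ∃ A, MeasurableSet A ∧ ν Aᶜ = 0 ∧ InjOn G₂ A) :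
    ∃ Φ : X ≃ᵐ Y, MeasurePreserving Φ μ ν ∧ ∀ᵐ x ∂μ, G₂ (Φ x) = G₁ x := by
  obtain ⟨A, hA, hA0, hAi, hAc⟩ := exists_injOn_uncountable_compl h₁
  obtain ⟨B, hB, hB0, hBi, hBc⟩ := exists_injOn_uncountable_compl h₂
  have hiA : MeasurableSet (G₁ '' A) := hA.image_of_measurable_injOn hG₁ hAi
  have hiB : MeasurableSet (G₂ '' B) := hB.image_of_measurable_injOn hG₂ hBi
  have hκA : μ.map G₁ (G₁ '' A)ᶜ = 0 := by
    rw [Measure.map_apply hG₁ hiA.compl]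
    exact measure_mono_null (fun x hx hxA => hx ⟨x, hxA, rfl⟩) hA0
  have hκB : ν.map G₂ (G₂ '' B)ᶜ = 0 := by
    rw [Measure.map_apply hG₂ hiB.compl]
    exact measure_mono_null (fun x hx hxB => hx ⟨x, hxB, rfl⟩) hB0
  have hA' : MeasurableSet (A ∩ G₁ ⁻¹' (G₂ '' B)) := hA.inter (hG₁ hiB)
  have hB' : MeasurableSet (B ∩ G₂ ⁻¹' (G₁ '' A)) := hB.inter (hG₂ hiA)
  have hA'0 : μ (A ∩ G₁ ⁻¹' (G₂ '' B))ᶜ = 0 := by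
    rw [compl_inter, ← preimage_compl]
    refine measure_union_null hA0 ?_
    rw [← Measure.map_apply hG₁ hiB.compl, hmap, hκB]
  have hB'0 : ν (B ∩ G₂ ⁻¹' (G₁ '' A))ᶜ = 0 := by
    rw [compl_inter, ← preimage_compl]
    refine measure_union_null hB0 ?_
    rw [← Measure.map_apply hG₂ hiA.compl, ← hmap, hκA]
  have := hA'.standardBorel
  have := hB'.standardBorel
  obtain ⟨ψ, hψ⟩ := exists_measurableEquiv_of_range_eq
    (f := fun x : ↥(A ∩ G₁ ⁻¹' (G₂ '' B)) => G₁ x) (g := fun y : ↥(B ∩ G₂ ⁻¹' (G₁ '' A)) => G₂ y)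
    ((hG₁.comp measurable_subtype_coe).measurableEmbedding fun x y h =>
      Subtype.ext (hAi x.2.1 y.2.1 h))
    ((hG₂.comp measurable_subtype_coe).measurableEmbedding fun x y h =>
      Subtype.ext (hBi x.2.1 y.2.1 h)) (by
      ext z
      constructor
      · rintro ⟨⟨x, hx, y, hy, hyx⟩, rfl⟩
        exact ⟨⟨y, hy, x, hx, hyx.symm⟩, hyx⟩
      · rintro ⟨⟨x, hx, y, hy, hyx⟩, rfl⟩
        exact ⟨⟨y, hy, x, hx, hyx.symm⟩, hyx⟩)
  obtain ⟨Φ, hΦ⟩ := exists_measurableEquiv_extending hA' hB'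
    (fun h => hAc (h.mono (compl_subset_compl.2 inter_subset_left)))
    (fun h => hBc (h.mono (compl_subset_compl.2 inter_subset_left))) ψ
  have hae : ∀ᵐ x ∂μ, G₂ (Φ x) = G₁ x := by
    filter_upwards [show ∀ᵐ x ∂μ, x ∈ A ∩ G₁ ⁻¹' (G₂ '' B) by rw [ae_iff]; exact hA'0] with x hx
    rw [hΦ ⟨x, hx⟩]
    exact hψ ⟨x, hx⟩
  refine ⟨Φ, ⟨Φ.measurable, measure_eq_of_map_eq_of_injOn hG₂ ?_ hB' ?_ hB'0
    (hBi.mono inter_subset_left)⟩, hae⟩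
  · rw [Measure.map_map hG₂ Φ.measurable, ← hmap]
    exact Measure.map_congr hae
  · rw [Measure.map_apply Φ.measurable hB'.compl]
    refine measure_mono_null ?_ hA'0
    intro x hx hxA
    refine hx ?_
    rw [hΦ ⟨x, hxA⟩]
    exact (ψ ⟨x, hxA⟩).2

theorem exists_measurePreserving_equiv_of_labels [MeasurableSpace L] [MeasurableSingletonClass L]
    [Countable L] [StandardBorelSpace L] {μ : Measure X} {ν : Measure Y} [IsProbabilityMeasure μ]
    [IsProbabilityMeasure ν] [NullSingletonClass μ] [NullSingletonClass ν] {r : X → L} {s : Y → L}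
    (hr : Measurable r) (hs : Measurable s) (h : μ.map r = ν.map s) :
    ∃ Φ : X ≃ᵐ Y, MeasurePreserving Φ μ ν ∧ ∀ᵐ x ∂μ, s (Φ x) = r x := by
  obtain ⟨G₁, hG₁, hl₁, hm₁, hi₁⟩ := exists_labelled_uniformizing_map μ hr
  obtain ⟨G₂, hG₂, hl₂, hm₂, hi₂⟩ := exists_labelled_uniformizing_map ν hs
  obtain ⟨Φ, hΦ, hae⟩ := exists_measurePreserving_equiv hG₁ hG₂ (by rw [hm₁, hm₂, h]) hi₁ hi₂
  refine ⟨Φ, hΦ, hae.mono fun x hx => ?_⟩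
  rw [← hl₁, ← hl₂, hx]

end Transport

/-! ### Matching factor maps up to a small error. -/

section Approximation

open Set Filter Topology

variable {X Y : Type*} [MeasurableSpace X] [StandardBorelSpace X] [MeasurableSpace Y]
  [StandardBorelSpace Y] {μ : Measure X} {ν : Measure Y} [IsProbabilityMeasure μ]
  [IsProbabilityMeasure ν] [NullSingletonClass μ] [NullSingletonClass ν]
  {E : Type*} [NormedAddCommGroup E] [NormedSpace ℝ E]

/-- The bijection of index `n` matches the first `n` bits exactly, as labels in a finite set. An
exact match of `p` and `q` need not exist, since their fibres can differ in structure. -/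
theorem exists_equiv_tendsto {p : X → ℕ → Bool} {q : Y → ℕ → Bool} (hp : Measurable p)
    (hq : Measurable q) (h : μ.map p = ν.map q) :
    ∃ Φ : ℕ → X ≃ᵐ Y, (∀ n, MeasurePreserving (Φ n) μ ν) ∧
      ∀ᵐ x ∂μ, Tendsto (fun n => q (Φ n x)) atTop (𝓝 (p x)) := by
  have hcut : ∀ n, Measurable fun (x : ℕ → Bool) (i : Fin n) => x i := fun n =>
    measurable_pi_lambda _ fun i => measurable_pi_apply _
  choose Φ hΦ hae using fun n => exists_measurePreserving_equiv_of_labels (L := Fin n → Bool)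
    (μ := μ) (ν := ν) ((hcut n).comp hp) ((hcut n).comp hq)
    (by rw [← Measure.map_map (hcut n) hp, ← Measure.map_map (hcut n) hq, h])
  refine ⟨Φ, hΦ, ?_⟩
  filter_upwards [ae_all_iff.2 hae] with x hx
  refine tendsto_pi_nhds.2 fun i => tendsto_const_nhds.congr' ?_
  filter_upwards [eventually_gt_atTop i] with n hn
  exact (congrFun (hx n) ⟨i, hn⟩).symm

/-- Replace `b` by a continuous function `g` close to it in `L¹`. For `g`, convergence of the bits
and dominated convergence suffice. The two errors of replacement are equally small, because `p` and
`q ∘ Φ n` have the same law. -/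
theorem exists_equiv_lintegral_le_cantor {p : X → ℕ → Bool} {q : Y → ℕ → Bool} (hp : Measurable p)
    (hq : Measurable q) (h : μ.map p = ν.map q) {b : (ℕ → Bool) × (ℕ → Bool) → E}
    (hb : Integrable b ((μ.map p).prod (μ.map p))) {ε : ENNReal} (hε : ε ≠ 0) :
    ∃ Φ : X ≃ᵐ Y, MeasurePreserving Φ μ ν ∧
      ∫⁻ x, ‖b (p x.1, p x.2) - b (q (Φ x.1), q (Φ x.2))‖ₑ ∂μ.prod μ ≤ ε := by
  have hε3 : ε / 3 ≠ 0 := by simpa [ENNReal.div_eq_zero_iff] using hε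
  obtain ⟨Φ, hΦ, hlim⟩ := exists_equiv_tendsto hp hq h
  obtain ⟨g, hg, -⟩ := hb.exists_boundedContinuous_lintegral_sub_le hε3
  have hpp : MeasurePreserving (Prod.map p p) (μ.prod μ) ((μ.map p).prod (μ.map p)) :=
    (hp.measurePreserving μ).prod (hp.measurePreserving μ)
  have hqΦ : ∀ n, MeasurePreserving (fun x => q (Φ n x)) μ (μ.map p) := fun n => by
    rw [h]
    exact (hq.measurePreserving ν).comp (hΦ n)
  have hlim2 : ∀ᵐ x ∂μ.prod μ, Tendsto (fun n => g (q (Φ n x.1), q (Φ n x.2))) atTop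
      (𝓝 (g (p x.1, p x.2))) := by
    filter_upwards [Measure.quasiMeasurePreserving_fst.ae hlim,
      Measure.quasiMeasurePreserving_snd.ae hlim] with x h1 h2
    exact (g.continuous.tendsto _).comp (h1.prodMk_nhds h2)
  have hgm : ∀ {f f' : X → ℕ → Bool}, Measurable f → Measurable f' →
      AEStronglyMeasurable (fun x : X × X => g (f x.1, f' x.2)) (μ.prod μ) := fun hf hf' =>
    (g.continuous.stronglyMeasurable.comp_measurable
      ((hf.comp measurable_fst).prodMk (hf'.comp measurable_snd))).aestronglyMeasurable
  have hdct : Tendsto (fun n => ∫⁻ x, ‖g (p x.1, p x.2) - g (q (Φ n x.1), q (Φ n x.2))‖ₑ ∂μ.prod μ)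
      atTop (𝓝 (∫⁻ _, 0 ∂μ.prod μ)) := by
    refine tendsto_lintegral_of_dominated_convergence' (fun _ => ENNReal.ofReal (2 * ‖g‖)) (fun n =>
      ((hgm hp hp).sub (hgm (hq.comp (Φ n).measurable) (hq.comp (Φ n).measurable))).enorm)
      (fun n => ae_of_all _ fun x => ?_) ?_ ?_
    · show ‖_‖ₑ ≤ _
      rw [← ofReal_norm]
      refine ENNReal.ofReal_le_ofReal ((norm_sub_le _ _).trans ?_)
      rw [two_mul]
      exact add_le_add (g.norm_coe_le_norm _) (g.norm_coe_le_norm _)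
    · rw [lintegral_const, measure_univ, mul_one]
      exact ENNReal.ofReal_ne_top
    · filter_upwards [hlim2] with x hx
      have := (hx.const_sub (g (p x.1, p x.2))).enorm
      simpa using this
  rw [lintegral_zero] at hdct
  obtain ⟨n, hn⟩ := ((hdct.eventually_lt_const (pos_iff_ne_zero.2 hε3)).mono fun _ => le_of_lt).exists
  refine ⟨Φ n, hΦ n, ?_⟩
  have hqq : MeasurePreserving (Prod.map (fun x => q (Φ n x)) fun x => q (Φ n x)) (μ.prod μ)
      ((μ.map p).prod (μ.map p)) := (hqΦ n).prod (hqΦ n)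
  have hF : AEMeasurable (fun y => ‖b y - g y‖ₑ) ((μ.map p).prod (μ.map p)) :=
    (hb.aestronglyMeasurable.sub g.continuous.aestronglyMeasurable).enorm
  have e1 : ∫⁻ x, ‖b (p x.1, p x.2) - g (p x.1, p x.2)‖ₑ ∂μ.prod μ ≤ ε / 3 := by
    refine le_of_eq_of_le ?_ hg
    rw [← hpp.map_eq]
    rw [← hpp.map_eq] at hF
    rw [lintegral_map' hF hpp.measurable.aemeasurable]
    rfl
  have e2 : ∫⁻ x, ‖b (q (Φ n x.1), q (Φ n x.2)) - g (q (Φ n x.1), q (Φ n x.2))‖ₑ ∂μ.prod μ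
      ≤ ε / 3 := by
    refine le_of_eq_of_le ?_ hg
    rw [← hqq.map_eq]
    rw [← hqq.map_eq] at hF
    rw [lintegral_map' hF hqq.measurable.aemeasurable]
    rfl
  have m1 : AEMeasurable (fun x : X × X => ‖b (p x.1, p x.2) - g (p x.1, p x.2)‖ₑ) (μ.prod μ) :=
    hF.comp_quasiMeasurePreserving hpp.quasiMeasurePreserving
  have m2 : AEMeasurable (fun x : X × X =>
      ‖g (p x.1, p x.2) - g (q (Φ n x.1), q (Φ n x.2))‖ₑ) (μ.prod μ) :=
    ((hgm hp hp).sub (hgm (hq.comp (Φ n).measurable) (hq.comp (Φ n).measurable))).enorm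
  calc ∫⁻ x, ‖b (p x.1, p x.2) - b (q (Φ n x.1), q (Φ n x.2))‖ₑ ∂μ.prod μ
      ≤ ∫⁻ x, (‖b (p x.1, p x.2) - g (p x.1, p x.2)‖ₑ +
          ‖g (p x.1, p x.2) - g (q (Φ n x.1), q (Φ n x.2))‖ₑ) +
          ‖b (q (Φ n x.1), q (Φ n x.2)) - g (q (Φ n x.1), q (Φ n x.2))‖ₑ ∂μ.prod μ := by
        refine lintegral_mono fun x => ?_
        have : b (p x.1, p x.2) - b (q (Φ n x.1), q (Φ n x.2)) =
            (b (p x.1, p x.2) - g (p x.1, p x.2)) +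
            (g (p x.1, p x.2) - g (q (Φ n x.1), q (Φ n x.2))) -
            (b (q (Φ n x.1), q (Φ n x.2)) - g (q (Φ n x.1), q (Φ n x.2))) := by abel
        rw [this]
        exact enorm_sub_le.trans (add_le_add_left (enorm_add_le _ _) _)
    _ ≤ ε / 3 + ε / 3 + ε / 3 := by
        rw [lintegral_add_left' (f := fun x : X × X => ‖b (p x.1, p x.2) - g (p x.1, p x.2)‖ₑ +
          ‖g (p x.1, p x.2) - g (q (Φ n x.1), q (Φ n x.2))‖ₑ) (m1.add m2), lintegral_add_left' m1]
        exact add_le_add (add_le_add e1 hn) e2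
    _ = ε := ENNReal.add_thirds ε

theorem exists_equiv_lintegral_le {K : Type*} [MeasurableSpace K] [StandardBorelSpace K]
    {p : X → K} {q : Y → K} (hp : Measurable p)
    (hq : Measurable q) (h : μ.map p = ν.map q) [MeasurableSpace E] [BorelSpace E] [CompleteSpace E]
    [SecondCountableTopology E] {b : K × K → E} (hbm : Measurable b)
    (hb : Integrable b ((μ.map p).prod (μ.map p))) {ε : ENNReal} (hε : ε ≠ 0) :
    ∃ Φ : X ≃ᵐ Y, MeasurePreserving Φ μ ν ∧
      ∫⁻ x, ‖b (p x.1, p x.2) - b (q (Φ x.1), q (Φ x.2))‖ₑ ∂μ.prod μ ≤ ε := by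
  have he : MeasurableEmbedding (MeasurableSpace.mapNatBool K) :=
    (MeasurableSpace.measurable_mapNatBool K).measurableEmbedding
      (MeasurableSpace.injective_mapNatBool K)
  set e := MeasurableSpace.mapNatBool K
  have hee : MeasurableEmbedding (Prod.map e e) := he.prodMap he
  obtain ⟨b', hb', hbb⟩ := hee.exists_measurable_extend hbm fun _ => ⟨0⟩
  have hbx : ∀ x y, b' (e x, e y) = b (x, y) := fun x y => congrFun hbb (x, y)
  have hint : Integrable b' ((μ.map fun x => e (p x)).prod (μ.map fun x => e (p x))) := by
    have : (μ.map fun x => e (p x)) = (μ.map p).map e := (Measure.map_map he.measurable hp).symm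
    rw [this, Measure.map_prod_map _ _ he.measurable he.measurable, hee.integrable_map_iff, hbb]
    exact hb
  obtain ⟨Φ, hΦ, hle⟩ := exists_equiv_lintegral_le_cantor (he.measurable.comp hp)
    (he.measurable.comp hq)
    (by rw [← Measure.map_map he.measurable hp, ← Measure.map_map he.measurable hq, h]) hint hε
  refine ⟨Φ, hΦ, ?_⟩
  simpa only [Function.comp_apply, hbx] using hle

end Approximation

/-! ### Isomorphic quotients have cut distance zero -/

section CutDist

variable {X Y K : Type*} [MeasurableSpace X] [MeasurableSpace Y] [MeasurableSpace K] {d : ℕ}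

theorem cutNorm_le_lintegral (μ : Measure X) (k : X × X → EuclideanSpace ℝ (Fin d)) :
    cutNorm μ k ≤ ∫⁻ p, ‖k p‖ₑ ∂μ.prod μ := by
  refine iSup_le fun e => iSup_le fun he => iSup_le fun S => iSup_le fun _ => iSup_le fun T =>
    iSup_le fun _ => ?_
  calc ENNReal.ofReal (inner ℝ e (∫ p in S ×ˢ T, k p ∂μ.prod μ))
      ≤ ENNReal.ofReal ‖∫ p in S ×ˢ T, k p ∂μ.prod μ‖ := by
        refine ENNReal.ofReal_le_ofReal ((real_inner_le_norm _ _).trans ?_)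
        exact mul_le_of_le_one_left (norm_nonneg _) he
    _ = ‖∫ p in S ×ˢ T, k p ∂μ.prod μ‖ₑ := ofReal_norm _
    _ ≤ ∫⁻ p in S ×ˢ T, ‖k p‖ₑ ∂μ.prod μ := enorm_integral_le_lintegral_enorm _
    _ ≤ ∫⁻ p, ‖k p‖ₑ ∂μ.prod μ := setLIntegral_le_lintegral _ _

theorem bijCutDist_eq_zero [StandardBorelSpace X] [StandardBorelSpace Y] [StandardBorelSpace K]
    {μ : Measure X} {ν : Measure Y} {σ : Measure K} [IsProbabilityMeasure μ]
    [IsProbabilityMeasure ν] [NullSingletonClass μ] [NullSingletonClass ν] {p : X → K} {q : Y → K}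
    (hp : MeasurePreserving p μ σ) (hq : MeasurePreserving q ν σ)
    {b : K × K → EuclideanSpace ℝ (Fin d)} (hb : Measurable b) (hbi : Integrable b (σ.prod σ))
    {w : X × X → EuclideanSpace ℝ (Fin d)} {u : Y × Y → EuclideanSpace ℝ (Fin d)}
    (hw : w =ᵐ[μ.prod μ] fun x => b (p x.1, p x.2))
    (hu : u =ᵐ[ν.prod ν] fun y => b (q y.1, q y.2)) : bijCutDist μ ν w u = 0 := by
  refine le_antisymm (le_of_forall_pos_le_add fun ε hε => ?_) zero_le
  rw [← hp.map_eq] at hbi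
  obtain ⟨Φ, hΦ, hle⟩ := exists_equiv_lintegral_le hp.measurable hq.measurable
    (hp.map_eq.trans hq.map_eq.symm) hb hbi hε.ne'
  rw [zero_add]
  refine (iInf₂_le Φ hΦ).trans ((cutNorm_le_lintegral μ _).trans (le_of_eq_of_le ?_ hle))
  refine lintegral_congr_ae ?_
  filter_upwards [hw, (hΦ.prod hΦ).quasiMeasurePreserving.ae hu] with x h1 h2
  rw [h1]
  exact congrArg (fun v => ‖b (p x.1, p x.2) - v‖ₑ) h2

/-- The isomorphism makes both averages pullbacks of the single kernel `b`. If there are atoms, the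
projection that forgets the second coordinate is composed with the factor maps, and the same
argument applies. -/
theorem cutDist_average_eq_zero {I₁ I₂ : Type*} {C : MeasurableSpace I₁} {D : MeasurableSpace I₂} [mX : MeasurableSpace I₁]
    [mY : MeasurableSpace I₂] [StandardBorelSpace I₁] [StandardBorelSpace I₂] {μ : Measure I₁}
    {ν : Measure I₂} [IsProbabilityMeasure μ] [IsProbabilityMeasure ν]
    {w : I₁ × I₁ → EuclideanSpace ℝ (Fin d)} {u : I₂ × I₂ → EuclideanSpace ℝ (Fin d)}
    (h : QuotientsIsomorphic C D μ ν w u) :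
    cutDist μ ν (average C μ w) (average D ν u) = 0 := by
  obtain ⟨J, _, _, ρ, a, K, _, _, σ, b, ⟨ha, q₁, hq₁, hav⟩, ⟨hb, q₂, hq₂, hbv⟩, φ, ψ, hφ, -, -, -,
    hab⟩ := h
  have hq₁' := hq₁.measurePreserving
  have hq₂' := hq₂.measurePreserving
  have : IsProbabilityMeasure ρ := hq₁'.map_eq ▸ Measure.isProbabilityMeasure_map hq₁'.aemeasurable
  have : IsProbabilityMeasure σ := hq₂'.map_eq ▸ Measure.isProbabilityMeasure_map hq₂'.aemeasurable
  have hp := hφ.comp hq₁'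
  have hw : average C μ w =ᵐ[μ.prod μ] fun x => b (φ (q₁ x.1), φ (q₁ x.2)) :=
    hav.trans ((hq₁'.prod hq₁').quasiMeasurePreserving.ae_eq_comp hab)
  have hbi : Integrable b (σ.prod σ) := by
    rw [← (hq₂'.prod hq₂').map_eq, integrable_map_measure hb.aestronglyMeasurable
      (hq₂'.prod hq₂').aemeasurable]
    exact integrable_condExp.congr hbv
  unfold cutDist
  split_ifs with hat
  · have : NullSingletonClass μ := ⟨hat.1⟩
    have : NullSingletonClass ν := ⟨hat.2⟩
    exact bijCutDist_eq_zero hp hq₂' hb hbi hw hbv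
  · have f₁ : MeasurePreserving Prod.fst (μ.prod (volume : Measure unitInterval)) μ :=
      measurePreserving_fst
    have f₂ : MeasurePreserving Prod.fst (ν.prod (volume : Measure unitInterval)) ν :=
      measurePreserving_fst
    exact bijCutDist_eq_zero (hp.comp f₁) (hq₂'.comp f₂) hb hbi
      ((f₁.prod f₁).quasiMeasurePreserving.ae_eq_comp hw)
      ((f₂.prod f₂).quasiMeasurePreserving.ae_eq_comp hbv)

end CutDist

/-! ### Tree functions of averaged kernels -/

/-- Everything is measurable for `C`, so the integral may be taken for the measure restricted to
`C`, where the usual measurability of parametric integrals applies. -/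
theorem stronglyMeasurable_adjOp_of_le {I : Type*} {C mI : MeasurableSpace I} (hC : C ≤ mI)
    {μ : Measure I} [IsProbabilityMeasure μ] {k : I × I → ℝ} (hk : Measurable[C.prod C] k) {f : I → ℝ}
    (hf : StronglyMeasurable[C] f) : StronglyMeasurable[C] (adjOp μ k f) := by
  have : IsProbabilityMeasure (μ.trim hC) := ⟨by rw [trim_measurableSet_eq hC MeasurableSet.univ, measure_univ]⟩
  have h := @stronglyMeasurable_adjOp I C (μ.trim hC) _ k hk f hf.aestronglyMeasurable
  have heq : adjOp μ k f = @adjOp I C (μ.trim hC) k f := by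
    funext ξ
    refine integral_trim hC (StronglyMeasurable.mul ?_ hf)
    exact Measurable.stronglyMeasurable (hk.comp (@measurable_prodMk_left I I C C ξ))
  rw [heq]
  exact h

theorem aestronglyMeasurable_adjOp_of_le {I : Type*} {C mI : MeasurableSpace I} (hC : C ≤ mI)
    {μ : Measure I} [IsProbabilityMeasure μ] {k : I × I → ℝ} (hk : Measurable[C.prod C] k) {f : I → ℝ}
    (hf : AEStronglyMeasurable[C] f μ) : AEStronglyMeasurable[C] (adjOp μ k f) μ := by
  rw [adjOp_congr hf.ae_eq_mk]
  exact (stronglyMeasurable_adjOp_of_le hC hk hf.stronglyMeasurable_mk).aestronglyMeasurable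

theorem prod_self_le {I : Type*} {C mI : MeasurableSpace I} (hC : C ≤ mI) :
    C.prod C ≤ Prod.instMeasurableSpace :=
  sup_le_sup (MeasurableSpace.comap_mono hC) (MeasurableSpace.comap_mono hC)

theorem setIntegral_eq_integral_mul_indicator {X : Type*} [MeasurableSpace X] {μ : Measure X}
    {A : Set X} (hA : MeasurableSet A) (F : X → ℝ) :
    ∫ ξ in A, F ξ ∂μ = ∫ ξ, F ξ * A.indicator 1 ξ ∂μ := by
  rw [← integral_indicator hA]
  refine integral_congr_ae (ae_of_all _ fun ξ => ?_)
  by_cases h : ξ ∈ A <;> simp [h]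

section Average

variable {I : Type*} {C : MeasurableSpace I} [mI : MeasurableSpace I] {μ : Measure I}
  [IsProbabilityMeasure μ] {d : ℕ} {w : I × I → EuclideanSpace ℝ (Fin d)}

theorem measurable_average (hC : C ≤ mI) : Measurable (average C μ w) :=
  (stronglyMeasurable_condExp.mono (prod_self_le hC)).measurable

theorem norm_average_le (hw1 : ∀ᵐ p ∂μ.prod μ, ‖w p‖ ≤ 1) :
    ∀ᵐ p ∂μ.prod μ, ‖average C μ w p‖ ≤ 1 :=
  ae_bdd_norm_condExp_of_ae_bdd_norm hw1

theorem integral_average_mul (hC : C ≤ mI) (hw : Measurable w) (hw1 : ∀ᵐ p ∂μ.prod μ, ‖w p‖ ≤ 1)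
    (l : Fin d) {f g : I → ℝ} (hf : AEStronglyMeasurable[C] f μ) (hg : AEStronglyMeasurable[C] g μ)
    (hfi : Integrable f μ) (hgi : Integrable g μ) :
    ∫ p, average C μ w p l * (g p.1 * f p.2) ∂μ.prod μ =
      ∫ p, w p l * (g p.1 * f p.2) ∂μ.prod μ := by
  have hle := prod_self_le hC
  have hk := boundedKernel_coord (μ := μ) hw hw1 l
  have hproj : (fun p => average C μ w p l) =ᵐ[μ.prod μ]
      condExp (C.prod C) (μ.prod μ) fun p => w p l :=
    (EuclideanSpace.proj (𝕜 := ℝ) l).comp_condExp_comm (integrable_of_norm_le_one hw hw1)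
  have hgf : AEStronglyMeasurable[C.prod C] (fun p : I × I => g p.1 * f p.2) (μ.prod μ) := by
    refine ⟨fun p => hg.mk g p.1 * hf.mk f p.2, ?_, ?_⟩
    · have h1 : StronglyMeasurable[C.prod C] fun p : I × I => hg.mk g p.1 :=
        hg.stronglyMeasurable_mk.comp_measurable (@measurable_fst I I C C)
      have h2 : StronglyMeasurable[C.prod C] fun p : I × I => hf.mk f p.2 :=
        hf.stronglyMeasurable_mk.comp_measurable (@measurable_snd I I C C)
      exact h1.mul h2
    · filter_upwards [Measure.quasiMeasurePreserving_fst.ae hg.ae_eq_mk,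
        Measure.quasiMeasurePreserving_snd.ae hf.ae_eq_mk] with p h1 h2
      rw [h1, h2]
  have hpull := condExp_mul_of_aestronglyMeasurable_right (f := fun p => w p l) hgf
    (hk.integrable_mul_mul hfi hgi) hk.integrable
  calc ∫ p, average C μ w p l * (g p.1 * f p.2) ∂μ.prod μ
      = ∫ p, condExp (C.prod C) (μ.prod μ) ((fun p => w p l) * fun p : I × I => g p.1 * f p.2) p
          ∂μ.prod μ := by
        refine integral_congr_ae ?_
        filter_upwards [hproj, hpull] with p h1 h2
        rw [h2, Pi.mul_apply, ← h1]
    _ = ∫ p, w p l * (g p.1 * f p.2) ∂μ.prod μ := integral_condExp hle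

/-- Invariance makes the right side measurable for `C`, as the left side is, so only integrals over
members of `C` need comparison. These are pairings with `C × C`-measurable functions, on which `w`
and its average agree. -/
theorem adjOp_average_ae_eq (hC : C ≤ mI) (hw : Measurable w) (hw1 : ∀ᵐ p ∂μ.prod μ, ‖w p‖ ≤ 1)
    (hinv : IsInvariantPair μ w C C) (s : Option (Fin d ⊕ Fin d)) {f : I → ℝ}
    (hf : AEStronglyMeasurable[C] f μ) (hf2 : MemLp f 2 μ) :
    adjOp μ (coordKernel (average C μ w) s) f =ᵐ[μ] adjOp μ (coordKernel w s) f := by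
  rcases s with _ | s
  · rfl
  have hfi := MemLp.integrable_two hf2
  have hK := kernelFamily_coord (μ := μ) hw hw1
  have hA := kernelFamily_coord (μ := μ) (measurable_average (μ := μ) (w := w) hC) (norm_average_le (C := C) hw1)
  have hinv' : AEStronglyMeasurable[C] (adjOp μ (coordKernel w (some s)) f) μ := by
    rw [adjOp_congr hf.ae_eq_mk]
    exact hinv.coord hf.stronglyMeasurable_mk.measurable (hf2.ae_eq hf.ae_eq_mk) s
  have hCm : Measurable[C.prod C] (coordKernel (average C μ w) (some s)) := by
    have h0 : Measurable[C.prod C] (average C μ w) := stronglyMeasurable_condExp.measurable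
    have hp : ∀ l : Fin d, Measurable fun v : EuclideanSpace ℝ (Fin d) => v l := fun l =>
      (EuclideanSpace.proj (𝕜 := ℝ) l).continuous.measurable
    rcases s with l | l
    · exact (hp l).comp h0
    · exact (hp l).comp (h0.comp (@measurable_swap I I C C))
  have : IsProbabilityMeasure (μ.trim hC) := ⟨by rw [trim_measurableSet_eq hC MeasurableSet.univ, measure_univ]⟩
  refine ae_eq_of_forall_setIntegral_eq_of_sigmaFinite' hC
    (fun _ _ _ => ((hA.bdd _).integrable_adjOp hfi).integrableOn)
    (fun _ _ _ => ((hK.bdd _).integrable_adjOp hfi).integrableOn) (fun A hAm _ => ?_)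
    (aestronglyMeasurable_adjOp_of_le hC hCm hf) hinv'
  have hAi : Integrable (A.indicator (1 : I → ℝ)) μ :=
    (integrable_const (1 : ℝ)).indicator (hC _ hAm)
  have hAs : AEStronglyMeasurable[C] (A.indicator (1 : I → ℝ)) μ :=
    (show StronglyMeasurable[C] _ from stronglyMeasurable_one.indicator hAm).aestronglyMeasurable
  rw [setIntegral_eq_integral_mul_indicator (hC _ hAm),
    setIntegral_eq_integral_mul_indicator (hC _ hAm)]
  rcases s with l | l
  · rw [(hA.bdd _).integral_adjOp_mul hfi hAi, (hK.bdd _).integral_adjOp_mul hfi hAi]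
    exact integral_average_mul hC hw hw1 l hf hAs hfi hAi
  · rw [(hA.bdd _).adjoint hfi hAi, (hK.bdd _).adjoint hfi hAi, hA.transpose, hK.transpose]
    simp only [mul_comm (f _)]
    rw [(hA.bdd _).integral_adjOp_mul hAi hfi, (hK.bdd _).integral_adjOp_mul hAi hfi]
    exact integral_average_mul hC hw hw1 l hAs hf hAi hfi

theorem treeFun_average_ae_eq (hw : Measurable w) (hw1 : ∀ᵐ p ∂μ.prod μ, ‖w p‖ ≤ 1)
    (hC : IsInvariantAlgebra μ w C) (t : RootedTree (Option (Fin d ⊕ Fin d))) :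
    AEStronglyMeasurable[C] (treeFun μ (coordKernel w) t) μ ∧
    treeFun μ (coordKernel (average C μ w)) t =ᵐ[μ] treeFun μ (coordKernel w) t := by
  have hK := kernelFamily_coord (μ := μ) hw hw1
  induction t with
  | one => exact ⟨aestronglyMeasurable_const, Filter.EventuallyEq.rfl⟩
  | graft s c r hc hr =>
    have hadj := adjOp_average_ae_eq hC.le hw hw1 hC.invariant s hc.1 (memLp_treeFun hK c 2)
    constructor
    · refine AEStronglyMeasurable.mul ?_ hr.1
      rcases s with _ | s
      · have : adjOp μ (coordKernel w none) (treeFun μ (coordKernel w) c) = fun _ => 0 := by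
          funext ξ
          simp [adjOp, coordKernel]
        rw [this]
        exact aestronglyMeasurable_const
      · rw [adjOp_congr hc.1.ae_eq_mk]
        exact hC.invariant.coord hc.1.stronglyMeasurable_mk.measurable
          ((memLp_treeFun hK c 2).ae_eq hc.1.ae_eq_mk) s
    · filter_upwards [hadj, hr.2] with ξ h1 h2
      simp only [treeFun]
      rw [adjOp_congr hc.2, h1, h2]

end Average

/-! ### Tree functions and measure preserving maps -/

section Pullback

variable {X Y : Type*} [MeasurableSpace X] [MeasurableSpace Y] {μ : Measure X} {ν : Measure Y}
  [IsProbabilityMeasure μ] [IsProbabilityMeasure ν] {S : Type} {inv : S → S} {K : S → Y × Y → ℝ}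

theorem integral_comp_measurePreserving {p : X → Y} (hp : MeasurePreserving p μ ν) {F : Y → ℝ}
    (hF : StronglyMeasurable F) : ∫ x, F (p x) ∂μ = ∫ y, F y ∂ν := by
  rw [← hp.map_eq, integral_map hp.aemeasurable hF.aestronglyMeasurable]

theorem treeFun_comp_measurePreserving (hK : KernelFamily ν inv K) {p : X → Y}
    (hp : MeasurePreserving p μ ν) (t : RootedTree S) :
    treeFun μ (fun s x => K s (p x.1, p x.2)) t = fun ξ => treeFun ν K t (p ξ) := by
  induction t with
  | one => rfl
  | graft s c r hc hr =>
    funext ξ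
    simp only [treeFun]
    rw [hr, hc]
    congr 1
    have hm : StronglyMeasurable fun y => K s (p ξ, y) * treeFun ν K c y :=
      ((hK.bdd s).measurable.comp measurable_prodMk_left).stronglyMeasurable.mul
        (stronglyMeasurable_treeFun hK c)
    exact integral_comp_measurePreserving hp hm

theorem integral_treeFun_comp_measurePreserving (hK : KernelFamily ν inv K) {p : X → Y}
    (hp : MeasurePreserving p μ ν) (t : RootedTree S) :
    ∫ ξ, treeFun μ (fun s x => K s (p x.1, p x.2)) t ξ ∂μ = ∫ y, treeFun ν K t y ∂ν := by
  rw [treeFun_comp_measurePreserving hK hp t]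
  exact integral_comp_measurePreserving hp (stronglyMeasurable_treeFun hK t)

theorem KernelFamily.comp_measurePreserving (hK : KernelFamily ν inv K) {p : X → Y}
    (hp : MeasurePreserving p μ ν) :
    KernelFamily μ inv fun s x => K s (p x.1, p x.2) where
  bdd s := ⟨(hK.bdd s).measurable.comp (hp.measurable.prodMap hp.measurable),
    (hp.prod hp).quasiMeasurePreserving.ae (hK.bdd s).bound⟩
  transpose s := by rw [← hK.transpose s]; rfl

end Pullback

/-! ### Tree functions and the cut norm -/

section CutNorm

variable {X : Type*} [MeasurableSpace X] {μ : Measure X} [IsProbabilityMeasure μ] {S : Type}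
  {inv : S → S} {K₁ K₂ : S → X × X → ℝ} {δ : ℝ}

/-- The operators of the two families are close, as operators from `L^∞` to `L^1`. -/
def OperatorClose (μ : Measure X) (δ : ℝ) (K₁ K₂ : S → X × X → ℝ) : Prop :=
  ∀ s (f : X → ℝ), Measurable f → (∀ᵐ ξ ∂μ, |f ξ| ≤ 1) →
    ∫ ξ, |adjOp μ (K₁ s) f ξ - adjOp μ (K₂ s) f ξ| ∂μ ≤ δ

/-- The number of edges of a rooted tree. -/
def RootedTree.size {S : Type} : RootedTree S → ℕ
  | .one => 0
  | .graft _ c r => c.size + r.size + 1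

/-- The counting lemma: the kernels are exchanged edge by edge, at a cost of `δ` for each edge,
since all remaining factors are bounded by `1`. -/
theorem OperatorClose.integral_abs_treeFun_sub_le (h : OperatorClose μ δ K₁ K₂)
    (h₁ : KernelFamily μ inv K₁) (h₂ : KernelFamily μ inv K₂) (t : RootedTree S) :
    ∫ ξ, |treeFun μ K₁ t ξ - treeFun μ K₂ t ξ| ∂μ ≤ t.size * δ := by
  induction t with
  | one => simp [treeFun, RootedTree.size]
  | graft s c r hc hr =>
    have i₁ := integrable_treeFun h₁ c
    have i₂ := integrable_treeFun h₂ c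
    have a₁ := (h₁.bdd s).integrable_adjOp i₁
    have a₂ := (h₂.bdd s).integrable_adjOp i₁
    have hδ := h s _ (stronglyMeasurable_treeFun h₁ c).measurable (abs_treeFun_le h₁ c)
    have hsub := (h₂.bdd s).adjOp_sub i₁ i₂
    have hbd := (h₂.bdd s).abs_adjOp_le (i₁.sub i₂)
    have hbd₂ := (h₂.bdd s).abs_adjOp_le i₂
    have hint₂ : ∫ ζ, |treeFun μ K₂ c ζ| ∂μ ≤ 1 := by
      have := integral_mono_ae i₂.abs (integrable_const 1) (abs_treeFun_le h₂ c)
      simpa using this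
    have hpt : ∀ᵐ ξ ∂μ, |treeFun μ K₁ (.graft s c r) ξ - treeFun μ K₂ (.graft s c r) ξ| ≤
        |adjOp μ (K₁ s) (treeFun μ K₁ c) ξ - adjOp μ (K₂ s) (treeFun μ K₁ c) ξ| +
        (∫ ζ, |treeFun μ K₁ c ζ - treeFun μ K₂ c ζ| ∂μ) +
        |treeFun μ K₁ r ξ - treeFun μ K₂ r ξ| := by
      filter_upwards [hsub, hbd, hbd₂, abs_treeFun_le h₁ r] with ξ e1 e2 e3 e4
      simp only [treeFun]
      simp only [Pi.sub_apply, one_mul] at e1 e2 e3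
      rw [e1] at e2
      set A := adjOp μ (K₁ s) (treeFun μ K₁ c) ξ
      set A' := adjOp μ (K₂ s) (treeFun μ K₁ c) ξ
      set B := adjOp μ (K₂ s) (treeFun μ K₂ c) ξ
      set a := treeFun μ K₁ r ξ
      set b := treeFun μ K₂ r ξ
      have hB : |B| ≤ 1 := e3.trans hint₂
      -- The three terms exchange the kernel on the grafted edge, inside the branch `c`, and inside
      -- the rest `r`.
      calc |A * a - B * b| = |(A - A') * a + (A' - B) * a + B * (a - b)| := by congr 1; ring
        _ ≤ |A - A'| * |a| + |A' - B| * |a| + |B| * |a - b| := by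
          refine (abs_add_three _ _ _).trans_eq ?_
          rw [abs_mul, abs_mul, abs_mul]
        _ ≤ |A - A'| * 1 + |A' - B| * 1 + 1 * |a - b| := by gcongr
        _ ≤ _ := by linarith
    have ir : Integrable (fun ξ => |treeFun μ K₁ r ξ - treeFun μ K₂ r ξ|) μ :=
      ((integrable_treeFun h₁ r).sub (integrable_treeFun h₂ r)).abs
    have ia : Integrable (fun ξ => |adjOp μ (K₁ s) (treeFun μ K₁ c) ξ -
        adjOp μ (K₂ s) (treeFun μ K₁ c) ξ|) μ := (a₁.sub a₂).abs
    refine (integral_mono_ae ((integrable_treeFun h₁ _).sub (integrable_treeFun h₂ _)).abs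
      ((ia.add (integrable_const _)).add ir) hpt).trans ?_
    rw [integral_add' (ia.add (integrable_const _)) ir, integral_add' ia (integrable_const _)]
    simp only [integral_const, probReal_univ, one_smul, RootedTree.size]
    push_cast
    linarith

theorem integral_abs_le_of_setIntegral_le {g : X → ℝ} (hg : Measurable g) (hgi : Integrable g μ)
    {c : ℝ} (h : ∀ A, MeasurableSet A → |∫ ξ in A, g ξ ∂μ| ≤ c) : ∫ ξ, |g ξ| ∂μ ≤ 2 * c := by
  have := integral_norm_eq_pos_sub_neg hgi
  simp only [Real.norm_eq_abs] at this
  rw [this]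
  have h1 := h {x | 0 ≤ g x} (measurableSet_le measurable_const hg)
  have h2 := h {x | g x ≤ 0} (measurableSet_le hg measurable_const)
  linarith [abs_le.1 h1, abs_le.1 h2]

/-- The constant is `2 * 2`: an `L¹` norm is at most twice the largest absolute integral over a set,
and this is used once in each variable. Between the two uses, the adjoint relation and `|f| ≤ 1`
remove `f`. -/
theorem BoundedKernel.integral_abs_adjOp_le {M c : ℝ} {k : X × X → ℝ} (hk : BoundedKernel μ M k)
    (h : ∀ A B, MeasurableSet A → MeasurableSet B → |∫ p in A ×ˢ B, k p ∂μ.prod μ| ≤ c)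
    {f : X → ℝ} (hf : Measurable f) (hf1 : ∀ᵐ ξ ∂μ, |f ξ| ≤ 1) :
    ∫ ξ, |adjOp μ k f ξ| ∂μ ≤ 4 * c := by
  have hfi : Integrable f μ := Integrable.of_bound hf.aestronglyMeasurable 1 hf1
  have hind : ∀ {A : Set X}, MeasurableSet A → Integrable (A.indicator (1 : X → ℝ)) μ := fun hA =>
    (integrable_const (1 : ℝ)).indicator hA
  have hsec : ∀ A, MeasurableSet A →
      ∫ ξ, |adjOp μ (transposeKernel k) (A.indicator 1) ξ| ∂μ ≤ 2 * c := by
    intro A hA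
    refine integral_abs_le_of_setIntegral_le
      (stronglyMeasurable_adjOp hk.transpose.measurable (hind hA).1).measurable
      (hk.transpose.integrable_adjOp (hind hA)) fun B hB => ?_
    rw [setIntegral_eq_integral_mul_indicator hB, hk.transpose.adjoint (hind hA) (hind hB),
      transposeKernel_transposeKernel]
    simp only [mul_comm (A.indicator 1 _)]
    rw [hk.integral_adjOp_mul (hind hB) (hind hA)]
    have : ∫ p, k p * (A.indicator 1 p.1 * B.indicator 1 p.2) ∂μ.prod μ =
        ∫ p in A ×ˢ B, k p ∂μ.prod μ := by
      rw [← integral_indicator (hA.prod hB)]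
      refine integral_congr_ae (ae_of_all _ fun p => ?_)
      by_cases h1 : p.1 ∈ A <;> by_cases h2 : p.2 ∈ B <;> simp [h1, h2, Set.indicator]
    rw [this]
    exact h A B hA hB
  have h4 : (4 : ℝ) * c = 2 * (2 * c) := by ring
  rw [h4]
  refine integral_abs_le_of_setIntegral_le
    (stronglyMeasurable_adjOp hk.measurable hfi.1).measurable (hk.integrable_adjOp hfi) fun A hA => ?_
  rw [setIntegral_eq_integral_mul_indicator hA, hk.adjoint hfi (hind hA)]
  refine (abs_integral_le_integral_abs).trans ((integral_mono_ae ?_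
    (hk.transpose.integrable_adjOp (hind hA)).abs ?_).trans (hsec A hA))
  · exact ((hk.transpose.integrable_adjOp (hind hA)).bdd_mul (c := 1) hf.aestronglyMeasurable
      (by simpa using hf1)).abs
  · filter_upwards [hf1] with ξ hξ
    rw [abs_mul]
    exact mul_le_of_le_one_left (abs_nonneg _) hξ

end CutNorm

/-! ### Kernels at cut distance zero have equal tree integrals -/

section CutNorm

variable {X : Type*} [MeasurableSpace X] {μ : Measure X} [IsProbabilityMeasure μ] {d : ℕ}

theorem abs_setIntegral_coord_le_of_cutNorm_le {k : X × X → EuclideanSpace ℝ (Fin d)}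
    (hk : Integrable k (μ.prod μ)) {c : ℝ} (hc : 0 ≤ c) (h : cutNorm μ k ≤ ENNReal.ofReal c)
    (l : Fin d) {A B : Set X} (hA : MeasurableSet A) (hB : MeasurableSet B) :
    |∫ p in A ×ˢ B, k p l ∂μ.prod μ| ≤ c := by
  have hl : ∫ p in A ×ˢ B, k p l ∂μ.prod μ = (∫ p in A ×ˢ B, k p ∂μ.prod μ) l :=
    ContinuousLinearMap.integral_comp_comm (EuclideanSpace.proj (𝕜 := ℝ) l) hk.integrableOn
  have key : ∀ e : EuclideanSpace ℝ (Fin d), ‖e‖ ≤ 1 →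
      inner ℝ e (∫ p in A ×ˢ B, k p ∂μ.prod μ) ≤ c := fun e he => by
    have h1 : ENNReal.ofReal (inner ℝ e (∫ p in A ×ˢ B, k p ∂μ.prod μ)) ≤ cutNorm μ k :=
      (le_iSup₂_of_le (f := fun (T : Set X) (_ : MeasurableSet T) =>
        ENNReal.ofReal (inner ℝ e (∫ p in A ×ˢ T, k p ∂μ.prod μ))) B hB le_rfl).trans
        ((le_iSup₂_of_le (f := fun (S : Set X) (_ : MeasurableSet S) =>
          ⨆ (T : Set X) (_ : MeasurableSet T),
            ENNReal.ofReal (inner ℝ e (∫ p in S ×ˢ T, k p ∂μ.prod μ))) A hA le_rfl).trans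
          (le_iSup₂_of_le (f := fun (e : EuclideanSpace ℝ (Fin d)) (_ : ‖e‖ ≤ 1) =>
            ⨆ (S : Set X) (_ : MeasurableSet S) (T : Set X) (_ : MeasurableSet T),
              ENNReal.ofReal (inner ℝ e (∫ p in S ×ˢ T, k p ∂μ.prod μ))) e he le_rfl))
    exact (ENNReal.ofReal_le_ofReal_iff hc).1 (h1.trans h)
  have hn : ‖EuclideanSpace.single l (1 : ℝ)‖ ≤ 1 := by simp
  have h1 := key (EuclideanSpace.single l 1) hn
  have h2 := key (-EuclideanSpace.single l 1) (by rwa [norm_neg])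
  rw [inner_neg_left] at h2
  rw [EuclideanSpace.inner_single_left] at h1 h2
  rw [hl, abs_le]
  simp only [map_one, one_mul] at h1 h2
  exact ⟨by linarith, h1⟩

theorem adjOp_kernel_sub {M N : ℝ} {k k' : X × X → ℝ} (hk : BoundedKernel μ M k)
    (hk' : BoundedKernel μ N k') {f : X → ℝ} (hf : Integrable f μ) :
    adjOp μ (fun p => k p - k' p) f =ᵐ[μ] fun ξ => adjOp μ k f ξ - adjOp μ k' f ξ := by
  filter_upwards [hk.integrable_section hf, hk'.integrable_section hf] with ξ h1 h2
  simp only [adjOp, sub_mul]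
  exact integral_sub h1 h2

theorem BoundedKernel.sub {M N : ℝ} {k k' : X × X → ℝ} (hk : BoundedKernel μ M k)
    (hk' : BoundedKernel μ N k') : BoundedKernel μ (M + N) fun p => k p - k' p where
  measurable := hk.measurable.sub hk'.measurable
  bound := by
    filter_upwards [hk.bound, hk'.bound] with p h1 h2
    exact (abs_sub _ _).trans (add_le_add h1 h2)

theorem operatorClose_of_cutNorm_le {w u : X × X → EuclideanSpace ℝ (Fin d)} (hw : Measurable w)
    (hw1 : ∀ᵐ p ∂μ.prod μ, ‖w p‖ ≤ 1) (hu : Measurable u) (hu1 : ∀ᵐ p ∂μ.prod μ, ‖u p‖ ≤ 1)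
    {c : ℝ} (hc : 0 ≤ c) (h : cutNorm μ (fun p => w p - u p) ≤ ENNReal.ofReal c) :
    OperatorClose μ (4 * c) (coordKernel w) (coordKernel u) := by
  have hW := kernelFamily_coord (μ := μ) hw hw1
  have hU := kernelFamily_coord (μ := μ) hu hu1
  have hint : Integrable (fun p => w p - u p) (μ.prod μ) :=
    (integrable_of_norm_le_one hw hw1).sub (integrable_of_norm_le_one hu hu1)
  have hrect : ∀ l {A B : Set X}, MeasurableSet A → MeasurableSet B →
      |∫ p in A ×ˢ B, (w p l - u p l) ∂μ.prod μ| ≤ c := fun l A B hA hB =>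
    abs_setIntegral_coord_le_of_cutNorm_le hint hc h l hA hB
  rintro (_ | s) f hf hf1
  · simp [adjOp, coordKernel, hc]
  have hfi : Integrable f μ := Integrable.of_bound hf.aestronglyMeasurable 1 hf1
  have hsub := adjOp_kernel_sub (hW.bdd (some s)) (hU.bdd (some s)) hfi
  have : ∫ ξ, |adjOp μ (coordKernel w (some s)) f ξ - adjOp μ (coordKernel u (some s)) f ξ| ∂μ =
      ∫ ξ, |adjOp μ (fun p => coordKernel w (some s) p - coordKernel u (some s) p) f ξ| ∂μ :=
    integral_congr_ae (hsub.mono fun ξ hξ => by simp only [hξ])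
  rw [this]
  refine ((hW.bdd (some s)).sub (hU.bdd (some s))).integral_abs_adjOp_le (fun A B hA hB => ?_) hf hf1
  rcases s with l | l
  · exact hrect l hA hB
  · refine le_of_eq_of_le ?_ (hrect l hB hA)
    congr 1
    rw [← integral_indicator (hA.prod hB), ← integral_indicator (hB.prod hA), ← integral_prod_swap]
    refine integral_congr_ae (ae_of_all _ fun p => ?_)
    obtain ⟨x, y⟩ := p
    by_cases h1 : x ∈ B <;> by_cases h2 : y ∈ A <;>
      simp [h1, h2, Set.indicator, coordKernel, transposeKernel]

end CutNorm

section CutDist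

variable {X Y : Type*} [MeasurableSpace X] [MeasurableSpace Y] {μ : Measure X} {ν : Measure Y}
  [IsProbabilityMeasure μ] [IsProbabilityMeasure ν] {d : ℕ}
  {w : X × X → EuclideanSpace ℝ (Fin d)} {u : Y × Y → EuclideanSpace ℝ (Fin d)}

theorem coordKernel_comp (p : X → Y) : coordKernel (fun x : X × X => u (p x.1, p x.2)) =
    fun s x => coordKernel u s (p x.1, p x.2) := by
  funext s
  rcases s with _ | l | l <;> rfl

theorem integral_treeFun_eq_of_bijCutDist_eq_zero (hw : Measurable w)
    (hw1 : ∀ᵐ p ∂μ.prod μ, ‖w p‖ ≤ 1) (hu : Measurable u) (hu1 : ∀ᵐ p ∂ν.prod ν, ‖u p‖ ≤ 1)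
    (h : bijCutDist μ ν w u = 0) (t : RootedTree (Option (Fin d ⊕ Fin d))) :
    ∫ ξ, treeFun μ (coordKernel w) t ξ ∂μ = ∫ ξ, treeFun ν (coordKernel u) t ξ ∂ν := by
  have hW := kernelFamily_coord (μ := μ) hw hw1
  have hU := kernelFamily_coord (μ := ν) hu hu1
  have key : ∀ c : ℝ, 0 < c → |∫ ξ, treeFun μ (coordKernel w) t ξ ∂μ -
      ∫ ξ, treeFun ν (coordKernel u) t ξ ∂ν| ≤ t.size * (4 * c) := by
    intro c hc
    have hlt : bijCutDist μ ν w u < ENNReal.ofReal c := by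
      rw [h]
      exact ENNReal.ofReal_pos.2 hc
    obtain ⟨Φ, hlt⟩ := iInf_lt_iff.1 hlt
    obtain ⟨hΦ, hlt⟩ := iInf_lt_iff.1 hlt
    have hΦΦ := hΦ.prod hΦ
    have huΦ : Measurable fun p : X × X => u (Φ p.1, Φ p.2) := hu.comp hΦΦ.measurable
    have hclose := operatorClose_of_cutNorm_le hw hw1 huΦ (hΦΦ.quasiMeasurePreserving.ae hu1) hc.le
      hlt.le
    rw [coordKernel_comp] at hclose
    have hUΦ := hU.comp_measurePreserving hΦ
    rw [← integral_treeFun_comp_measurePreserving hU hΦ t,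
      ← integral_sub (integrable_treeFun hW t) (integrable_treeFun hUΦ t)]
    exact abs_integral_le_integral_abs.trans (hclose.integral_abs_treeFun_sub_le hW hUΦ t)
  refine sub_eq_zero.1 (abs_nonpos_iff.1 (le_of_forall_pos_le_add fun ε hε => ?_))
  -- The summand `1` keeps the denominator positive for the tree without edges.
  have hs : (0 : ℝ) < 4 * t.size + 1 := by positivity
  refine (key (ε / (4 * t.size + 1)) (by positivity)).trans ?_
  rw [zero_add]
  calc (t.size : ℝ) * (4 * (ε / (4 * t.size + 1)))
      = (4 * t.size) / (4 * t.size + 1) * ε := by ring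
    _ ≤ 1 * ε := by
      refine mul_le_mul_of_nonneg_right ((div_le_one hs).2 (by linarith)) hε.le
    _ = ε := one_mul ε

theorem integral_treeFun_eq_of_cutDist_eq_zero (hw : Measurable w)
    (hw1 : ∀ᵐ p ∂μ.prod μ, ‖w p‖ ≤ 1) (hu : Measurable u) (hu1 : ∀ᵐ p ∂ν.prod ν, ‖u p‖ ≤ 1)
    (h : cutDist μ ν w u = 0) (t : RootedTree (Option (Fin d ⊕ Fin d))) :
    ∫ ξ, treeFun μ (coordKernel w) t ξ ∂μ = ∫ ξ, treeFun ν (coordKernel u) t ξ ∂ν := by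
  unfold cutDist at h
  split_ifs at h with hat
  · exact integral_treeFun_eq_of_bijCutDist_eq_zero hw hw1 hu hu1 h t
  · have f₁ : MeasurePreserving Prod.fst (μ.prod (volume : Measure unitInterval)) μ :=
      measurePreserving_fst
    have f₂ : MeasurePreserving Prod.fst (ν.prod (volume : Measure unitInterval)) ν :=
      measurePreserving_fst
    have := integral_treeFun_eq_of_bijCutDist_eq_zero (w := blowUp w) (u := blowUp u)
      (hw.comp (f₁.prod f₁).measurable) ((f₁.prod f₁).quasiMeasurePreserving.ae hw1)
      (hu.comp (f₂.prod f₂).measurable) ((f₂.prod f₂).quasiMeasurePreserving.ae hu1) h t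
    rw [← integral_treeFun_comp_measurePreserving (kernelFamily_coord hw hw1) f₁ t,
      ← integral_treeFun_comp_measurePreserving (kernelFamily_coord hu hu1) f₂ t,
      ← coordKernel_comp, ← coordKernel_comp]
    exact this

end CutDist

theorem integral_treeFun_eq_of_exists_cutDist_average_eq_zero {I₁ I₂ : Type*}
    [m₁ : MeasurableSpace I₁] [m₂ : MeasurableSpace I₂] {μ₁ : Measure I₁}
    {μ₂ : Measure I₂} [IsProbabilityMeasure μ₁] [IsProbabilityMeasure μ₂] {d : ℕ}
    {w : I₁ × I₁ → EuclideanSpace ℝ (Fin d)} {u : I₂ × I₂ → EuclideanSpace ℝ (Fin d)}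
    (hw : Measurable w) (hw1 : ∀ᵐ p ∂μ₁.prod μ₁, ‖w p‖ ≤ 1)
    (hu : Measurable u) (hu1 : ∀ᵐ p ∂μ₂.prod μ₂, ‖u p‖ ≤ 1)
    (h : ∃ (C : MeasurableSpace I₁) (D : MeasurableSpace I₂), IsInvariantAlgebra μ₁ w C ∧
      IsInvariantAlgebra μ₂ u D ∧ cutDist μ₁ μ₂ (average C μ₁ w) (average D μ₂ u) = 0)
    (t : RootedTree (Option (Fin d ⊕ Fin d))) :
    ∫ ξ, treeFun μ₁ (coordKernel w) t ξ ∂μ₁ = ∫ ξ, treeFun μ₂ (coordKernel u) t ξ ∂μ₂ := by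
  obtain ⟨C, D, hC, hD, h⟩ := h
  rw [← integral_congr_ae (treeFun_average_ae_eq (mI := m₁) hw hw1 hC t).2,
    ← integral_congr_ae (treeFun_average_ae_eq (mI := m₂) hu hu1 hD t).2]
  have hmC := measurable_average (mI := m₁) (μ := μ₁) (w := w) hC.le
  have hmD := measurable_average (mI := m₂) (μ := μ₂) (w := u) hD.le
  have hnC := norm_average_le (C := C) (mI := m₁) hw1
  have hnD := norm_average_le (C := D) (mI := m₂) hu1
  clear hC hD
  exact @integral_treeFun_eq_of_cutDist_eq_zero I₁ I₂ m₁ m₂ μ₁ μ₂ _ _ d _ _ hmC hnC hmD hnD h t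

/-! ### Integrals over labelled forests -/

section Marginal

variable {I V : Type*} [MeasurableSpace I] [Fintype V] [DecidableEq V] (μ : Measure I)
  [IsProbabilityMeasure μ]

/-- Resampling one coordinate of an independent family does not change its law. This is Fubini's
theorem in the form needed to integrate out a leaf. -/
theorem measurePreserving_update (v : V) :
    MeasurePreserving (fun p : (V → I) × I => Function.update p.1 v p.2)
      ((Measure.pi fun _ => μ).prod μ) (Measure.pi fun _ => μ) := by
  have hm : Measurable fun p : (V → I) × I => Function.update p.1 v p.2 := by
    refine measurable_pi_lambda _ fun u => ?_
    by_cases h : u = v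
    · subst h
      simpa using measurable_snd
    · simp only [Function.update_of_ne h]
      exact (measurable_pi_apply u).comp measurable_fst
  refine ⟨hm, (Measure.pi_eq fun s hs => ?_).symm⟩
  rw [Measure.map_apply hm (MeasurableSet.univ_pi hs)]
  have : (fun p : (V → I) × I => Function.update p.1 v p.2) ⁻¹' Set.univ.pi s =
      (Set.univ.pi (Function.update s v Set.univ)) ×ˢ s v := by
    ext ⟨x, y⟩
    simp only [Set.mem_preimage, Set.mem_univ_pi, Set.mem_prod]
    constructor
    · refine fun h => ⟨fun u => ?_, by simpa using h v⟩
      by_cases huv : u = v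
      · subst huv; simp
      · simpa [Function.update_of_ne huv] using h u
    · rintro ⟨h, hy⟩ u
      by_cases huv : u = v
      · subst huv; simpa using hy
      · simpa [Function.update_of_ne huv] using h u
  rw [this, Measure.prod_prod, Measure.pi_pi, ← Finset.mul_prod_erase _ _ (Finset.mem_univ v),
    ← Finset.mul_prod_erase _ (fun i => μ (s i)) (Finset.mem_univ v)]
  simp only [Function.update_self, measure_univ, one_mul]
  rw [mul_comm]
  congr 1
  refine Finset.prod_congr rfl fun u hu => ?_
  rw [Function.update_of_ne (Finset.ne_of_mem_erase hu)]

theorem measurePreserving_pair {i j : V} (hij : i ≠ j) :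
    MeasurePreserving (fun ξ : V → I => (ξ i, ξ j)) (Measure.pi fun _ => μ) (μ.prod μ) := by
  have h := (iIndepFun_pi (μ := fun _ : V => μ) (X := fun _ => id) fun _ => aemeasurable_id).indepFun
    hij
  have h2 := (indepFun_iff_map_prod_eq_prod_map_map (measurable_pi_apply i).aemeasurable
    (measurable_pi_apply j).aemeasurable).1 h
  refine ⟨(measurable_pi_apply i).prodMk (measurable_pi_apply j), ?_⟩
  refine h2.trans ?_
  congr 1
  · exact (measurePreserving_eval (fun _ : V => μ) i).map_eq
  · exact (measurePreserving_eval (fun _ : V => μ) j).map_eq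

end Marginal

/-! ### Graphs with rooted trees attached to the vertices. -/

section Forest

variable {I : Type*} [MeasurableSpace I] {μ : Measure I} [IsProbabilityMeasure μ] {S : Type}
  {inv : S → S} {K : S → I × I → ℝ} {V : Type} [Fintype V] [DecidableEq V]

/-- The integrand of a graph with labelled edges and with rooted trees attached to its vertices. -/
noncomputable def forestFun (μ : Measure I) (K : S → I × I → ℝ) (E : Finset (V × V)) (lab : V × V → S)
    (τ : V → RootedTree S) (ξ : V → I) : ℝ :=
  (∏ e ∈ E, K (lab e) (ξ e.1, ξ e.2)) * ∏ v, treeFun μ K (τ v) (ξ v)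

/-- Loops are excluded because the kernels are bounded only almost everywhere, which says nothing
about the diagonal. -/
theorem integrable_forestFun (hK : KernelFamily μ inv K) {E : Finset (V × V)}
    (hE : ∀ e ∈ E, e.1 ≠ e.2) (lab : V × V → S) (τ : V → RootedTree S) :
    Integrable (forestFun μ K E lab τ) (Measure.pi fun _ => μ) := by
  have hm : Measurable (forestFun μ K E lab τ) := by
    refine (Finset.measurable_prod _ fun e _ => ?_).mul (Finset.measurable_prod _ fun v _ => ?_)
    · exact (hK.bdd _).measurable.comp
        ((measurable_pi_apply e.1).prodMk (measurable_pi_apply e.2))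
    · exact (stronglyMeasurable_treeFun hK _).measurable.comp (measurable_pi_apply v)
  refine Integrable.of_bound hm.aestronglyMeasurable 1 ?_
  have h1 : ∀ᵐ ξ ∂(Measure.pi fun _ : V => μ), ∀ e ∈ E, |K (lab e) (ξ e.1, ξ e.2)| ≤ 1 := by
    rw [Filter.eventually_all_finset]
    exact fun e he => (measurePreserving_pair μ (hE e he)).quasiMeasurePreserving.ae (hK.bdd _).bound
  have h2 : ∀ᵐ ξ ∂(Measure.pi fun _ : V => μ), ∀ v, |treeFun μ K (τ v) (ξ v)| ≤ 1 := by
    rw [ae_all_iff]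
    exact fun v => (measurePreserving_eval (fun _ : V => μ) v).quasiMeasurePreserving.ae
      (abs_treeFun_le hK _)
  filter_upwards [h1, h2] with ξ h1 h2
  rw [forestFun, Real.norm_eq_abs, abs_mul, Finset.abs_prod, Finset.abs_prod]
  exact mul_le_one₀ (Finset.prod_le_one (fun _ _ => abs_nonneg _) h1)
    (Finset.prod_nonneg fun _ _ => abs_nonneg _)
    (Finset.prod_le_one (fun _ _ => abs_nonneg _) fun v _ => h2 v)

/-- Integrating out a leaf `v` attached to `p` by the edge `e₀`. -/
theorem integral_forestFun_insert (hK : KernelFamily μ inv K) {E : Finset (V × V)}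
    (hE : ∀ e ∈ E, e.1 ≠ e.2) (lab : V × V → S) (τ : V → RootedTree S) {v p : V} (hvp : v ≠ p)
    (hv : ∀ e ∈ E, e.1 ≠ v ∧ e.2 ≠ v) {e₀ : V × V} {s : S}
    (he₀ : e₀ = (p, v) ∧ s = lab e₀ ∨ e₀ = (v, p) ∧ s = inv (lab e₀)) :
    ∫ ξ, forestFun μ K (insert e₀ E) lab τ ξ ∂(Measure.pi fun _ => μ) =
      ∫ ξ, forestFun μ K E lab
        (Function.update (Function.update τ v .one) p (.graft s (τ v) (τ p))) ξ
          ∂(Measure.pi fun _ => μ) := by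
  have he₀E : e₀ ∉ E := fun h => by
    rcases he₀ with ⟨rfl, -⟩ | ⟨rfl, -⟩
    · exact (hv _ h).2 rfl
    · exact (hv _ h).1 rfl
  have hE' : ∀ e ∈ insert e₀ E, e.1 ≠ e.2 := fun e he => by
    rcases Finset.mem_insert.1 he with rfl | he
    · rcases he₀ with ⟨rfl, -⟩ | ⟨rfl, -⟩
      · exact hvp.symm
      · exact hvp
    · exact hE e he
  have hmp := measurePreserving_update (V := V) μ v
  have hint := integrable_forestFun hK hE' lab τ
  have hker : ∀ ξ : V → I, K (lab e₀) (ξ e₀.1, ξ e₀.2) = K s (ξ p, ξ v) := fun ξ => by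
    rcases he₀ with ⟨rfl, rfl⟩ | ⟨rfl, rfl⟩
    · rfl
    · rw [← hK.transpose]
      rfl
  have hfac : ∀ (ξ : V → I) (x : I), forestFun μ K (insert e₀ E) lab τ (Function.update ξ v x) =
      ((∏ e ∈ E, K (lab e) (ξ e.1, ξ e.2)) *
        ∏ u ∈ (Finset.univ.erase v), treeFun μ K (τ u) (ξ u)) *
      (K s (ξ p, x) * treeFun μ K (τ v) x) := by
    intro ξ x
    rw [forestFun, Finset.prod_insert he₀E, hker, ← Finset.mul_prod_erase _ _ (Finset.mem_univ v),
      Function.update_self, Function.update_of_ne hvp.symm]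
    have e1 : ∏ e ∈ E, K (lab e) (Function.update ξ v x e.1, Function.update ξ v x e.2) =
        ∏ e ∈ E, K (lab e) (ξ e.1, ξ e.2) := Finset.prod_congr rfl fun e he => by
      rw [Function.update_of_ne (hv e he).1, Function.update_of_ne (hv e he).2]
    have e2 : ∏ u ∈ Finset.univ.erase v, treeFun μ K (τ u) (Function.update ξ v x u) =
        ∏ u ∈ Finset.univ.erase v, treeFun μ K (τ u) (ξ u) := Finset.prod_congr rfl fun u hu => by
      rw [Function.update_of_ne (Finset.ne_of_mem_erase hu)]
    rw [e1, e2]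
    ring
  calc ∫ ξ, forestFun μ K (insert e₀ E) lab τ ξ ∂(Measure.pi fun _ => μ)
      = ∫ q, forestFun μ K (insert e₀ E) lab τ (Function.update q.1 v q.2)
          ∂(Measure.pi fun _ => μ).prod μ := by
        conv_lhs => rw [← hmp.map_eq]
        rw [integral_map hmp.aemeasurable (by rw [hmp.map_eq]; exact hint.1)]
    _ = ∫ ξ, ∫ x, forestFun μ K (insert e₀ E) lab τ (Function.update ξ v x) ∂μ
          ∂(Measure.pi fun _ => μ) := integral_prod _ (hmp.integrable_comp_of_integrable hint)
    _ = _ := by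
        refine integral_congr_ae (ae_of_all _ fun ξ => ?_)
        simp only [hfac, integral_const_mul]
        rw [forestFun, mul_assoc]
        congr 1
        have hp : p ∈ Finset.univ.erase v := Finset.mem_erase.2 ⟨hvp.symm, Finset.mem_univ p⟩
        rw [← Finset.mul_prod_erase _ _ (Finset.mem_univ v), ← Finset.mul_prod_erase _ _ hp,
          ← Finset.mul_prod_erase _ (fun u => treeFun μ K (Function.update (Function.update τ v .one) p
            (.graft s (τ v) (τ p)) u) (ξ u)) hp,
          Function.update_of_ne hvp, Function.update_self, Function.update_self]
        have e3 : ∏ u ∈ (Finset.univ.erase v).erase p, treeFun μ K (Function.update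
            (Function.update τ v .one) p (.graft s (τ v) (τ p)) u) (ξ u) =
            ∏ u ∈ (Finset.univ.erase v).erase p, treeFun μ K (τ u) (ξ u) :=
          Finset.prod_congr rfl fun u hu => by
            rw [Function.update_of_ne (Finset.ne_of_mem_erase hu),
              Function.update_of_ne (Finset.ne_of_mem_erase (Finset.mem_of_mem_erase hu))]
        rw [e3]
        simp only [treeFun, adjOp]
        ring

theorem integral_forestFun_empty (lab : V × V → S) (τ : V → RootedTree S) :
    ∫ ξ, forestFun μ K ∅ lab τ ξ ∂(Measure.pi fun _ => μ) = ∏ v, ∫ ξ, treeFun μ K (τ v) ξ ∂μ := by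
  simp only [forestFun, Finset.prod_empty, one_mul]
  exact integral_fintype_prod_eq_prod (fun v => treeFun μ K (τ v))

end Forest

/-- The end point of a longest path is a leaf: another neighbour would either prolong the path or
close a cycle. -/
theorem exists_leaf_of_isAcyclic {V : Type*} [Finite V] {G : SimpleGraph V} (hG : G.IsAcyclic)
    {a b : V} (hab : G.Adj a b) : ∃ v p, G.Adj v p ∧ ∀ x, G.Adj v x → x = p := by
  classical
  have := Fintype.ofFinite V
  have : Nonempty V := ⟨a⟩
  obtain ⟨u, v, p, hp, hmax⟩ := SimpleGraph.Walk.exists_isPath_forall_isPath_length_le_length G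
  have hpos : 0 < p.length := by
    have h1 : (SimpleGraph.Walk.cons hab .nil).IsPath := by simp [hab.ne]
    exact (hmax _ _ _ h1)
  have hnil : ¬p.Nil := by rwa [SimpleGraph.Walk.not_nil_iff_lt_length]
  refine ⟨u, p.snd, p.adj_snd hnil, fun x hx => hG.eq_snd_of_adj_start hp hx ?_⟩
  by_contra hxs
  have h2 := hmax _ _ _ (hp.cons (h := hx.symm) hxs)
  simp at h2

section Equality

variable {I₁ I₂ : Type*} [MeasurableSpace I₁] [MeasurableSpace I₂] {μ₁ : Measure I₁}
  {μ₂ : Measure I₂} [IsProbabilityMeasure μ₁] [IsProbabilityMeasure μ₂]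
  {S : Type} {inv : S → S} {K₁ : S → I₁ × I₁ → ℝ} {K₂ : S → I₂ × I₂ → ℝ}

/-- Equality of the integrals of all rooted trees gives equality of the integrals of all forests. -/
theorem integral_forestFun_eq (h₁ : KernelFamily μ₁ inv K₁) (h₂ : KernelFamily μ₂ inv K₂)
    (h : ∀ t : RootedTree S, ∫ ξ, treeFun μ₁ K₁ t ξ ∂μ₁ = ∫ ξ, treeFun μ₂ K₂ t ξ ∂μ₂)
    {V : Type} [Fintype V] [DecidableEq V] (F : OrientedGraph V) (hF : F.toSimpleGraph.IsAcyclic)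
    (lab : V × V → S) (τ : V → RootedTree S) :
    ∫ ξ, forestFun μ₁ K₁ F.edges lab τ ξ ∂(Measure.pi fun _ => μ₁) =
      ∫ ξ, forestFun μ₂ K₂ F.edges lab τ ξ ∂(Measure.pi fun _ => μ₂) := by
  obtain ⟨E, hasymm⟩ := F
  induction hn : E.card generalizing E τ with
  | zero =>
    rw [Finset.card_eq_zero] at hn
    subst hn
    simp only [integral_forestFun_empty, h]
  | succ n ih =>
    have hloop : ∀ e ∈ E, e.1 ≠ e.2 := fun e he heq => by
      have he' : (e.1, e.2) ∈ E := he
      rw [heq] at he'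
      exact hasymm _ _ he' he'
    have hadj : ∀ i j, (OrientedGraph.toSimpleGraph ⟨E, hasymm⟩).Adj i j ↔
        i ≠ j ∧ ((i, j) ∈ E ∨ (j, i) ∈ E) := fun i j => SimpleGraph.fromRel_adj _ i j
    obtain ⟨e, he⟩ : E.Nonempty := Finset.card_pos.1 (by omega)
    obtain ⟨v, p, hvp, hleaf⟩ := exists_leaf_of_isAcyclic hF ((hadj e.1 e.2).2 ⟨hloop e he, .inl he⟩)
    obtain ⟨hne, hmem⟩ := (hadj v p).1 hvp
    -- Since `v` is a leaf, another edge at `v` could only be the reverse of `e₀`, which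
    -- antisymmetry of the orientation forbids.
    have hstep : ∀ e₀ ∈ E, (e₀ = (p, v) ∨ e₀ = (v, p)) →
        (∀ e ∈ E.erase e₀, e.1 ≠ v ∧ e.2 ≠ v) := by
      rintro e₀ he₀ hor ⟨i, j⟩ he
      obtain ⟨hne₀, heE⟩ := Finset.mem_erase.1 he
      have hij := hloop _ heE
      constructor
      · rintro rfl
        have hj : j = p := hleaf j ((hadj i j).2 ⟨hij, .inl heE⟩)
        subst hj
        rcases hor with rfl | rfl
        · exact hasymm _ _ heE he₀
        · exact hne₀ rfl
      · rintro rfl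
        have hi : i = p := hleaf i ((hadj j i).2 ⟨hij.symm, .inr heE⟩)
        subst hi
        rcases hor with rfl | rfl
        · exact hne₀ rfl
        · exact hasymm _ _ heE he₀
    obtain ⟨e₀, he₀, hor⟩ : ∃ e₀ ∈ E, e₀ = (p, v) ∨ e₀ = (v, p) := by
      rcases hmem with h | h
      · exact ⟨_, h, .inr rfl⟩
      · exact ⟨_, h, .inl rfl⟩
    obtain ⟨s, hs⟩ : ∃ s, e₀ = (p, v) ∧ s = lab e₀ ∨ e₀ = (v, p) ∧ s = inv (lab e₀) := by
      rcases hor with h | h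
      · exact ⟨_, .inl ⟨h, rfl⟩⟩
      · exact ⟨_, .inr ⟨h, rfl⟩⟩
    have hloop' : ∀ e ∈ E.erase e₀, e.1 ≠ e.2 := fun e he => hloop e (Finset.mem_of_mem_erase he)
    have hasymm' : ∀ i j, (i, j) ∈ E.erase e₀ → (j, i) ∉ E.erase e₀ := fun i j hi hj =>
      hasymm i j (Finset.mem_of_mem_erase hi) (Finset.mem_of_mem_erase hj)
    have hsub : OrientedGraph.toSimpleGraph ⟨E.erase e₀, hasymm'⟩ ≤
        OrientedGraph.toSimpleGraph ⟨E, hasymm⟩ := by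
      intro i j hij
      obtain ⟨h1, h2⟩ := (SimpleGraph.fromRel_adj _ i j).1 hij
      exact (hadj i j).2 ⟨h1, h2.imp Finset.mem_of_mem_erase Finset.mem_of_mem_erase⟩
    have hins : insert e₀ (E.erase e₀) = E := Finset.insert_erase he₀
    -- The leaf stays as an isolated vertex with the trivial tree, so connectedness is lost. This is
    -- why the induction runs over forests.
    have hfinal := ih (Function.update (Function.update τ v .one) p (.graft s (τ v) (τ p)))
      (E.erase e₀) hasymm' (hF.anti hsub) (by rw [Finset.card_erase_of_mem he₀]; omega)
    dsimp only at hfinal ⊢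
    rw [← hins, integral_forestFun_insert h₁ hloop' lab τ hne (hstep e₀ he₀ hor) hs,
      integral_forestFun_insert h₂ hloop' lab τ hne (hstep e₀ he₀ hor) hs]
    exact hfinal

end Equality

/-! ### Homomorphism densities in coordinates -/

section Density

variable {I : Type*} [MeasurableSpace I] {μ : Measure I} [IsProbabilityMeasure μ] {d : ℕ}
  {w : I × I → EuclideanSpace ℝ (Fin d)} {V : Type} [Fintype V] [DecidableEq V]

theorem OrientedGraph.ne_of_mem (F : OrientedGraph V) : ∀ e ∈ F.edges, e.1 ≠ e.2 :=
  fun e he heq => by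
    have he' : (e.1, e.2) ∈ F.edges := he
    rw [heq] at he'
    exact F.asymm _ _ he' he'

theorem forestFun_coordKernel (F : OrientedGraph V) (l : F.edges → Fin d)
    {lab : V × V → Option (Fin d ⊕ Fin d)} (hlab : ∀ e : F.edges, lab e = some (.inl (l e)))
    (ξ : V → I) : forestFun μ (coordKernel w) F.edges lab (fun _ => .one) ξ =
      pureTensor (fun e : F.edges => w (ξ e.1.1, ξ e.1.2)) l := by
  simp only [forestFun, treeFun, Finset.prod_const_one, mul_one, pureTensor]
  rw [← Finset.prod_coe_sort]
  refine Finset.prod_congr rfl fun e _ => ?_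
  rw [hlab]
  rfl

/-- An edge labelling which extends the multi-index of a coordinate of the tensor power. -/
def extendLabel {E : Finset (V × V)} (l : E → Fin d) (e : V × V) : Option (Fin d ⊕ Fin d) :=
  if h : e ∈ E then some (.inl (l ⟨e, h⟩)) else none

theorem extendLabel_coe {E : Finset (V × V)} (l : E → Fin d) (e : E) :
    extendLabel l e = some (.inl (l e)) := by
  simp [extendLabel]

theorem homDensity_apply (hw : Measurable w) (hw1 : ∀ᵐ p ∂μ.prod μ, ‖w p‖ ≤ 1)
    (F : OrientedGraph V) (l : F.edges → Fin d) {lab : V × V → Option (Fin d ⊕ Fin d)}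
    (hlab : ∀ e : F.edges, lab e = some (.inl (l e))) :
    homDensity μ F w l =
      ∫ ξ, forestFun μ (coordKernel w) F.edges lab (fun _ => .one) ξ ∂(Measure.pi fun _ => μ) := by
  have hK := kernelFamily_coord (μ := μ) hw hw1
  have hint : Integrable (fun ξ : V → I => pureTensor fun e : F.edges => w (ξ e.1.1, ξ e.1.2))
      (Measure.pi fun _ => μ) :=
    Integrable.of_eval_piLp fun m => by
      simp only [← forestFun_coordKernel (μ := μ) F m (extendLabel_coe m)]
      exact integrable_forestFun hK F.ne_of_mem _ _
  simp only [forestFun_coordKernel F l hlab]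
  exact (ContinuousLinearMap.integral_comp_comm (EuclideanSpace.proj (𝕜 := ℝ) l) hint).symm

end Density

/-! ### Adding a leaf to an oriented tree -/

section AddLeaf

variable {V : Type} [Fintype V] [DecidableEq V]

/-- The edges of a graph, as edges on the vertex set with one vertex added. -/
def someEdges (E : Finset (V × V)) : Finset (Option V × Option V) :=
  E.map (Function.Embedding.some.prodMap Function.Embedding.some)

theorem mem_someEdges {E : Finset (V × V)} {e : Option V × Option V} :
    e ∈ someEdges E ↔ ∃ i j, (i, j) ∈ E ∧ e = (some i, some j) := by
  simp only [someEdges, Finset.mem_map, Prod.exists]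
  constructor
  · rintro ⟨i, j, h, rfl⟩
    exact ⟨i, j, h, rfl⟩
  · rintro ⟨i, j, h, rfl⟩
    exact ⟨i, j, h, rfl⟩

/-- The graph with one more vertex, joined to `p` by the edge `e₀`. -/
def OrientedGraph.addLeaf (F : OrientedGraph V) (p : V) (e₀ : Option V × Option V)
    (he₀ : e₀ = (some p, none) ∨ e₀ = (none, some p)) : OrientedGraph (Option V) where
  edges := insert e₀ (someEdges F.edges)
  asymm := by
    intro i j hij hji
    rw [Finset.mem_insert, mem_someEdges] at hij hji
    rcases hij with hij | ⟨a, b, hab, hij⟩ <;> rcases hji with hji | ⟨a', b', hab', hji⟩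
    · rcases he₀ with rfl | rfl <;> simp_all
    · rcases he₀ with rfl | rfl <;> simp_all
    · rcases he₀ with rfl | rfl <;> simp_all
    · simp only [Prod.mk.injEq] at hij hji
      obtain ⟨rfl, rfl⟩ := hij
      obtain ⟨h1, h2⟩ := hji
      obtain rfl := Option.some.inj h1
      obtain rfl := Option.some.inj h2
      exact F.asymm _ _ hab hab'

theorem OrientedGraph.adj_iff (F : OrientedGraph V) (i j : V) :
    F.toSimpleGraph.Adj i j ↔ i ≠ j ∧ ((i, j) ∈ F.edges ∨ (j, i) ∈ F.edges) :=
  SimpleGraph.fromRel_adj _ i j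

/-- Antisymmetry makes the passage to unoriented edges injective. Trees can then be recognized by
connectedness and a count of directed edges, which is easy to maintain when a leaf is added. -/
theorem OrientedGraph.card_edgeSet (F : OrientedGraph V) :
    Nat.card F.toSimpleGraph.edgeSet = F.edges.card := by
  rw [← Fintype.card_coe, ← Nat.card_eq_fintype_card]
  symm
  refine Nat.card_congr (Equiv.ofBijective (fun e : F.edges => (⟨s(e.1.1, e.1.2), ?_⟩ :
    F.toSimpleGraph.edgeSet)) ⟨?_, ?_⟩)
  · exact (F.adj_iff _ _).2 ⟨F.ne_of_mem _ e.2, .inl e.2⟩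
  · rintro ⟨⟨i, j⟩, h⟩ ⟨⟨i', j'⟩, h'⟩ heq
    have : s(i, j) = s(i', j') := congrArg Subtype.val heq
    rcases Sym2.eq_iff.1 this with ⟨rfl, rfl⟩ | ⟨rfl, rfl⟩
    · rfl
    · exact absurd h' (F.asymm _ _ h)
  · rintro ⟨e, he⟩
    induction e with
    | h i j =>
      rcases ((F.adj_iff i j).1 he).2 with h | h
      · exact ⟨⟨(i, j), h⟩, rfl⟩
      · exact ⟨⟨(j, i), h⟩, Subtype.ext Sym2.eq_swap⟩

theorem OrientedGraph.isOrientedTree_iff (F : OrientedGraph V) :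
    F.IsOrientedTree ↔ F.toSimpleGraph.Connected ∧ F.edges.card + 1 = Fintype.card V := by
  rw [IsOrientedTree, SimpleGraph.isTree_iff_connected_and_card, F.card_edgeSet,
    Nat.card_eq_fintype_card]

theorem OrientedGraph.IsOrientedTree.addLeaf {F : OrientedGraph V} (hF : F.IsOrientedTree) {p : V}
    {e₀ : Option V × Option V} (he₀ : e₀ = (some p, none) ∨ e₀ = (none, some p)) :
    (F.addLeaf p e₀ he₀).IsOrientedTree := by
  rw [isOrientedTree_iff] at hF ⊢
  obtain ⟨hconn, hcard⟩ := hF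
  have hleaf : (F.addLeaf p e₀ he₀).toSimpleGraph.Adj (some p) none := by
    rw [adj_iff]
    refine ⟨by simp, ?_⟩
    rcases he₀ with rfl | rfl
    · exact .inl (Finset.mem_insert_self _ _)
    · exact .inr (Finset.mem_insert_self _ _)
  let f : F.toSimpleGraph →g (F.addLeaf p e₀ he₀).toSimpleGraph :=
    { toFun := some
      map_rel' := fun {i j} hij => by
        rw [adj_iff] at hij ⊢
        refine ⟨by simpa using hij.1, hij.2.imp (fun h => ?_) fun h => ?_⟩
        · exact Finset.mem_insert_of_mem (mem_someEdges.2 ⟨i, j, h, rfl⟩)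
        · exact Finset.mem_insert_of_mem (mem_someEdges.2 ⟨j, i, h, rfl⟩) }
  have hreach : ∀ x, (F.addLeaf p e₀ he₀).toSimpleGraph.Reachable (some p) x := by
    rintro (_ | v)
    · exact hleaf.reachable
    · exact (hconn.preconnected p v).map f
  constructor
  · have : Nonempty (Option V) := ⟨none⟩
    exact ⟨fun x y => (hreach x).symm.trans (hreach y)⟩
  · have hnot : e₀ ∉ someEdges F.edges := fun h => by
      obtain ⟨i, j, -, hij⟩ := mem_someEdges.1 h
      rcases he₀ with rfl | rfl <;> simp at hij
    rw [show (F.addLeaf p e₀ he₀).edges = insert e₀ (someEdges F.edges) from rfl,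
      Finset.card_insert_of_notMem hnot, someEdges, Finset.card_map, hcard, Fintype.card_option]

variable {I : Type*} [MeasurableSpace I] {μ : Measure I} [IsProbabilityMeasure μ] {S : Type}
  {inv : S → S} {K : S → I × I → ℝ}

theorem measurePreserving_comp_some (μ : Measure I) [IsProbabilityMeasure μ] :
    MeasurePreserving (fun (ξ : Option V → I) (v : V) => ξ (some v)) (Measure.pi fun _ => μ)
      (Measure.pi fun _ => μ) := by
  have hm : Measurable fun (ξ : Option V → I) (v : V) => ξ (some v) :=
    measurable_pi_lambda _ fun v => measurable_pi_apply _
  refine ⟨hm, (Measure.pi_eq fun s hs => ?_).symm⟩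
  rw [Measure.map_apply hm (MeasurableSet.univ_pi hs)]
  have : (fun (ξ : Option V → I) (v : V) => ξ (some v)) ⁻¹' Set.univ.pi s =
      Set.univ.pi fun o : Option V => o.elim Set.univ s := by
    ext ξ
    simp [Option.forall]
  rw [this, Measure.pi_pi, Fintype.prod_option]
  simp

/-- A branch of a rooted tree may be replaced by a new leaf. -/
theorem integral_forestFun_addLeaf (hK : KernelFamily μ inv K) (F : OrientedGraph V)
    {lab : V × V → S} {lab' : Option V × Option V → S} (hlab : ∀ i j, lab' (some i, some j) = lab (i, j))
    {τ : V → RootedTree S} {p : V} {s : S} {c r : RootedTree S} (hτ : τ p = .graft s c r)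
    {e₀ : Option V × Option V} (he₀ : e₀ = (some p, none) ∨ e₀ = (none, some p))
    (hs : e₀ = (some p, none) ∧ s = lab' e₀ ∨ e₀ = (none, some p) ∧ s = inv (lab' e₀)) :
    ∫ ξ, forestFun μ K (F.addLeaf p e₀ he₀).edges lab'
        (fun o => o.elim c (Function.update τ p r)) ξ ∂(Measure.pi fun _ => μ) =
      ∫ ξ, forestFun μ K F.edges lab τ ξ ∂(Measure.pi fun _ => μ) := by
  have hE : ∀ e ∈ someEdges F.edges, e.1 ≠ e.2 := fun e he => by
    obtain ⟨i, j, hij, rfl⟩ := mem_someEdges.1 he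
    simpa using F.ne_of_mem _ hij
  have hv : ∀ e ∈ someEdges F.edges, e.1 ≠ none ∧ e.2 ≠ none := fun e he => by
    obtain ⟨i, j, hij, rfl⟩ := mem_someEdges.1 he
    simp
  rw [show (F.addLeaf p e₀ he₀).edges = insert e₀ (someEdges F.edges) from rfl,
    integral_forestFun_insert hK hE lab' _ (v := none) (p := some p) (by simp) hv hs]
  have hpt : ∀ ξ : Option V → I, forestFun μ K (someEdges F.edges) lab'
      (Function.update (Function.update (fun o : Option V => o.elim c (Function.update τ p r)) none
        .one) (some p) (.graft s c (Function.update τ p r p))) ξ =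
      forestFun μ K F.edges lab τ fun v => ξ (some v) := by
    intro ξ
    rw [forestFun, forestFun, Fintype.prod_option, someEdges, Finset.prod_map,
      Function.update_of_ne (by simp), Function.update_self]
    simp only [treeFun, one_mul]
    congr 1
    · refine Finset.prod_congr rfl fun e _ => ?_
      rw [← hlab]
      rfl
    · refine Finset.prod_congr rfl fun v _ => ?_
      by_cases hvp : v = p
      · subst hvp
        rw [Function.update_self, Function.update_self, hτ]
      · rw [Function.update_of_ne (by simpa using hvp), Function.update_of_ne (by simp)]
        simp [Function.update_of_ne hvp]
  have hmp := measurePreserving_comp_some (V := V) μ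
  calc _ = ∫ ξ : Option V → I, forestFun μ K F.edges lab τ fun v => ξ (some v)
          ∂(Measure.pi fun _ => μ) := integral_congr_ae (ae_of_all _ hpt)
    _ = _ := by
        conv_rhs => rw [← hmp.map_eq]
        rw [integral_map hmp.aemeasurable (by
          rw [hmp.map_eq]; exact (integrable_forestFun hK F.ne_of_mem lab τ).1)]

end AddLeaf

/-! ### Densities of oriented trees and integrals of rooted trees -/

section Equality

variable {I₁ I₂ : Type*} [MeasurableSpace I₁] [MeasurableSpace I₂] {μ₁ : Measure I₁}
  {μ₂ : Measure I₂} [IsProbabilityMeasure μ₁] [IsProbabilityMeasure μ₂] {d : ℕ}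
  {w : I₁ × I₁ → EuclideanSpace ℝ (Fin d)} {u : I₂ × I₂ → EuclideanSpace ℝ (Fin d)}

theorem homDensity_eq_of_integral_treeFun_eq (hw : Measurable w)
    (hw1 : ∀ᵐ p ∂μ₁.prod μ₁, ‖w p‖ ≤ 1) (hu : Measurable u) (hu1 : ∀ᵐ p ∂μ₂.prod μ₂, ‖u p‖ ≤ 1)
    (h : ∀ t : RootedTree (Option (Fin d ⊕ Fin d)),
      ∫ ξ, treeFun μ₁ (coordKernel w) t ξ ∂μ₁ = ∫ ξ, treeFun μ₂ (coordKernel u) t ξ ∂μ₂)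
    {V : Type} [Fintype V] [DecidableEq V] {F : OrientedGraph V} (hF : F.IsOrientedTree) :
    homDensity μ₁ F w = homDensity μ₂ F u := by
  refine PiLp.ext fun l => ?_
  rw [homDensity_apply hw hw1 F l (extendLabel_coe l), homDensity_apply hu hu1 F l (extendLabel_coe l)]
  exact integral_forestFun_eq (kernelFamily_coord hw hw1) (kernelFamily_coord hu hu1) h F
    hF.isAcyclic _ _

theorem forestFun_eq_zero {I : Type*} [MeasurableSpace I] {μ : Measure I} {d : ℕ}
    {w : I × I → EuclideanSpace ℝ (Fin d)} {V : Type} [Fintype V] [DecidableEq V]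
    {E : Finset (V × V)} {lab : V × V → Option (Fin d ⊕ Fin d)}
    {τ : V → RootedTree (Option (Fin d ⊕ Fin d))} {p : V} {c r : RootedTree (Option (Fin d ⊕ Fin d))}
    (hτ : τ p = .graft none c r) (ξ : V → I) : forestFun μ (coordKernel w) E lab τ ξ = 0 := by
  rw [forestFun, Finset.prod_eq_zero (Finset.mem_univ p), mul_zero]
  simp [hτ, treeFun, adjOp, coordKernel]

/-- Induction on the total number of edges in the attached trees. A branch at `p` is detached and
its edge becomes a genuine edge to a new vertex, which carries the branch; this lowers the total by
one. Without attached trees the integral is a coordinate of a density. -/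
theorem integral_forestFun_eq_of_homDensity_eq (hw : Measurable w)
    (hw1 : ∀ᵐ p ∂μ₁.prod μ₁, ‖w p‖ ≤ 1) (hu : Measurable u) (hu1 : ∀ᵐ p ∂μ₂.prod μ₂, ‖u p‖ ≤ 1)
    (h : ∀ (V : Type) [Fintype V] [DecidableEq V] (T : OrientedGraph V), T.IsOrientedTree →
      homDensity μ₁ T w = homDensity μ₂ T u) (n : ℕ)
    {V : Type} [Fintype V] [DecidableEq V] {F : OrientedGraph V} (hF : F.IsOrientedTree)
    {lab : V × V → Option (Fin d ⊕ Fin d)} (hlab : ∀ e ∈ F.edges, ∃ l, lab e = some (.inl l))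
    {τ : V → RootedTree (Option (Fin d ⊕ Fin d))} (hτ : ∑ v, (τ v).size = n) :
    ∫ ξ, forestFun μ₁ (coordKernel w) F.edges lab τ ξ ∂(Measure.pi fun _ => μ₁) =
      ∫ ξ, forestFun μ₂ (coordKernel u) F.edges lab τ ξ ∂(Measure.pi fun _ => μ₂) := by
  induction n using Nat.strong_induction_on generalizing V with
  | _ n ih =>
    by_cases hall : ∀ v, τ v = .one
    · obtain rfl : τ = fun _ => .one := funext hall
      choose l hl using fun e : F.edges => hlab e e.2
      rw [← homDensity_apply hw hw1 F l hl, ← homDensity_apply hu hu1 F l hl, h V F hF]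
    push Not at hall
    obtain ⟨p, hp⟩ := hall
    cases hτp : τ p with
    | one => exact absurd hτp hp
    | graft s c r =>
      rcases s with _ | s
      · simp only [forestFun_eq_zero hτp]
        simp
      obtain ⟨l, e₀, he₀, hs⟩ : ∃ (l : Fin d) (e₀ : Option V × Option V),
          (e₀ = (some p, none) ∨ e₀ = (none, some p)) ∧
          (e₀ = (some p, none) ∧ some s = some (.inl l) ∨
            e₀ = (none, some p) ∧ some s = coordInv d (some (.inl l))) := by
        -- A transposed label `inr l` is realized by the label `inl l` on an edge directed towards
        -- `p`, so all genuine edges carry coordinates of the kernel itself.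
        rcases s with l | l
        · exact ⟨l, _, .inl rfl, .inl ⟨rfl, rfl⟩⟩
        · exact ⟨l, _, .inr rfl, .inr ⟨rfl, rfl⟩⟩
      let lab' : Option V × Option V → Option (Fin d ⊕ Fin d) := fun e =>
        match e with
        | (some i, some j) => lab (i, j)
        | _ => some (.inl l)
      have hlab₀ : lab' e₀ = some (.inl l) := by
        rcases he₀ with rfl | rfl <;> rfl
      rw [← hlab₀] at hs
      rw [← integral_forestFun_addLeaf (lab' := lab') (kernelFamily_coord hw hw1) F
        (fun _ _ => rfl) hτp he₀ hs,
        ← integral_forestFun_addLeaf (lab' := lab') (kernelFamily_coord hu hu1) F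
        (fun _ _ => rfl) hτp he₀ hs]
      refine ih _ ?_ (hF.addLeaf he₀) (fun e he => ?_) rfl
      · rw [← hτ, Fintype.sum_option, ← Finset.add_sum_erase _ _ (Finset.mem_univ p),
          ← Finset.add_sum_erase _ (fun v => (τ v).size) (Finset.mem_univ p)]
        have herase : ∑ v ∈ Finset.univ.erase p, ((some v).elim c (Function.update τ p r)).size =
            ∑ v ∈ Finset.univ.erase p, (τ v).size := Finset.sum_congr rfl fun v hv => by
          simp [Function.update_of_ne (Finset.ne_of_mem_erase hv)]
        rw [herase, hτp]
        simp [RootedTree.size]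
        omega
      · rcases Finset.mem_insert.1 he with rfl | he
        · exact ⟨l, hlab₀⟩
        · obtain ⟨i, j, hij, rfl⟩ := mem_someEdges.1 he
          exact hlab _ hij

/-- The preceding induction starts from a single vertex with the whole rooted tree attached to it.
-/
theorem integral_treeFun_eq_of_homDensity_eq (hw : Measurable w)
    (hw1 : ∀ᵐ p ∂μ₁.prod μ₁, ‖w p‖ ≤ 1) (hu : Measurable u) (hu1 : ∀ᵐ p ∂μ₂.prod μ₂, ‖u p‖ ≤ 1)
    (h : ∀ (V : Type) [Fintype V] [DecidableEq V] (T : OrientedGraph V), T.IsOrientedTree →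
      homDensity μ₁ T w = homDensity μ₂ T u) (t : RootedTree (Option (Fin d ⊕ Fin d))) :
    ∫ ξ, treeFun μ₁ (coordKernel w) t ξ ∂μ₁ = ∫ ξ, treeFun μ₂ (coordKernel u) t ξ ∂μ₂ := by
  let F : OrientedGraph Unit := ⟨∅, fun _ _ h => absurd h (Finset.notMem_empty _)⟩
  have hF : F.IsOrientedTree := SimpleGraph.IsTree.of_subsingleton
  have := integral_forestFun_eq_of_homDensity_eq hw hw1 hu hu1 h _ hF (lab := fun _ => none)
    (fun e he => absurd he (Finset.notMem_empty _)) (τ := fun _ => t) rfl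
  simpa [F, integral_forestFun_empty] using this

end Equality

end FracIso

theorem theoremC {I₁ : Type*} {I₂ : Type*}
    [MeasurableSpace I₁] [StandardBorelSpace I₁] [MeasurableSpace I₂] [StandardBorelSpace I₂]
    (μ₁ : Measure I₁) [IsProbabilityMeasure μ₁] (μ₂ : Measure I₂) [IsProbabilityMeasure μ₂]
    (d : ℕ)
    (w : I₁ × I₁ → EuclideanSpace ℝ (Fin d)) (hw : Measurable w)
    (hw1 : ∀ᵐ p ∂(μ₁.prod μ₁), ‖w p‖ ≤ 1)
    (u : I₂ × I₂ → EuclideanSpace ℝ (Fin d)) (hu : Measurable u)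
    (hu1 : ∀ᵐ p ∂(μ₂.prod μ₂), ‖u p‖ ≤ 1) :
    List.TFAE [
      -- (1) equal tensorized homomorphism densities of all oriented trees
      ∀ (V : Type) [Fintype V] [DecidableEq V] (T : FracIso.OrientedGraph V), T.IsOrientedTree →
        FracIso.homDensity μ₁ T w = FracIso.homDensity μ₂ T u,
      -- (2) equal distributions on iterated degree measures
      FracIso.degreeLaw μ₁ w = FracIso.degreeLaw μ₂ u,
      -- (3) isomorphic quotients by the canonical sub-sigma-algebras
      FracIso.QuotientsIsomorphic (FracIso.canonicalAlgebra μ₁ w) (FracIso.canonicalAlgebra μ₂ u)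
        μ₁ μ₂ w u,
      -- (4) a coupling that intertwines the adjacency operators
      ∃ γ : FracIso.Coupling μ₁ μ₂, ∀ e : EuclideanSpace ℝ (Fin d),
        (∀ f : I₂ → ℝ, MemLp f 2 μ₂ →
          FracIso.adjOp μ₁ (FracIso.scalarKernel e w) (γ.op f) =ᵐ[μ₁]
            γ.op (FracIso.adjOp μ₂ (FracIso.scalarKernel e u) f)) ∧
        (∀ g : I₁ → ℝ, MemLp g 2 μ₁ →
          γ.transpose.op (FracIso.adjOp μ₁ (FracIso.scalarKernel e w) g) =ᵐ[μ₂]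
            FracIso.adjOp μ₂ (FracIso.scalarKernel e u) (γ.transpose.op g)),
      -- (5) invariant sub-sigma-algebras with averaged kernels at cut distance zero
      ∃ (C : MeasurableSpace I₁) (D : MeasurableSpace I₂),
        FracIso.IsInvariantAlgebra μ₁ w C ∧ FracIso.IsInvariantAlgebra μ₂ u D ∧
        FracIso.cutDist μ₁ μ₂ (FracIso.average C μ₁ w) (FracIso.average D μ₂ u) = 0] := by
  tfae_have 1 → 4 := fun h => FracIso.exists_coupling_of_integral_treeFun_eq hw hw1 hu hu1
    (FracIso.integral_treeFun_eq_of_homDensity_eq hw hw1 hu hu1 h)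
  tfae_have 4 → 2 := by
    rintro ⟨γ, hγ⟩
    exact ((γ.intertwines_iff hw hw1 hu hu1).2 hγ).degreeLaw_eq hw hw1 hu hu1
  tfae_have 2 → 3 := FracIso.quotientsIsomorphic_of_degreeLaw_eq hw hw1 hu hu1
  tfae_have 3 → 5 := fun h => ⟨_, _, FracIso.isInvariantAlgebra_canonicalAlgebra hw hw1,
    FracIso.isInvariantAlgebra_canonicalAlgebra hu hu1, FracIso.cutDist_average_eq_zero h⟩
  tfae_have 5 → 1 := fun h V _ _ T hT => FracIso.homDensity_eq_of_integral_treeFun_eq hw hw1 hu hu1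
    (FracIso.integral_treeFun_eq_of_exists_cutDist_average_eq_zero hw hw1 hu hu1 h) hT
  tfae_finish
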